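/- Consider a cellular network in the plane $\mathbb R^2$. **Model.** The base stations (BSs) form a homogeneous Poisson point process $\Psi$ of density $\lambda_{\rm BS}>0$. Let $\mathsf S$ be a finite set of link states. A link of length $r$ is in state $s\in\mathsf S$ with probability given by the multi-ball model with $\mathcal B$ balls, $$p_s(r)=\sum_{b=1}^{\mathcal B+1} q_s^{b}\,\mathbf 1\{D_{b-1}\le r<D_b\},\qquad 0=D_0\le D_1\le\dots\le D_{\mathcal B+1}=\infty,\quad q_s^b\ge 0,\quad \sum_{s\in\mathsf S} q_s^b=1 .$$ A link of length $r$ in state $s$ has path-loss $l_s(r)=\kappa_s r^{\alpha_s}$ with $\kappa_s,\alpha_s>0$, and log-normal shadowing $\mathcal X_s$ with mean $\mu_s$ and standard deviation $\sigma_s>0$ in dB, i.e. with density $\frac{10}{\ln 10}\frac{1}{\sqrt{2\pi}\,\sigma_s x}\exp\!\big(-\frac{(10\log_{10}x-\mu_s)^2}{2\sigma_s^2}\big)$ on $x>0$. For each location $z$, given the BSs, the pairs (state, shadowing) of the links between $z$ and the different BSs are independent; more precisely, every BS $x\in\Psi$ carries an independent, identically distributed mark that determines, jointly measurably in the displacement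 $z-x$ and the mark, the state and the shadowing of its link to each location $z$. A location $z$ is served by a BS that minimizes $L=l_s(r)/\mathcal X$ over all BSs, where $r$, $s$ and $\mathcal X$ are the length, state and shadowing of the link to $z$. The cell of a BS is the (not necessarily connected) set of all locations that it serves. Let $\Pr^0,\mathbb E^0$ denote probability and expectation under the Palm distribution of the marked point process, under which a typical BS, ${\rm BS}^{(0)}$, is located at the origin. It is given, for any Borel set $W$ with $0<|W|<\infty$, by $\mathbb E^0\{f\}=\frac1{\lambda_{\rm BS}|W|}\,\mathbb E\sum_{x\in\Psi\cap W} f(\text{configuration seen from }x)$. Let $\mathrm{area}$ be the Lebesgue measure of the cell of ${\rm BS}^{(0)}$. For the typical mobile terminal at the origin, under the stationary distribution, let $L_s^{(0)}$ be the minimum of $L$ over the BSs whose link to it is in state $s$ ($+\infty$ if there are none), and let $\mathcal A_s$ be the probability that it is served by a BS whose link to it is in state $s$. Let $$\Lambda_s([0,\xi))=2\pi\lambda_{\rm BS}\,\mathbb E_{\mathcal X_s}\Big\{\int_0^{(\mathcal X_s\xi/\kappa_s)^{1/\alpha_s}}p_s(r)\,r\,dr\Big\}.$$ **Lemma.** $\Pr^0$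 is a probability measure and the area of the cell of ${\rm BS}^{(0)}$ is a random variable. With $\Pr^0\{r\in\mathsf C_s\}$ the conditional probability that a fixed location at distance $r$ from ${\rm BS}^{(0)}$ (in any fixed direction) is served by ${\rm BS}^{(0)}$, given that its link to ${\rm BS}^{(0)}$ is in state $s$ (a term with $p_s(r)=0$ is read as $0$), and with $L_{\tilde s}$ the minimum of $L$ at this location over the BSs other than ${\rm BS}^{(0)}$ whose link to it is in state $\tilde s$, $$\begin{aligned}\mathbb E^0\{\mathrm{area}\}&=2\pi\sum_{s\in\mathsf S}\int_0^\infty \Pr{}^0\{r\in\mathsf C_s\}\,p_s(r)\,r\,dr\\ &=2\pi\sum_{s\in\mathsf S}\int_0^\infty\mathbb E_{\mathcal X_s}\Big\{\prod_{\tilde s\in\mathsf S}\Pr{}^0\Big\{L_{\tilde s}>\frac{\kappa_s r^{\alpha_s}}{\mathcal X_s}\,\Big|\,\mathcal X_s\Big\}\Big\}\,p_s(r)\,r\,dr\\ &=2\pi\sum_{s\in\mathsf S}\int_0^\infty\mathbb E_{\mathcal X_s}\Big\{\exp\Big(-\sum_{\tilde s\in\mathsf S}2\pi\lambda_{\rm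 BS}\,\mathbb E_{\mathcal X_{\tilde s}}\Big\{\int_0^{c_{s,\tilde s}(r,\mathcal X_{\tilde s},\mathcal X_s)}p_{\tilde s}(\tilde r)\,\tilde r\,d\tilde r\Big\}\Big)\Big\}\,p_s(r)\,r\,dr\\ &=\sum_{s\in\mathsf S}\frac{\mathcal A_s}{\lambda_{\rm BS}}=\frac1{\lambda_{\rm BS}},\end{aligned}$$ where $c_{s,\tilde s}(r,x',x)=\big(\frac{x'}{x}\,\frac{\kappa_s}{\kappa_{\tilde s}}\,r^{\alpha_s}\big)^{1/\alpha_{\tilde s}}$, and $\mathcal X_s$, $\mathcal X_{\tilde s}$ are independent shadowing variables. In the second line the event $L_{\tilde s}>\cdot$ means that every BS other than ${\rm BS}^{(0)}$ whose link to the location is in state $\tilde s$ has $L>\cdot$. Moreover, for every $s\in\mathsf S$, $$\mathcal A_s=\mathbb E\Big\{\prod_{\tilde s\ne s}\Pr\{L^{(0)}_{\tilde s}>L^{(0)}_s\mid L^{(0)}_s\}\Big\}=\int_0^\infty\prod_{\tilde s\neq s}\Pr\{L_{\tilde s}^{(0)}>x\}\,f_{L_s^{(0)}}(x)\,dx,$$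 where $f_{L_s^{(0)}}$ is the density of $L_s^{(0)}$ on $(0,\infty)$ (the law of $L_s^{(0)}$ restricted to finite values is absolutely continuous), and the void probabilities are $\Pr\{L_s^{(0)}>x\}=\exp(-\Lambda_s([0,x)))$ for all $x\ge0$. -/

import Mathlib

open MeasureTheory ProbabilityTheory Set
open scoped ENNReal

noncomputable section

/-- The Euclidean plane. -/
abbrev Plane : Type := EuclideanSpace ℝ (Fin 2)

/-- Deterministic parameters of the network with finite set `S` of link states:
density of base stations, path-loss constants and slopes, shadowing mean and standard deviation
(in dB), and the multi-ball link state model with `numBalls` balls.  The radii are indexed so that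
`D 0 = 0` and `D (numBalls + 1) = ∞`; `q b s` is the probability of state `s` for link lengths in
`[D b, D (b + 1))`. -/
structure NetworkParams (S : Type*) [Fintype S] where
  lam : ℝ
  lam_pos : 0 < lam
  kappa : S → ℝ
  kappa_pos : ∀ s, 0 < kappa s
  alpha : S → ℝ
  alpha_pos : ∀ s, 0 < alpha s
  mu : S → ℝ
  sigma : S → ℝ
  sigma_pos : ∀ s, 0 < sigma s
  numBalls : ℕ
  D : Fin (numBalls + 2) → ℝ≥0∞
  D_zero : D 0 = 0
  D_last : D (Fin.last (numBalls + 1)) = ⊤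
  D_mono : Monotone D
  q : Fin (numBalls + 1) → S → ℝ
  q_nonneg : ∀ b s, 0 ≤ q b s
  q_sum : ∀ b, ∑ s, q b s = 1

namespace NetworkParams

variable {S : Type*} [Fintype S] (N : NetworkParams S)

/-- Multi-ball link state model: probability that a link of length `r` is in state `s`. -/
def p (s : S) (r : ℝ) : ℝ :=
  ∑ b : Fin (N.numBalls + 1),
    N.q b s * indicator {ρ : ℝ | N.D b.castSucc ≤ ENNReal.ofReal ρ ∧
      ENNReal.ofReal ρ < N.D b.succ} (fun _ => (1 : ℝ)) r

/-- Distance-dependent path-loss in state `s`. -/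
def pathLoss (s : S) (r : ℝ) : ℝ := N.kappa s * r ^ N.alpha s

/-- Log-normal density of the shadowing in state `s`, parameters in dB. -/
def shadowPDF (s : S) (x : ℝ) : ℝ :=
  if 0 < x then
    10 / Real.log 10 * (1 / (Real.sqrt (2 * Real.pi) * N.sigma s * x)) *
      Real.exp (-(10 * Real.logb 10 x - N.mu s) ^ 2 / (2 * N.sigma s ^ 2))
  else 0

/-- Law of the shadowing in state `s`. -/
def shadowLaw (s : S) : Measure ℝ :=
  volume.withDensity (fun x => ENNReal.ofReal (N.shadowPDF s x))

/-- Intensity of `[0, ξ)` for the point process of the inverse average received powers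
of the links in state `s`. -/
def Lambda (s : S) (ξ : ℝ) : ℝ :=
  2 * Real.pi * N.lam * ∫ x, (∫ r in (0 : ℝ)..(x * ξ / N.kappa s) ^ (1 / N.alpha s),
    N.p s r * r) ∂(N.shadowLaw s)

/-- The radius within which a base station in state `t` with shadowing `x'` beats a link of length
`r` in state `s` with shadowing `x`. -/
def cRadius (s t : S) (r x' x : ℝ) : ℝ :=
  ((x' / x) * (N.kappa s / N.kappa t) * r ^ N.alpha s) ^ (1 / N.alpha t)

end NetworkParams

/-- Random link states and shadowings.  A base station carries a mark `m`, drawn from `ν`; the link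
between it and the location at displacement `y` from it is in state `state y m` and has shadowing
`shadow y m`.  Only the law at each displacement is prescribed; the joint law of the links of one
base station to several locations is arbitrary. -/
structure LinkField {S : Type*} [Fintype S] [MeasurableSpace S] (N : NetworkParams S)
    {M : Type*} [MeasurableSpace M] (ν : Measure M) where
  state : Plane → M → S
  shadow : Plane → M → ℝ
  measurable_state : Measurable (Function.uncurry state)
  measurable_shadow : Measurable (Function.uncurry shadow)
  law : ∀ (y : Plane) (s : S) (A : Set ℝ), MeasurableSet A →
    ν {m | state y m = s ∧ shadow y m ∈ A} = ENNReal.ofReal (N.p s ‖y‖) * N.shadowLaw s A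

/-- Positions and marks of the (enumerated) base stations. -/
abbrev Config (M : Type*) : Type _ := ℕ → Plane × M

namespace LinkField

variable {S : Type*} [Fintype S] [MeasurableSpace S] {N : NetworkParams S}
  {M : Type*} [MeasurableSpace M] {ν : Measure M} (F : LinkField N ν)

/-- State of the link between the location `z` and the base station `b`. -/
def linkState (z : Plane) (b : Plane × M) : S := F.state (z - b.1) b.2

/-- Inverse average received power at `z` from the base station `b`. -/
def invPower (z : Plane) (b : Plane × M) : ℝ :=
  N.pathLoss (F.linkState z b) ‖z - b.1‖ / F.shadow (z - b.1) b.2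

/-- The `n`-th base station of `c` serves `z`: it minimizes the inverse average received power. -/
def Serves (c : Config M) (n : ℕ) (z : Plane) : Prop :=
  ∀ k, F.invPower z (c n) ≤ F.invPower z (c k)

/-- Cell of the `n`-th base station. -/
def cell (c : Config M) (n : ℕ) : Set Plane := {z | F.Serves c n z}

/-- Smallest inverse average received power at the origin among links in state `s`
(`∞` if there is none). -/
def minInvPower (s : S) (c : Config M) : ℝ≥0∞ :=
  open Classical in
  ⨅ n, if F.linkState 0 (c n) = s then ENNReal.ofReal (F.invPower 0 (c n)) else ⊤

end LinkField

/-- Number of points of the enumerated point process `X` in `A`. -/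
def pointCount {Ω : Type*} (X : ℕ → Ω → Plane) (A : Set Plane) (ω : Ω) : ℕ∞ :=
  {n | X n ω ∈ A}.encard

/-- The points `X 0, X 1, …` form a homogeneous Poisson point process of density `lam` in the
plane. -/
structure IsHomogeneousPPP {Ω : Type*} [MeasurableSpace Ω] (P : Measure Ω) (lam : ℝ)
    (X : ℕ → Ω → Plane) : Prop where
  measurable : ∀ n, Measurable (X n)
  count_law : ∀ A : Set Plane, MeasurableSet A → volume A < ⊤ → ∀ k : ℕ,
    P {ω | pointCount X A ω = k} = poissonMeasure (lam * (volume A).toReal).toNNReal {k}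
  count_indep : ∀ (j : ℕ) (A : Fin j → Set Plane), (∀ i, MeasurableSet (A i)) →
    (∀ i, volume (A i) < ⊤) → Pairwise (fun i i' => Disjoint (A i) (A i')) →
    iIndepFun (fun i => pointCount X (A i)) P

/-- The marks `K n` are i.i.d. with law `ν` and independent of the points `X n`. -/
structure IsIndependentMarking {Ω : Type*} [MeasurableSpace Ω] (P : Measure Ω)
    (X : ℕ → Ω → Plane) {M : Type*} [MeasurableSpace M] (ν : Measure M) (K : ℕ → Ω → M) :
    Prop where
  measurable : ∀ n, Measurable (K n)
  law : ∀ n, P.map (K n) = ν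
  iid : iIndepFun K P
  indep : IndepFun (fun ω n => X n ω) (fun ω n => K n ω) P

section Palm

variable {Ω : Type*} [MeasurableSpace Ω] {M : Type*} [MeasurableSpace M]

/-- The random configuration of base stations. -/
def config (X : ℕ → Ω → Plane) (K : ℕ → Ω → M) (ω : Ω) : Config M := fun k => (X k ω, K k ω)

/-- Palm distribution of a stationary marked point process of density `lam`, computed with the
window `W`: the measure
`A ↦ (lam * |W|)⁻¹ * E[∑ n, 1{X n ∈ W} 1{configuration seen from X n belongs to A}]`.
A point `(n, c)` consists of the configuration `c`, translated so that the typical base station is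
at the origin, and of the index `n` of the typical base station. -/
def palm (P : Measure Ω) (lam : ℝ) (X : ℕ → Ω → Plane) (K : ℕ → Ω → M) (W : Set Plane) :
    Measure (ℕ × Config M) :=
  (ENNReal.ofReal lam * volume W)⁻¹ •
    Measure.sum (fun n => (P.restrict {ω | X n ω ∈ W}).map
      (fun ω => (n, fun k => (X k ω - X n ω, K k ω))))

end Palm

section Association

variable {S : Type*} [Fintype S] [MeasurableSpace S] {N : NetworkParams S}
  {M : Type*} [MeasurableSpace M] {ν : Measure M}
  {Ω : Type*} [MeasurableSpace Ω]

/-- Mean area (Lebesgue measure) of the cell of the typical base station under `Q`. -/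
def meanCellArea (F : LinkField N ν) (Q : Measure (ℕ × Config M)) : ℝ≥0∞ :=
  ∫⁻ a, volume (F.cell a.2 a.1) ∂Q

/-- Probability that the typical mobile terminal, at the origin, is served by a base station whose
link with it is in state `s`. -/
def assocProb (P : Measure Ω) (F : LinkField N ν) (X : ℕ → Ω → Plane) (K : ℕ → Ω → M)
    (s : S) : ℝ≥0∞ :=
  P {ω | ∃ n, F.Serves (config X K ω) n 0 ∧ F.linkState 0 (config X K ω n) = s}

/-- Smallest inverse average received power at the typical mobile terminal in state `s`. -/
def minLink (F : LinkField N ν) (X : ℕ → Ω → Plane) (K : ℕ → Ω → M) (s : S) (ω : Ω) : ℝ≥0∞ :=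
  F.minInvPower s (config X K ω)

/-- The law of `minLink` on the event that it is finite (a sub-probability measure on `ℝ`). -/
def minLinkLaw (P : Measure Ω) (F : LinkField N ν) (X : ℕ → Ω → Plane) (K : ℕ → Ω → M)
    (s : S) : Measure ℝ :=
  (P.restrict {ω | minLink F X K s ω ≠ ⊤}).map (fun ω => (minLink F X K s ω).toReal)

/-- Probability density function of `minLink`. -/
def minLinkPDF (P : Measure Ω) (F : LinkField N ν) (X : ℕ → Ω → Plane) (K : ℕ → Ω → M)
    (s : S) : ℝ → ℝ≥0∞ :=
  (minLinkLaw P F X K s).rnDeriv volume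

end Association

end

/-! The marked base stations form a Poisson process on `Plane × M` with intensity λ·(Lebesgue ⊗ ν).
By the Slivnyak–Mecke theorem, under the Palm distribution the mark of the typical base station has
law ν, and the other base stations, seen from it, are distributed like the original process. A
location z lies in the typical cell iff no other base station has a strictly smaller L at z. Given
the typical mark this is a void event, of probability exp(-intensity of the better links)
(`palm_void`). If the typical link has length r, state s and shadowing x, that intensity is the sum
over t of Λ_t([0, l_s(r)/x)), whatever z is, by translation invariance. Averaging over x gives
`coverage s r`; Fubini in z and polar coordinates then give the integral formulas for the mean area
(`meanCellArea_palm`).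

The same Mecke formula, applied to the number of base stations that serve the origin over a link in
state s, gives λ times the same integral (`tsum_measure_serves`). Almost surely exactly one base
station serves the origin, because L-values have no ties and are locally finite (`ae_regular`).
Hence this mean number is 𝒜_s, and the 𝒜_s add up to 1.

For the formulas for 𝒜_s: void probabilities of unions over the states factorize, so the minima L_s
are independent (`iIndepFun_minLink`), and the server is in state s exactly when L_s is the strict
minimum.

The Poisson hypothesis only speaks of counts in disjoint sets, so the theory is built on the Laplace
functional (`HasPoissonLaplace`). Independent marking averages the exponential over the mark. The
test function ∞·1_B gives void probabilities. Differentiation in the direction 1_A gives Mecke's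
formula for exponential functionals, and since Laplace functionals determine laws of random measures
(`ext_of_laplace`), it extends to the reduced Campbell measure (`reduced_campbell`). -/

noncomputable section

/-! ### The exponential exp(-x) on [0, ∞] and its inverse -/

/-- The function `x ↦ exp (-x)` on `[0, ∞]`. -/
def expNeg (x : ℝ≥0∞) : ℝ≥0∞ := EReal.exp (-(x : EReal))

@[simp] lemma expNeg_zero : expNeg 0 = 1 := by simp [expNeg]

@[simp] lemma expNeg_top : expNeg ⊤ = 0 := by simp [expNeg]

lemma expNeg_antitone : Antitone expNeg := fun x y h => by
  unfold expNeg
  exact EReal.exp_monotone (EReal.neg_le_neg_iff.2 (EReal.coe_ennreal_le_coe_ennreal_iff.2 h))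

lemma expNeg_le_one (x : ℝ≥0∞) : expNeg x ≤ 1 := by
  simpa using expNeg_antitone (zero_le : 0 ≤ x)

lemma expNeg_ne_top (x : ℝ≥0∞) : expNeg x ≠ ⊤ :=
  ((expNeg_le_one x).trans_lt ENNReal.one_lt_top).ne

lemma continuous_expNeg : Continuous expNeg :=
  ENNReal.continuous_exp.comp (continuous_neg.comp continuous_coe_ennreal_ereal)

@[fun_prop]
lemma measurable_expNeg : Measurable expNeg := continuous_expNeg.measurable

lemma expNeg_eq_zero {x : ℝ≥0∞} : expNeg x = 0 ↔ x = ⊤ := by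
  simp [expNeg]

lemma expNeg_ofReal {x : ℝ} (hx : 0 ≤ x) :
    expNeg (ENNReal.ofReal x) = ENNReal.ofReal (Real.exp (-x)) := by
  rw [expNeg, EReal.coe_ennreal_ofReal, max_eq_left hx, ← EReal.coe_neg, EReal.exp_coe]

lemma expNeg_add (x y : ℝ≥0∞) : expNeg (x + y) = expNeg x * expNeg y := by
  rw [expNeg, EReal.coe_ennreal_add, EReal.neg_add (by simp) (by simp), sub_eq_add_neg,
    EReal.exp_add]
  rfl

lemma expNeg_sum {ι : Type*} (s : Finset ι) (f : ι → ℝ≥0∞) :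
    expNeg (∑ i ∈ s, f i) = ∏ i ∈ s, expNeg (f i) := by
  classical
  induction s using Finset.induction_on with
  | empty => simp
  | insert a s ha ih => rw [Finset.sum_insert ha, Finset.prod_insert ha, expNeg_add, ih]

lemma expNeg_mul_nat (a : ℝ≥0∞) (k : ℕ) : expNeg (a * k) = expNeg a ^ k := by
  have := expNeg_sum (Finset.range k) (fun _ => a)
  simpa [mul_comm] using this

lemma tendsto_expNeg_sum_range (f : ℕ → ℝ≥0∞) :
    Filter.Tendsto (fun k => ∏ n ∈ Finset.range k, expNeg (f n)) Filter.atTop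
      (nhds (expNeg (∑' n, f n))) := by
  have := (continuous_expNeg.tendsto _).comp (ENNReal.tendsto_nat_tsum f)
  exact this.congr fun k => expNeg_sum _ _

/-- The inverse of `expNeg` on `[0, 1]`. -/
def negLog (x : ℝ≥0∞) : ℝ≥0∞ := (-(ENNReal.log x)).toENNReal

@[fun_prop]
lemma measurable_negLog : Measurable negLog := by
  unfold negLog
  fun_prop

lemma expNeg_negLog {x : ℝ≥0∞} (hx : x ≤ 1) : expNeg (negLog x) = x := by
  have h : 0 ≤ -(ENNReal.log x) := by simpa using hx
  rw [expNeg, negLog, EReal.coe_toENNReal h, neg_neg, ENNReal.exp_log]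

lemma tendsto_lintegral_expNeg {α : Type*} [MeasurableSpace α] {Q : Measure α}
    [IsFiniteMeasure Q] {f : ℕ → α → ℝ≥0∞} {g : α → ℝ≥0∞} (hf : ∀ j, Measurable (f j))
    (h : ∀ a, Filter.Tendsto (fun j => f j a) Filter.atTop (nhds (g a))) :
    Filter.Tendsto (fun j => ∫⁻ a, expNeg (f j a) ∂Q) Filter.atTop
      (nhds (∫⁻ a, expNeg (g a) ∂Q)) := by
  refine tendsto_lintegral_of_dominated_convergence (fun _ => 1)
    (fun j => measurable_expNeg.comp (hf j)) (fun j => ae_of_all _ fun a => expNeg_le_one _)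
    (by simp) (ae_of_all _ fun a => (continuous_expNeg.tendsto _).comp (h a))

lemma monotone_one_sub_expNeg : Monotone fun x => 1 - expNeg x :=
  fun _ _ h => tsub_le_tsub_left (expNeg_antitone h) 1

lemma continuous_one_sub_expNeg : Continuous fun x => 1 - expNeg x :=
  (ENNReal.continuous_sub_left ENNReal.one_ne_top).comp continuous_expNeg

@[fun_prop]
lemma measurable_one_sub_expNeg : Measurable fun x => 1 - expNeg x :=
  continuous_one_sub_expNeg.measurable

/-! ### Laplace functional of the homogeneous Poisson process -/

/-- The Laplace functional of the points `Y 0, Y 1, …` is that of a Poisson process with intensity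
measure `μ`. -/
structure HasPoissonLaplace {Ω E : Type*} [MeasurableSpace Ω] [MeasurableSpace E]
    (P : Measure Ω) (μ : Measure E) (Y : ℕ → Ω → E) : Prop where
  measurable : ∀ n, Measurable (Y n)
  laplace : ∀ h : E → ℝ≥0∞, Measurable h →
    ∫⁻ ω, expNeg (∑' n, h (Y n ω)) ∂P = expNeg (∫⁻ y, (1 - expNeg (h y)) ∂μ)

section Unmarked

variable {Ω : Type*} [MeasurableSpace Ω] {P : Measure Ω} {lam : ℝ} {X : ℕ → Ω → Plane}

lemma tsum_indicator_eq_pointCount {Ω : Type*} (X : ℕ → Ω → Plane) (A : Set Plane) (ω : Ω) :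
    ∑' n, A.indicator (fun _ => (1 : ℝ≥0∞)) (X n ω) = (pointCount X A ω : ℝ≥0∞) := by
  rw [pointCount, ← ENNReal.tsum_set_one, tsum_subtype {n | X n ω ∈ A} (fun _ => (1 : ℝ≥0∞))]
  rfl

/-- This is the Poisson generating function: with x = exp(-a), the series of e^{-r}(xr)^k/k! sums to
e^{-(1-x)r}. The value a = ∞ is included, as x = 0. -/
lemma lintegral_expNeg_mul_poissonMeasure (r : NNReal) (a : ℝ≥0∞) :
    ∫⁻ k, expNeg (a * (k : ℕ)) ∂(poissonMeasure r) = expNeg ((1 - expNeg a) * r) := by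
  obtain ⟨x, hx0, hx1, hx⟩ : ∃ x : ℝ, 0 ≤ x ∧ x ≤ 1 ∧ expNeg a = ENNReal.ofReal x :=
    ⟨(expNeg a).toReal, ENNReal.toReal_nonneg,
      ENNReal.toReal_le_of_le_ofReal zero_le_one (by simpa using expNeg_le_one a),
      (ENNReal.ofReal_toReal (expNeg_ne_top a)).symm⟩
  have hsum : HasSum (fun k : ℕ => Real.exp (-r) * ((x * r) ^ k / (k.factorial : ℝ)))
      (Real.exp (-r) * Real.exp (x * r)) := by
    refine HasSum.mul_left _ ?_
    rw [Real.exp_eq_exp_ℝ]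
    exact NormedSpace.expSeries_div_hasSum_exp (x * r : ℝ)
  rw [lintegral_countable']
  have hterm : ∀ k : ℕ, expNeg (a * k) * poissonMeasure r {k} =
      ENNReal.ofReal (Real.exp (-r) * ((x * r) ^ k / (k.factorial : ℝ))) := fun k => by
    rw [expNeg_mul_nat, poissonMeasure_singleton, hx, ← ENNReal.ofReal_pow hx0,
      ← ENNReal.ofReal_mul (by positivity)]
    congr 1
    rw [mul_pow]
    ring
  simp_rw [hterm]
  rw [← ENNReal.ofReal_tsum_of_nonneg (fun k => by positivity) hsum.summable, hsum.tsum_eq, hx,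
    ← ENNReal.ofReal_one, ← ENNReal.ofReal_sub _ hx0, ← ENNReal.ofReal_coe_nnreal,
    ← ENNReal.ofReal_mul (by linarith), expNeg_ofReal (mul_nonneg (by linarith) r.coe_nonneg),
    ← Real.exp_add]
  congr 2
  ring

namespace IsHomogeneousPPP

lemma measurable_pointCount (hX : IsHomogeneousPPP P lam X) {A : Set Plane}
    (hA : MeasurableSet A) : Measurable (pointCount X A) := by
  have : Measurable fun ω => (pointCount X A ω : ℝ≥0∞) := by
    simp_rw [← tsum_indicator_eq_pointCount]
    exact Measurable.tsum fun n => (measurable_const.indicator hA).comp (hX.measurable n)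
  refine ENat.measurable_iff.2 fun k => ?_
  have h2 := this (measurableSet_singleton (k : ℝ≥0∞))
  convert h2 using 1
  ext ω
  simp only [mem_preimage, mem_singleton_iff]
  rw [← ENat.toENNReal_coe, ENat.toENNReal_inj]

/-- `count_law` gives the masses of finite values only. They already add up to 1, so domination on
every set together with equal total mass forces equality; in particular the count is almost surely
finite. -/
lemma map_pointCount [IsProbabilityMeasure P] (hX : IsHomogeneousPPP P lam X) {A : Set Plane}
    (hA : MeasurableSet A) (hA' : volume A < ⊤) :
    P.map (pointCount X A) =
      (poissonMeasure (lam * (volume A).toReal).toNNReal).map (Nat.cast : ℕ → ℕ∞) := by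
  have hm := hX.measurable_pointCount hA
  have hc : Measurable (Nat.cast : ℕ → ℕ∞) := measurable_from_top
  have := Measure.isProbabilityMeasure_map (μ := P) hm.aemeasurable
  have := Measure.isProbabilityMeasure_map
    (μ := poissonMeasure (lam * (volume A).toReal).toNNReal) hc.aemeasurable
  symm
  refine Measure.eq_of_le_of_measure_univ_eq ?_ (by simp)
  refine Measure.le_iff.2 fun s hs => ?_
  rw [Measure.map_apply hc hs, ← Measure.tsum_indicator_apply_singleton _ _ (hc hs)]
  calc _ = ∑' k : ℕ, (Nat.cast ⁻¹' s : Set ℕ).indicator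
        (fun k => P.map (pointCount X A) {(k : ℕ∞)}) k := by
        refine tsum_congr fun k => ?_
        refine congrFun (indicator_congr fun k _ => ?_) k
        rw [Measure.map_apply hm (measurableSet_singleton _)]
        exact (hX.count_law A hA hA' k).symm
    _ = ∑' k : (Nat.cast ⁻¹' s : Set ℕ), P.map (pointCount X A) {((k : ℕ) : ℕ∞)} := by
        rw [tsum_subtype (Nat.cast ⁻¹' s : Set ℕ)
          (fun k : ℕ => P.map (pointCount X A) {(k : ℕ∞)})]
    _ = P.map (pointCount X A) (⋃ k : (Nat.cast ⁻¹' s : Set ℕ), {((k : ℕ) : ℕ∞)}) := by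
        rw [measure_iUnion _ (fun k => measurableSet_singleton _)]
        intro i j hij
        simpa [Subtype.ext_iff] using hij
    _ ≤ _ := by
        exact measure_mono (iUnion_subset fun k => singleton_subset_iff.2 k.2)

lemma lintegral_expNeg_mul_pointCount [IsProbabilityMeasure P] (hX : IsHomogeneousPPP P lam X)
    (hlam : 0 ≤ lam) {A : Set Plane} (hA : MeasurableSet A) (hA' : volume A < ⊤) (a : ℝ≥0∞) :
    ∫⁻ ω, expNeg (a * (pointCount X A ω : ℝ≥0∞)) ∂P =
      expNeg ((1 - expNeg a) * (ENNReal.ofReal lam * volume A)) := by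
  have hm := hX.measurable_pointCount hA
  have hc : Measurable (Nat.cast : ℕ → ℕ∞) := measurable_from_top
  have hf : Measurable fun k : ℕ∞ => expNeg (a * (k : ℝ≥0∞)) := measurable_from_top
  rw [← lintegral_map hf hm, hX.map_pointCount hA hA', lintegral_map hf hc]
  simp only [ENat.toENNReal_coe]
  rw [lintegral_expNeg_mul_poissonMeasure]
  congr 2
  change ENNReal.ofReal _ = _
  rw [ENNReal.ofReal_mul hlam, ENNReal.ofReal_toReal hA'.ne]

lemma laplace_finite_sum [IsProbabilityMeasure P] (hX : IsHomogeneousPPP P lam X)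
    (hlam : 0 ≤ lam) {ι : Type*} (s : Finset ι) (a : ι → ℝ≥0∞) (A : ι → Set Plane)
    (hA : ∀ i, MeasurableSet (A i)) (hA' : ∀ i, volume (A i) < ⊤)
    (hd : Pairwise fun i i' => Disjoint (A i) (A i')) :
    ∫⁻ ω, expNeg (∑ i ∈ s, a i * (pointCount X (A i) ω : ℝ≥0∞)) ∂P =
      expNeg (∑ i ∈ s, (1 - expNeg (a i)) * (ENNReal.ofReal lam * volume (A i))) := by
  have hind : iIndepFun (fun i : s => pointCount X (A i)) P := by
    have e := s.equivFin
    have h1 := hX.count_indep s.card (fun k => A (e.symm k)) (fun k => hA _) (fun k => hA' _)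
      (fun i j hij => hd fun h => hij (e.symm.injective (Subtype.ext h)))
    have h2 := h1.precomp e.injective
    simpa using h2
  have hind2 : iIndepFun (fun (i : s) ω => expNeg (a i * (pointCount X (A i) ω : ℝ≥0∞))) P :=
    hind.comp (fun i k => expNeg (a i * (k : ℝ≥0∞))) (fun i => measurable_from_top)
  simp_rw [expNeg_sum, ← Finset.prod_coe_sort s]
  rw [lintegral_prod_eq_prod_lintegral_of_indepFun Finset.univ
    (fun (i : s) ω => expNeg (a i * (pointCount X (A i) ω : ℝ≥0∞))) hind2]
  · exact Finset.prod_congr rfl fun i _ =>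
      hX.lintegral_expNeg_mul_pointCount hlam (hA i) (hA' i) (a i)
  · intro i
    have hf : Measurable fun k : ℕ∞ => expNeg (a i * (k : ℝ≥0∞)) := measurable_from_top
    exact hf.comp (hX.measurable_pointCount (hA i))

lemma laplace_simpleFunc [IsProbabilityMeasure P] (hX : IsHomogeneousPPP P lam X)
    (hlam : 0 ≤ lam) (h : SimpleFunc Plane ℝ≥0∞)
    (hfin : ∀ a, a ≠ 0 → volume (h ⁻¹' {a}) < ⊤) :
    ∫⁻ ω, expNeg (∑' n, h (X n ω)) ∂P =
      expNeg (∫⁻ x, (1 - expNeg (h x)) ∂(ENNReal.ofReal lam • volume)) := by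
  classical
  set s := h.range.filter (· ≠ 0)
  -- The zero level set may have infinite volume but contributes nothing, so it is replaced by the
  -- empty set. The other level sets are disjoint with finite volume, where counts are independent
  -- and Poisson.
  set A : ℝ≥0∞ → Set Plane := fun a => if a = 0 then ∅ else h ⁻¹' {a}
  have hAm : ∀ a, MeasurableSet (A a) := fun a => by
    by_cases ha : a = 0
    · simp [A, ha]
    · simpa [A, ha] using h.measurableSet_preimage _
  have hAf : ∀ a, volume (A a) < ⊤ := fun a => by
    by_cases ha : a = 0
    · simp [A, ha]
    · simpa [A, ha] using hfin a ha
  have hAd : Pairwise fun a b => Disjoint (A a) (A b) := fun a b hab => by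
    by_cases ha : a = 0
    · simp [A, ha]
    by_cases hb : b = 0
    · simp [A, hb]
    · simp only [A, ha, hb, if_false]
      exact (Set.disjoint_singleton.2 hab).preimage _
  have key : ∀ (g : ℝ≥0∞ → ℝ≥0∞), g 0 = 0 → ∀ x : Plane,
      g (h x) = ∑ a ∈ s, g a * (A a).indicator (fun _ => 1) x := fun g hg x => by
    by_cases hx : h x = 0
    · rw [hx, hg, Finset.sum_eq_zero]
      intro a ha
      have ha0 : a ≠ 0 := (Finset.mem_filter.1 ha).2
      have : x ∉ A a := by simp [A, ha0, hx, ha0.symm]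
      simp [this]
    · rw [Finset.sum_eq_single (h x)]
      · have : x ∈ A (h x) := by simp [A, hx]
        simp [this]
      · intro b hb hbx
        have hb0 : b ≠ 0 := (Finset.mem_filter.1 hb).2
        have : x ∉ A b := by simp [A, hb0, hbx.symm]
        simp [this]
      · intro hns
        exact absurd (Finset.mem_filter.2 ⟨h.mem_range_self x, hx⟩) hns
  have h1 : ∀ ω, ∑' n, h (X n ω) = ∑ a ∈ s, a * (pointCount X (A a) ω : ℝ≥0∞) := fun ω => by
    simp_rw [← tsum_indicator_eq_pointCount, ← ENNReal.tsum_mul_left]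
    rw [← Summable.tsum_finsetSum (fun _ _ => ENNReal.summable)]
    exact tsum_congr fun n => key id rfl _
  have h2 : ∫⁻ x, (1 - expNeg (h x)) ∂(ENNReal.ofReal lam • volume) =
      ∑ a ∈ s, (1 - expNeg a) * (ENNReal.ofReal lam * volume (A a)) := by
    simp_rw [key (fun a => 1 - expNeg a) (by simp)]
    rw [lintegral_finsetSum _ fun a _ => (measurable_const.indicator (hAm a)).const_mul _]
    refine Finset.sum_congr rfl fun a _ => ?_
    rw [lintegral_const_mul _ (measurable_const.indicator (hAm a)),
      lintegral_indicator_const (hAm a)]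
    simp
  simp_rw [h1]
  rw [h2]
  exact hX.laplace_finite_sum hlam s id A hAm hAf hAd

/-- The Laplace functional of a homogeneous Poisson point process. -/
theorem hasPoissonLaplace [IsProbabilityMeasure P] (hX : IsHomogeneousPPP P lam X)
    (hlam : 0 ≤ lam) : HasPoissonLaplace P (ENNReal.ofReal lam • volume) X := by
  classical
  refine ⟨hX.measurable, fun h hh => ?_⟩
  -- Cutting the simple approximations off outside balls of radius j gives the nonzero levels finite
  -- volume, and the cut functions still increase to `h`.
  set g : ℕ → SimpleFunc Plane ℝ≥0∞ := fun j =>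
    (SimpleFunc.eapprox h j).restrict (Metric.ball (0 : Plane) j)
  have hg : ∀ j x, g j x = (Metric.ball (0 : Plane) j).indicator (SimpleFunc.eapprox h j) x :=
    fun j x => by
      simp only [g]
      rw [SimpleFunc.restrict_apply _ Metric.isOpen_ball.measurableSet]
  have hmono : ∀ x, Monotone fun j => g j x := fun x i j hij => by
    simp only [hg]
    by_cases hx : x ∈ Metric.ball (0 : Plane) i
    · have hx' : x ∈ Metric.ball (0 : Plane) j :=
        Metric.ball_subset_ball (by exact_mod_cast hij) hx
      simpa [hx, hx'] using SimpleFunc.monotone_eapprox h hij x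
    · simp [hx]
  have hsup : ∀ x, ⨆ j, g j x = h x := fun x => by
    obtain ⟨N, hN⟩ := exists_nat_gt ‖x‖
    rw [← SimpleFunc.iSup_eapprox_apply hh x]
    refine le_antisymm (iSup_mono fun j => ?_) (iSup_le fun j => ?_)
    · simp only [hg]
      exact indicator_le_self _ _ _
    · refine le_iSup_of_le (max j N) ?_
      have hx : x ∈ Metric.ball (0 : Plane) ((max j N : ℕ) : ℝ) := by
        rw [mem_ball_zero_iff]
        exact hN.trans_le (by exact_mod_cast le_max_right j N)
      simp only [hg, indicator_of_mem hx]
      exact SimpleFunc.monotone_eapprox h (le_max_left j N) x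
  have htend : ∀ x, Filter.Tendsto (fun j => g j x) Filter.atTop (nhds (h x)) := fun x => by
    have := tendsto_atTop_iSup (hmono x)
    rwa [hsup] at this
  have hfin : ∀ j a, a ≠ 0 → volume (g j ⁻¹' {a}) < ⊤ := fun j a ha => by
    refine (measure_mono ?_).trans_lt (measure_ball_lt_top (x := (0 : Plane)) (r := j))
    intro x hx
    by_contra hxb
    have hx' : g j x = a := hx
    rw [hg, indicator_of_notMem hxb] at hx'
    exact ha hx'.symm
  have hL : Filter.Tendsto (fun j => ∫⁻ ω, expNeg (∑' n, g j (X n ω)) ∂P) Filter.atTop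
      (nhds (∫⁻ ω, expNeg (∑' n, h (X n ω)) ∂P)) := by
    refine tendsto_lintegral_expNeg
      (fun j => Measurable.tsum fun n => (g j).measurable.comp (hX.measurable n)) fun ω => ?_
    have : ∑' n, h (X n ω) = ⨆ j, ∑' n, g j (X n ω) := by
      simp_rw [← lintegral_count]
      rw [← lintegral_iSup (f := fun j n => g j (X n ω)) (fun j => measurable_from_top)
        fun i j hij n => hmono _ hij]
      simp_rw [hsup]
    rw [this]
    exact tendsto_atTop_iSup fun i j hij => ENNReal.tsum_le_tsum fun n => hmono _ hij
  have hR : Filter.Tendsto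
      (fun j => expNeg (∫⁻ x, (1 - expNeg (g j x)) ∂(ENNReal.ofReal lam • volume)))
      Filter.atTop
      (nhds (expNeg (∫⁻ x, (1 - expNeg (h x)) ∂(ENNReal.ofReal lam • volume)))) := by
    refine (continuous_expNeg.tendsto _).comp ?_
    refine lintegral_tendsto_of_tendsto_of_monotone
      (fun j => (measurable_one_sub_expNeg.comp (g j).measurable).aemeasurable)
      (ae_of_all _ fun x i j hij => monotone_one_sub_expNeg (hmono x hij))
      (ae_of_all _ fun x => (continuous_one_sub_expNeg.tendsto _).comp (htend x))
  refine tendsto_nhds_unique hL (hR.congr fun j => ?_)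
  exact (hX.laplace_simpleFunc hlam (g j) (hfin j)).symm

end IsHomogeneousPPP

end Unmarked

/-! ### Marking theorem -/

namespace IsIndependentMarking

variable {Ω : Type*} [MeasurableSpace Ω] {P : Measure Ω} [IsProbabilityMeasure P]
  {X : ℕ → Ω → Plane} {M : Type*} [MeasurableSpace M] {ν : Measure M} {K : ℕ → Ω → M}

/-- With the positions frozen, the exponential is a product of independent factors, one per mark.
Finite products are computed by independence and dominated convergence passes to the limit. Writing
each mean as `expNeg (negLog _)` turns the infinite product back into the exponential of a sum over
the points. -/
lemma lintegral_expNeg_marks (hK : IsIndependentMarking P X ν K) {h : Plane × M → ℝ≥0∞}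
    (hh : Measurable h) (x : ℕ → Plane) :
    ∫⁻ ω, expNeg (∑' n, h (x n, K n ω)) ∂P =
      expNeg (∑' n, negLog (∫⁻ m, expNeg (h (x n, m)) ∂ν)) := by
  have hν : IsProbabilityMeasure ν := by
    rw [← hK.law 0]
    exact Measure.isProbabilityMeasure_map (hK.measurable 0).aemeasurable
  have hterm : ∀ n, Measurable fun m => expNeg (h (x n, m)) := fun n =>
    measurable_expNeg.comp (hh.comp measurable_prodMk_left)
  have hle : ∀ n, ∫⁻ m, expNeg (h (x n, m)) ∂ν ≤ 1 := fun n =>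
    (lintegral_mono fun m => expNeg_le_one _).trans (by simp)
  have hfin : ∀ N, ∫⁻ ω, expNeg (∑ n ∈ Finset.range N, h (x n, K n ω)) ∂P =
      ∏ n ∈ Finset.range N, expNeg (negLog (∫⁻ m, expNeg (h (x n, m)) ∂ν)) := fun N => by
    have hind : iIndepFun (fun n ω => expNeg (h (x n, K n ω))) P :=
      hK.iid.comp (fun n m => expNeg (h (x n, m))) hterm
    simp_rw [expNeg_sum]
    rw [lintegral_prod_eq_prod_lintegral_of_indepFun _ (fun n ω => expNeg (h (x n, K n ω))) hind
      fun n => (hterm n).comp (hK.measurable n)]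
    refine Finset.prod_congr rfl fun n _ => ?_
    rw [expNeg_negLog (hle n), ← hK.law n, lintegral_map (hterm n) (hK.measurable n)]
  have h1 : Filter.Tendsto (fun N => ∫⁻ ω, expNeg (∑ n ∈ Finset.range N, h (x n, K n ω)) ∂P)
      Filter.atTop (nhds (∫⁻ ω, expNeg (∑' n, h (x n, K n ω)) ∂P)) :=
    tendsto_lintegral_expNeg (fun N => Finset.measurable_sum _ fun n _ =>
      hh.comp (measurable_const.prodMk (hK.measurable n))) fun ω => ENNReal.tendsto_nat_tsum _
  refine tendsto_nhds_unique h1 ?_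
  simp_rw [hfin]
  exact tendsto_expNeg_sum_range _

/-- Independent marking of a Poisson process gives a Poisson process on the product space. -/
theorem hasPoissonLaplace (hK : IsIndependentMarking P X ν K) {μ : Measure Plane} [SFinite μ]
    (hX : HasPoissonLaplace P μ X) :
    HasPoissonLaplace P (μ.prod ν) (fun n ω => (X n ω, K n ω)) := by
  have hν : IsProbabilityMeasure ν := by
    rw [← hK.law 0]
    exact Measure.isProbabilityMeasure_map (hK.measurable 0).aemeasurable
  refine ⟨fun n => (hX.measurable n).prodMk (hK.measurable n), fun h hh => ?_⟩
  have hXm : Measurable fun ω n => X n ω := measurable_pi_lambda _ hX.measurable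
  have hKm : Measurable fun ω n => K n ω := measurable_pi_lambda _ hK.measurable
  have hI : Measurable fun x => ∫⁻ m, expNeg (h (x, m)) ∂ν :=
    (measurable_expNeg.comp hh).lintegral_prod_right'
  have hΦ : Measurable fun q : (ℕ → Plane) × (ℕ → M) => expNeg (∑' n, h (q.1 n, q.2 n)) :=
    measurable_expNeg.comp (Measurable.tsum fun n => hh.comp
      (((measurable_pi_apply n).comp measurable_fst).prodMk
        ((measurable_pi_apply n).comp measurable_snd)))
  have hprod := (indepFun_iff_map_prod_eq_prod_map_map hXm.aemeasurable hKm.aemeasurable).1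
    hK.indep
  have hPK := Measure.isProbabilityMeasure_map (μ := P) hKm.aemeasurable
  -- Independence of positions and marks lets Fubini integrate out the marks. What remains is the
  -- Laplace functional of the positions at the test function x ↦ `negLog` of the mean of exp(-h(x,
  -- ·)).
  have e1 : ∫⁻ ω, expNeg (∑' n, h (X n ω, K n ω)) ∂P =
      ∫⁻ ω, expNeg (∑' n, negLog (∫⁻ m, expNeg (h (X n ω, m)) ∂ν)) ∂P := by
    calc _ = ∫⁻ q, expNeg (∑' n, h (q.1 n, q.2 n))
          ∂(P.map fun ω => ((fun n => X n ω), fun n => K n ω)) := by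
          rw [lintegral_map hΦ (hXm.prodMk hKm)]
      _ = ∫⁻ x, ∫⁻ k, expNeg (∑' n, h (x n, k n)) ∂(P.map fun ω n => K n ω)
          ∂(P.map fun ω n => X n ω) := by
          rw [hprod, lintegral_prod _ hΦ.aemeasurable]
      _ = ∫⁻ x, expNeg (∑' n, negLog (∫⁻ m, expNeg (h (x n, m)) ∂ν))
          ∂(P.map fun ω n => X n ω) := by
          refine lintegral_congr fun x => ?_
          have hx : Measurable fun k : ℕ → M => expNeg (∑' n, h (x n, k n)) :=
            hΦ.comp measurable_prodMk_left
          rw [lintegral_map hx hKm, hK.lintegral_expNeg_marks hh]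
      _ = _ := by
          rw [lintegral_map _ hXm]
          exact measurable_expNeg.comp (Measurable.tsum fun n =>
            measurable_negLog.comp (hI.comp (measurable_pi_apply n)))
  have h1 : Measurable fun y => 1 - expNeg (h y) := measurable_one_sub_expNeg.comp hh
  rw [e1, hX.laplace (fun x => negLog (∫⁻ m, expNeg (h (x, m)) ∂ν))
    (measurable_negLog.comp hI), lintegral_prod _ h1.aemeasurable]
  congr 1
  refine lintegral_congr fun x => ?_
  have hle : ∫⁻ m, expNeg (h (x, m)) ∂ν ≤ 1 :=
    (lintegral_mono fun m => expNeg_le_one _).trans (by simp)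
  have hx : Measurable fun m => expNeg (h (x, m)) :=
    measurable_expNeg.comp (hh.comp measurable_prodMk_left)
  rw [expNeg_negLog hle, lintegral_sub hx (hle.trans_lt ENNReal.one_lt_top).ne (ae_of_all _ fun m => expNeg_le_one _)]
  simp

end IsIndependentMarking

lemma negLog_expNeg (x : ℝ≥0∞) : negLog (expNeg x) = x := by
  rw [negLog, expNeg, EReal.log_exp, neg_neg, EReal.toENNReal_coe]

/-! ### Moment problem on a cube -/

section Moments

open BoundedContinuousFunction

variable {ι : Type*} [Fintype ι]

/-- The `i`-th coordinate on the cube. -/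
def cubeCoord (i : ι) : (ι → unitInterval) →ᵇ ℝ :=
  mkOfCompact ⟨fun x => (x i : ℝ), by fun_prop⟩

/-- The algebra generated by the coordinates is the linear span of this monoid, so integrals only
have to be compared on monomials. -/
lemma exists_eq_monomial {f : (ι → unitInterval) →ᵇ ℝ}
    (hf : f ∈ Submonoid.closure (range (cubeCoord (ι := ι)))) :
    ∃ k : ι → ℕ, ∀ x, f x = ∏ i, (x i : ℝ) ^ k i := by
  classical
  induction hf using Submonoid.closure_induction with
  | mem f hf =>
    obtain ⟨i, rfl⟩ := hf
    refine ⟨Pi.single i 1, fun x => ?_⟩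
    rw [Finset.prod_eq_single i]
    · simp [cubeCoord]
    · intro j _ hj
      simp [hj]
    · simp
  | one => exact ⟨0, fun x => by simp⟩
  | mul f g _ _ hf hg =>
    obtain ⟨k, hk⟩ := hf
    obtain ⟨l, hl⟩ := hg
    refine ⟨k + l, fun x => ?_⟩
    simp [hk, hl, pow_add, Finset.prod_mul_distrib]

/-- Finite measures on a cube are determined by their moments. -/
theorem ext_of_moments {Q₁ Q₂ : Measure (ι → unitInterval)} [IsFiniteMeasure Q₁]
    [IsFiniteMeasure Q₂]
    (h : ∀ k : ι → ℕ, ∫ x, ∏ i, (x i : ℝ) ^ k i ∂Q₁ = ∫ x, ∏ i, (x i : ℝ) ^ k i ∂Q₂) :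
    Q₁ = Q₂ := by
  let A : StarSubalgebra ℝ ((ι → unitInterval) →ᵇ ℝ) :=
    { Algebra.adjoin ℝ (range cubeCoord) with
      star_mem' := fun {a} ha => by
        have : star a = a := BoundedContinuousFunction.ext fun x => rfl
        rw [this]
        exact ha }
  -- A point-separating subalgebra of bounded continuous functions determines finite measures on a
  -- Polish space. The two goals are separation by the coordinates and equality of integrals of
  -- polynomials.
  refine ext_of_forall_mem_subalgebra_integral_eq_of_polish (𝕜 := ℝ) (A := A) ?_ ?_
  · intro x y hxy
    obtain ⟨i, hi⟩ := Function.ne_iff.1 hxy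
    refine ⟨_, ⟨toContinuousMapStarₐ ℝ (cubeCoord i), ⟨cubeCoord i, ?_, rfl⟩, rfl⟩, ?_⟩
    · exact Algebra.subset_adjoin ⟨i, rfl⟩
    · intro hc
      exact hi (Subtype.ext hc)
  · intro g hg
    have hg' : g ∈ Submodule.span ℝ (Submonoid.closure (range (cubeCoord (ι := ι)))
        : Set ((ι → unitInterval) →ᵇ ℝ)) := by
      rw [← Algebra.adjoin_eq_span]
      exact hg
    clear hg
    induction hg' using Submodule.span_induction with
    | mem f hf =>
      obtain ⟨k, hk⟩ := exists_eq_monomial hf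
      simp_rw [hk]
      exact h k
    | zero => simp
    | add f g _ _ hf hg =>
      simp only [BoundedContinuousFunction.coe_add, Pi.add_apply]
      rw [integral_add (f.integrable _) (g.integrable _),
        integral_add (f.integrable _) (g.integrable _), hf, hg]
    | smul c f _ hf =>
      simp only [BoundedContinuousFunction.coe_smul]
      rw [integral_smul, integral_smul, hf]

end Moments

/-! ### Laplace functionals determine the law of a random measure -/

section Giry

variable {E : Type*} [MeasurableSpace E]

/-- The Laplace transform `exp (-ζ B)`, as an element of the unit interval. -/
def expNegCoord (ζ : Measure E) (B : Set E) : unitInterval :=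
  ⟨(expNeg (ζ B)).toReal, ENNReal.toReal_nonneg,
    ENNReal.toReal_le_of_le_ofReal zero_le_one (by simpa using expNeg_le_one _)⟩

lemma measurable_expNegCoord {B : Set E} (hB : MeasurableSet B) :
    Measurable fun ζ : Measure E => expNegCoord ζ B :=
  Measurable.subtype_mk (measurable_expNeg.comp (Measure.measurable_coe hB)).ennreal_toReal

lemma negLog_expNegCoord (ζ : Measure E) (B : Set E) :
    negLog (ENNReal.ofReal (expNegCoord ζ B)) = ζ B := by
  rw [expNegCoord, ENNReal.ofReal_toReal (expNeg_ne_top _), negLog_expNeg]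

/-- The mixed moments of the vector (exp(-ζ B))_B are Laplace functionals at the finite test
functions Σ k_B 1_B, so the cube theorem applies to its law. -/
lemma map_expNegCoord_eq {Q₁ Q₂ : Measure (Measure E)} [IsFiniteMeasure Q₁] [IsFiniteMeasure Q₂]
    (h : ∀ f : E → ℝ≥0∞, Measurable f → (∀ y, f y ≠ ⊤) →
      ∫⁻ ζ, expNeg (∫⁻ y, f y ∂ζ) ∂Q₁ = ∫⁻ ζ, expNeg (∫⁻ y, f y ∂ζ) ∂Q₂)
    (t : Finset (Set E)) (ht : ∀ B ∈ t, MeasurableSet B) :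
    Q₁.map (fun ζ (B : t) => expNegCoord ζ (B : Set E)) =
      Q₂.map (fun ζ (B : t) => expNegCoord ζ (B : Set E)) := by
  have hΦm : Measurable fun (ζ : Measure E) (B : t) => expNegCoord ζ (B : Set E) :=
    measurable_pi_lambda _ fun B => measurable_expNegCoord (ht B B.2)
  refine ext_of_moments fun k => ?_
  have hcont : Continuous fun x : t → unitInterval => ∏ i, (x i : ℝ) ^ k i := by fun_prop
  rw [integral_map hΦm.aemeasurable hcont.aestronglyMeasurable,
    integral_map hΦm.aemeasurable hcont.aestronglyMeasurable]
  have hind : ∀ B : t, Measurable ((B : Set E).indicator (1 : E → ℝ≥0∞)) := fun B =>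
    measurable_one.indicator (ht B B.2)
  have hk : ∀ ζ : Measure E, ∏ B : t, (expNegCoord ζ (B : Set E) : ℝ) ^ k B =
      (expNeg (∫⁻ y, ∑ B : t, (k B : ℝ≥0∞) * (B : Set E).indicator 1 y ∂ζ)).toReal := by
    intro ζ
    rw [lintegral_finsetSum _ fun B _ => (hind B).const_mul _, expNeg_sum, ENNReal.toReal_prod]
    refine Finset.prod_congr rfl fun B _ => ?_
    rw [lintegral_const_mul _ (hind B), lintegral_indicator_one (ht B B.2),
      mul_comm, expNeg_mul_nat, ENNReal.toReal_pow]
    rfl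
  have hfm : Measurable fun y => ∑ B : t, (k B : ℝ≥0∞) * (B : Set E).indicator 1 y :=
    Finset.measurable_sum _ fun B _ => (hind B).const_mul _
  have hff : ∀ y, ∑ B : t, (k B : ℝ≥0∞) * (B : Set E).indicator (1 : E → ℝ≥0∞) y ≠ ⊤ :=
    fun y => ENNReal.sum_ne_top.2 fun B _ => ENNReal.mul_ne_top (ENNReal.natCast_ne_top _)
      ((indicator_le_self _ _ y).trans_lt ENNReal.one_lt_top).ne
  have hm : Measurable fun ζ : Measure E =>
      expNeg (∫⁻ y, ∑ B : t, (k B : ℝ≥0∞) * (B : Set E).indicator 1 y ∂ζ) :=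
    measurable_expNeg.comp (Measure.measurable_lintegral hfm)
  simp_rw [hk]
  rw [integral_toReal hm.aemeasurable (ae_of_all _ fun _ => (expNeg_ne_top _).lt_top),
    integral_toReal hm.aemeasurable (ae_of_all _ fun _ => (expNeg_ne_top _).lt_top),
    h _ hfm hff]

/-- Finite measures on the space of measures on `E` are determined by their Laplace functionals. -/
theorem ext_of_laplace {Q₁ Q₂ : Measure (Measure E)} [IsFiniteMeasure Q₁] [IsFiniteMeasure Q₂]
    (h : ∀ f : E → ℝ≥0∞, Measurable f → (∀ y, f y ≠ ⊤) →
      ∫⁻ ζ, expNeg (∫⁻ y, f y ∂ζ) ∂Q₁ = ∫⁻ ζ, expNeg (∫⁻ y, f y ∂ζ) ∂Q₂) :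
    Q₁ = Q₂ := by
  -- The σ-algebra on measures is generated by the evaluations ζ ↦ ζ B, and the cylinder sets form a
  -- π-system. Each cylinder depends only on finitely many exp(-ζ B), since `negLog` recovers ζ B,
  -- also when it is infinite.
  let m : Set E → MeasurableSpace (Measure E) := fun B =>
    MeasurableSpace.comap (fun ζ : Measure E => ζ B) inferInstance
  let S : Set (Set E) := {B | MeasurableSet B}
  have hpre : ∀ s ∈ piiUnionInter (fun B => {s | MeasurableSet[m B] s}) S, Q₁ s = Q₂ s := by
    rintro s ⟨t, ht, f, hf, rfl⟩
    have ht' : ∀ B ∈ t, MeasurableSet B := fun B hB => ht hB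
    choose! U hU hUf using hf
    have hΦm : Measurable fun (ζ : Measure E) (B : t) => expNegCoord ζ (B : Set E) :=
      measurable_pi_lambda _ fun B => measurable_expNegCoord (ht' B B.2)
    have hV : MeasurableSet {x : t → unitInterval |
        ∀ B : t, negLog (ENNReal.ofReal (x B : ℝ)) ∈ U B} := by
      rw [ofPred_forall]
      refine MeasurableSet.iInter fun B => ?_
      have : Measurable fun x : t → unitInterval => negLog (ENNReal.ofReal (x B : ℝ)) := by
        fun_prop
      exact this (hU B B.2)
    have hs : ⋂ B ∈ t, f B = (fun (ζ : Measure E) (B : t) => expNegCoord ζ (B : Set E)) ⁻¹'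
        {x : t → unitInterval | ∀ B : t, negLog (ENNReal.ofReal (x B : ℝ)) ∈ U B} := by
      ext ζ
      simp only [mem_iInter, mem_preimage, mem_ofPred_eq, negLog_expNegCoord, Subtype.forall]
      exact forall₂_congr fun B hB => by rw [← hUf B hB]; rfl
    rw [hs, ← Measure.map_apply hΦm hV, ← Measure.map_apply hΦm hV, map_expNegCoord_eq h t ht']
  refine ext_of_generate_finite _ (generateFrom_piiUnionInter_measurableSet m S).symm
    (isPiSystem_piiUnionInter _ (fun B => @MeasurableSpace.isPiSystem_measurableSet _ (m B)) S)
    hpre ?_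
  exact hpre _ ⟨∅, by simp, fun _ => univ, by simp, by simp⟩

end Giry
-- Void probabilities and Mecke's formula for exponential functionals
lemma one_sub_expNeg_le (x : ℝ≥0∞) : 1 - expNeg x ≤ x := by
  by_cases hx : x = ⊤
  · simp [hx]
  · rw [← ENNReal.ofReal_toReal hx, expNeg_ofReal ENNReal.toReal_nonneg, ← ENNReal.ofReal_one,
      ← ENNReal.ofReal_sub _ (Real.exp_pos _).le]
    refine ENNReal.ofReal_le_ofReal ?_
    linarith [Real.add_one_le_exp (-x.toReal)]

/-- For finite x this is the derivative of u ↦ 1 - exp(-ux) at 0, along a positive sequence. For x =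
∞ the quotient is 1/s_k, which tends to ∞. -/
lemma tendsto_one_sub_expNeg_div {s : ℕ → ℝ≥0∞} (hs : Filter.Tendsto s Filter.atTop (nhds 0))
    (hs0 : ∀ k, s k ≠ 0) (hs1 : ∀ k, s k ≠ ⊤) (x : ℝ≥0∞) :
    Filter.Tendsto (fun k => (1 - expNeg (s k * x)) / s k) Filter.atTop (nhds x) := by
  by_cases hx : x = ⊤
  · subst hx
    simp_rw [ENNReal.mul_top (hs0 _)]
    simp only [expNeg_top, tsub_zero, one_div]
    simpa using tendsto_inv_iff.2 hs
  set ξ := x.toReal with hξ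
  set σ : ℕ → ℝ := fun k => (s k).toReal with hσ
  have hσ0 : ∀ k, 0 < σ k := fun k => ENNReal.toReal_pos (hs0 k) (hs1 k)
  have hσt : Filter.Tendsto σ Filter.atTop (nhdsWithin 0 {0}ᶜ) := by
    refine tendsto_nhdsWithin_iff.2 ⟨?_, Filter.Eventually.of_forall fun k => (hσ0 k).ne'⟩
    exact (ENNReal.tendsto_toReal ENNReal.zero_ne_top).comp hs
  have hd : HasDerivAt (fun u : ℝ => 1 - Real.exp (-(u * ξ))) ξ 0 := by
    have h1 : HasDerivAt (fun u : ℝ => -(u * ξ)) (-ξ) 0 := by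
      simpa only [one_mul, id] using ((hasDerivAt_id (0 : ℝ)).mul_const ξ).fun_neg
    simpa using h1.exp.const_sub 1
  have h2 := (hasDerivAt_iff_tendsto_slope.1 hd).comp hσt
  have h3 : ∀ k, (1 - expNeg (s k * x)) / s k =
      ENNReal.ofReal (slope (fun u : ℝ => 1 - Real.exp (-(u * ξ))) 0 (σ k)) := fun k => by
    have e1 : s k * x = ENNReal.ofReal (σ k * ξ) := by
      rw [ENNReal.ofReal_mul (hσ0 k).le, ENNReal.ofReal_toReal (hs1 k), ENNReal.ofReal_toReal hx]
    rw [e1, expNeg_ofReal (mul_nonneg (hσ0 k).le ENNReal.toReal_nonneg), ← ENNReal.ofReal_one,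
      ← ENNReal.ofReal_sub _ (Real.exp_pos _).le, ← ENNReal.ofReal_toReal (hs1 k),
      ← ENNReal.ofReal_div_of_pos (hσ0 k), slope_def_field]
    simp [hσ, hξ]
  simp_rw [h3]
  rw [← ENNReal.ofReal_toReal hx]
  exact (ENNReal.tendsto_ofReal h2)

lemma MeasureTheory.Measure.ext_of_finite_sets {E : Type*} [MeasurableSpace E]
    (μ : Measure E) [SigmaFinite μ] {m₁ m₂ : Measure E}
    (h : ∀ A, MeasurableSet A → μ A ≠ ⊤ → m₁ A = m₂ A) : m₁ = m₂ := by
  rw [Measure.ext_iff_of_iUnion_eq_univ (iUnion_spanningSets μ)]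
  refine fun i => Measure.ext fun A hA => ?_
  rw [Measure.restrict_apply hA, Measure.restrict_apply hA]
  exact h _ (hA.inter (measurableSet_spanningSets μ i))
    ((measure_mono inter_subset_right).trans_lt (measure_spanningSets_lt_top μ i)).ne

namespace HasPoissonLaplace

variable {Ω E : Type*} [MeasurableSpace Ω] [MeasurableSpace E] {P : Measure Ω}
  {μ : Measure E} {Y : ℕ → Ω → E}

lemma measurable_pi (hY : HasPoissonLaplace P μ Y) : Measurable fun ω k => Y k ω :=
  measurable_pi_lambda _ hY.measurable

/-- Void probabilities. -/
lemma measure_void (hY : HasPoissonLaplace P μ Y) {B : Set E} (hB : MeasurableSet B) :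
    P {ω | ∀ k, Y k ω ∉ B} = expNeg (μ B) := by
  -- With the value ∞ on B, the exponential functional becomes the indicator of the void event.
  have hm : Measurable (B.indicator fun _ => (⊤ : ℝ≥0∞)) := measurable_const.indicator hB
  have hset : MeasurableSet {ω | ∀ k, Y k ω ∉ B} := by
    rw [ofPred_forall]
    exact MeasurableSet.iInter fun k => (hY.measurable k hB).compl
  have h := hY.laplace _ hm
  have h2 : ∫⁻ y, (1 - expNeg (B.indicator (fun _ => (⊤ : ℝ≥0∞)) y)) ∂μ = μ B := by
    rw [← lintegral_indicator_one hB]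
    refine lintegral_congr fun y => ?_
    by_cases hy : y ∈ B <;> simp [hy]
  rw [h2] at h
  rw [← h, ← lintegral_indicator_one hset]
  refine lintegral_congr fun ω => ?_
  by_cases hω : ∀ k, Y k ω ∉ B
  · have hω' : ω ∈ {ω | ∀ k, Y k ω ∉ B} := hω
    rw [indicator_of_mem hω', ENNReal.tsum_eq_zero.2 fun k => indicator_of_notMem (hω k) _]
    simp
  · have hω' : ω ∉ {ω | ∀ k, Y k ω ∉ B} := hω
    rw [indicator_of_notMem hω']
    push Not at hω
    obtain ⟨k, hk⟩ := hω
    rw [ENNReal.tsum_eq_top_of_eq_top ⟨k, by simp [hk]⟩, expNeg_top]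

/-- The Laplace functional is taken at t·1_A + h. On A, 1 - e^{-t-h} = (1 - e^{-t})e^{-h} + (1 -
e^{-h}), which separates the dependence on t. -/
lemma laplace_add_indicator (hY : HasPoissonLaplace P μ Y) {h : E → ℝ≥0∞} (hh : Measurable h)
    {A : Set E} (hA : MeasurableSet A) (t : ℝ≥0∞) :
    ∫⁻ ω, expNeg (t * ∑' n, A.indicator (fun _ => 1) (Y n ω)) * expNeg (∑' n, h (Y n ω)) ∂P =
      expNeg ((1 - expNeg t) * ∫⁻ y in A, expNeg (h y) ∂μ) *
        expNeg (∫⁻ y, (1 - expNeg (h y)) ∂μ) := by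
  have hind : Measurable (A.indicator (fun _ => (1 : ℝ≥0∞))) := measurable_const.indicator hA
  have hE : Measurable fun y => expNeg (h y) := measurable_expNeg.comp hh
  simp_rw [← expNeg_add, ← ENNReal.tsum_mul_left, ← ENNReal.tsum_add]
  rw [hY.laplace (fun y => t * A.indicator (fun _ => 1) y + h y) ((hind.const_mul t).add hh),
    ← lintegral_indicator hA, ← lintegral_const_mul _ (hE.indicator hA),
    ← lintegral_add_left ((hE.indicator hA).const_mul _)]
  congr 1
  refine lintegral_congr fun y => ?_
  by_cases hy : y ∈ A
  · simp only [indicator_of_mem hy, mul_one, expNeg_add]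
    rw [ENNReal.sub_mul fun _ _ => expNeg_ne_top _, one_mul, add_comm,
      tsub_add_tsub_cancel (expNeg_le_one _) (mul_le_of_le_one_left' (expNeg_le_one _))]
  · simp [hy]

/-- This is the derivative at t = 0 of the preceding identity, along t = s_k = 1/(k+1). The
difference quotients converge to the integrand, so Fatou gives ≤; each of them is also below the
integrand, which gives ≥. No prior integrability of the count is needed. -/
lemma lintegral_count_mul_expNeg [IsProbabilityMeasure P] (hY : HasPoissonLaplace P μ Y) {h : E → ℝ≥0∞}
    (hh : Measurable h) {A : Set E} (hA : MeasurableSet A) (hA' : μ A ≠ ⊤) :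
    ∫⁻ ω, (∑' n, A.indicator (fun _ => 1) (Y n ω)) * expNeg (∑' n, h (Y n ω)) ∂P =
      (∫⁻ y in A, expNeg (h y) ∂μ) * expNeg (∫⁻ y, (1 - expNeg (h y)) ∂μ) := by
  set s : ℕ → ℝ≥0∞ := fun k => ((k : ℝ≥0∞) + 1)⁻¹ with hs
  have hs0 : ∀ k, s k ≠ 0 := fun k => by simp [hs]
  have hs1 : ∀ k, s k ≠ ⊤ := fun k => by simp [hs]
  have hst : Filter.Tendsto s Filter.atTop (nhds 0) := by
    have := (Filter.tendsto_add_atTop_iff_nat 1).2 ENNReal.tendsto_inv_nat_nhds_zero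
    simpa [hs] using this
  -- The right side depends on s_k through r_k = 1 - e^{-s_k}; the difference quotient therefore
  -- splits into one in r_k and the factor r_k/s_k, which tends to 1.
  set r : ℕ → ℝ≥0∞ := fun k => 1 - expNeg (s k) with hr
  have hr0 : ∀ k, r k ≠ 0 := fun k => by
    simp only [hr, ne_eq, tsub_eq_zero_iff_le, not_le]
    refine lt_of_le_of_ne (expNeg_le_one _) fun h => hs0 k ?_
    rw [← negLog_expNeg (s k), h]
    simp [negLog]
  have hr1 : ∀ k, r k ≠ ⊤ := fun k => (tsub_le_self.trans_lt ENNReal.one_lt_top).ne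
  have hrt : Filter.Tendsto r Filter.atTop (nhds 0) := by
    have := (continuous_one_sub_expNeg.tendsto 0).comp hst
    rwa [expNeg_zero, tsub_self] at this
  have hrs : Filter.Tendsto (fun k => r k / s k) Filter.atTop (nhds 1) := by
    simpa using tendsto_one_sub_expNeg_div hst hs0 hs1 1
  set a := ∫⁻ y in A, expNeg (h y) ∂μ with ha
  have ha' : a ≠ ⊤ := by
    refine ((lintegral_mono fun y => expNeg_le_one (h y)).trans_lt ?_).ne
    simpa using hA'.lt_top
  set L := expNeg (∫⁻ y, (1 - expNeg (h y)) ∂μ) with hL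
  have hL1 : L ≤ 1 := expNeg_le_one _
  have hind : Measurable (A.indicator (fun _ => (1 : ℝ≥0∞))) := measurable_const.indicator hA
  set N : Ω → ℝ≥0∞ := fun ω => ∑' n, A.indicator (fun _ => 1) (Y n ω) with hN
  have hNm : Measurable N := Measurable.tsum fun n => hind.comp (hY.measurable n)
  set Z : Ω → ℝ≥0∞ := fun ω => expNeg (∑' n, h (Y n ω)) with hZ
  have hZm : Measurable Z :=
    measurable_expNeg.comp (Measurable.tsum fun n => hh.comp (hY.measurable n))
  have hZ1 : ∀ ω, Z ω ≤ 1 := fun ω => expNeg_le_one _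
  have hZint : ∫⁻ ω, Z ω ∂P = L := hY.laplace h hh
  have hFm : ∀ k, Measurable fun ω => (1 - expNeg (s k * N ω)) / s k * Z ω := fun k =>
    ((measurable_one_sub_expNeg.comp (hNm.const_mul _)).div_const _).mul hZm
  have hFlim : ∀ ω, Filter.Tendsto (fun k => (1 - expNeg (s k * N ω)) / s k * Z ω) Filter.atTop
      (nhds (N ω * Z ω)) := fun ω =>
    ENNReal.Tendsto.mul_const (tendsto_one_sub_expNeg_div hst hs0 hs1 _)
      (Or.inr ((hZ1 ω).trans_lt ENNReal.one_lt_top).ne)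
  have hFle : ∀ k ω, (1 - expNeg (s k * N ω)) / s k * Z ω ≤ N ω * Z ω := fun k ω => by
    gcongr
    refine ENNReal.div_le_of_le_mul ?_
    rw [mul_comm]
    exact one_sub_expNeg_le _
  have hFint : ∀ k, ∫⁻ ω, (1 - expNeg (s k * N ω)) / s k * Z ω ∂P =
      (1 - expNeg (r k * a)) / r k * (r k / s k) * L := fun k => by
    have h1 : ∀ ω, (1 - expNeg (s k * N ω)) / s k * Z ω =
        (s k)⁻¹ * (Z ω - expNeg (s k * N ω) * Z ω) := fun ω => by
      rw [div_eq_mul_inv, mul_comm _ (s k)⁻¹, mul_assoc,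
        ENNReal.sub_mul fun _ _ => ((hZ1 ω).trans_lt ENNReal.one_lt_top).ne, one_mul]
    have hm : Measurable fun ω => expNeg (s k * N ω) * Z ω :=
      (measurable_expNeg.comp (hNm.const_mul _)).mul hZm
    have h2 : ∫⁻ ω, expNeg (s k * N ω) * Z ω ∂P = expNeg (r k * a) * L :=
      hY.laplace_add_indicator hh hA (s k)
    simp_rw [h1]
    rw [lintegral_const_mul' _ _ (ENNReal.inv_ne_top.2 (hs0 k)), lintegral_sub hm, hZint, h2]
    · have h3 : L - expNeg (r k * a) * L = (1 - expNeg (r k * a)) * L := by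
        rw [ENNReal.sub_mul fun _ _ => expNeg_ne_top _, one_mul]
      rw [h3, div_eq_mul_inv, div_eq_mul_inv]
      calc _ = (r k)⁻¹ * r k * ((s k)⁻¹ * ((1 - expNeg (r k * a)) * L)) := by
            rw [ENNReal.inv_mul_cancel (hr0 k) (hr1 k), one_mul]
        _ = _ := by ring
    · rw [h2]
      exact ENNReal.mul_ne_top (expNeg_ne_top _) (expNeg_ne_top _)
    · exact ae_of_all _ fun ω => mul_le_of_le_one_left' (expNeg_le_one _)
  have hRlim : Filter.Tendsto (fun k => (1 - expNeg (r k * a)) / r k * (r k / s k) * L)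
      Filter.atTop (nhds (a * L)) := by
    have h1 := ENNReal.Tendsto.mul (tendsto_one_sub_expNeg_div hrt hr0 hr1 a)
      (Or.inr ENNReal.one_ne_top) hrs (Or.inr ha')
    rw [mul_one] at h1
    exact ENNReal.Tendsto.mul_const h1 (Or.inr (expNeg_ne_top _))
  have hle : ∫⁻ ω, N ω * Z ω ∂P ≤ a * L := by
    calc _ = ∫⁻ ω, Filter.liminf (fun k => (1 - expNeg (s k * N ω)) / s k * Z ω) Filter.atTop ∂P :=
          lintegral_congr fun ω => (hFlim ω).liminf_eq.symm
      _ ≤ Filter.liminf (fun k => ∫⁻ ω, (1 - expNeg (s k * N ω)) / s k * Z ω ∂P) Filter.atTop :=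
          lintegral_liminf_le hFm
      _ = a * L := by
          simp_rw [hFint]
          exact hRlim.liminf_eq
  refine le_antisymm hle ?_
  refine le_of_tendsto' (hRlim) fun k => ?_
  rw [← hFint]
  exact lintegral_mono fun ω => hFle k ω

/-- Mecke's formula for a product functional. -/
lemma lintegral_tsum_mul_expNeg [IsProbabilityMeasure P] [SigmaFinite μ]
    (hY : HasPoissonLaplace P μ Y) {h g : E → ℝ≥0∞} (hh : Measurable h) (hg : Measurable g) :
    ∫⁻ ω, ∑' n, g (Y n ω) * expNeg (∑' k, h (Y k ω)) ∂P =
      (∫⁻ y, g y * expNeg (h y) ∂μ) * expNeg (∫⁻ y, (1 - expNeg (h y)) ∂μ) := by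
  set Z : Ω → ℝ≥0∞ := fun ω => expNeg (∑' n, h (Y n ω)) with hZ
  have hZm : Measurable Z :=
    measurable_expNeg.comp (Measurable.tsum fun n => hh.comp (hY.measurable n))
  have hE : Measurable fun y => expNeg (h y) := measurable_expNeg.comp hh
  -- Both sides of the formula are integrals of g against measures on E. These agree on sets of
  -- finite intensity by the count formula, hence everywhere by σ-finiteness.
  have hm : Measure.sum (fun n => (P.withDensity Z).map (Y n)) =
      expNeg (∫⁻ y, (1 - expNeg (h y)) ∂μ) • μ.withDensity (fun y => expNeg (h y)) := by
    refine Measure.ext_of_finite_sets μ fun A hA hA' => ?_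
    rw [Measure.sum_apply _ hA, Measure.smul_apply, withDensity_apply _ hA, smul_eq_mul, mul_comm,
      ← hY.lintegral_count_mul_expNeg hh hA hA']
    simp_rw [← ENNReal.tsum_mul_right]
    rw [lintegral_tsum (f := fun n ω => A.indicator (fun _ => 1) (Y n ω) * Z ω) fun n =>
      (((measurable_const.indicator hA).comp (hY.measurable n)).mul hZm).aemeasurable]
    refine tsum_congr fun n => ?_
    rw [Measure.map_apply (hY.measurable n) hA, withDensity_apply _ (hY.measurable n hA),
      ← lintegral_indicator (hY.measurable n hA)]
    refine lintegral_congr fun ω => ?_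
    by_cases hω : Y n ω ∈ A
    · simp [hω, hZ]
    · simp [hω]
  calc ∫⁻ ω, ∑' n, g (Y n ω) * Z ω ∂P
      = ∑' n, ∫⁻ ω, g (Y n ω) * Z ω ∂P :=
        lintegral_tsum fun n => ((hg.comp (hY.measurable n)).mul hZm).aemeasurable
    _ = ∫⁻ y, g y ∂(Measure.sum (fun n => (P.withDensity Z).map (Y n))) := by
        rw [lintegral_sum_measure]
        refine tsum_congr fun n => ?_
        have hgn : Measurable fun ω => g (Y n ω) := hg.comp (hY.measurable n)
        rw [lintegral_map hg (hY.measurable n),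
          lintegral_withDensity_eq_lintegral_mul _ hZm hgn]
        exact lintegral_congr fun ω => mul_comm _ _
    _ = _ := by
        rw [hm, lintegral_smul_measure, lintegral_withDensity_eq_lintegral_mul _ hE hg, smul_eq_mul,
          mul_comm]
        congr 1
        exact lintegral_congr fun y => mul_comm _ _

/-- Campbell's formula. -/
lemma campbell [IsProbabilityMeasure P] [SigmaFinite μ]
    (hY : HasPoissonLaplace P μ Y) {g : E → ℝ≥0∞} (hg : Measurable g) :
    ∫⁻ ω, ∑' n, g (Y n ω) ∂P = ∫⁻ y, g y ∂μ := by
  simpa using hY.lintegral_tsum_mul_expNeg (h := fun _ => 0) measurable_const hg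

end HasPoissonLaplace

/-! ### Point measures and measurability of void events -/

section PointMeasure

variable {E : Type*} [MeasurableSpace E]

/-- The counting measure of the points `y 0, y 1, …`. -/
def pointMeasure (y : ℕ → E) : Measure E := Measure.sum fun k => Measure.dirac (y k)

/-- The counting measure of the points `y 0, y 1, …` without the `n`-th. -/
def pointMeasureErase (n : ℕ) (y : ℕ → E) : Measure E :=
  Measure.sum fun k => if k = n then 0 else Measure.dirac (y k)

lemma lintegral_pointMeasure (y : ℕ → E) {f : E → ℝ≥0∞} (hf : Measurable f) :
    ∫⁻ x, f x ∂(pointMeasure y) = ∑' k, f (y k) := by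
  rw [pointMeasure, lintegral_sum_measure]
  exact tsum_congr fun k => lintegral_dirac' _ hf

lemma lintegral_pointMeasureErase (n : ℕ) (y : ℕ → E) {f : E → ℝ≥0∞} (hf : Measurable f) :
    ∫⁻ x, f x ∂(pointMeasureErase n y) = ∑' k, if k = n then 0 else f (y k) := by
  rw [pointMeasureErase, lintegral_sum_measure]
  refine tsum_congr fun k => ?_
  split_ifs
  · simp
  · exact lintegral_dirac' _ hf

lemma pointMeasureErase_le (n : ℕ) (y : ℕ → E) : pointMeasureErase n y ≤ pointMeasure y := by
  refine Measure.le_iff.2 fun s hs => ?_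
  rw [pointMeasure, pointMeasureErase, Measure.sum_apply _ hs, Measure.sum_apply _ hs]
  refine ENNReal.tsum_le_tsum fun k => ?_
  split_ifs
  · simp
  · exact le_rfl

lemma pointMeasure_eq_zero_iff (y : ℕ → E) {s : Set E} (hs : MeasurableSet s) :
    pointMeasure y s = 0 ↔ ∀ k, y k ∉ s := by
  rw [pointMeasure, Measure.sum_apply _ hs, ENNReal.tsum_eq_zero]
  exact forall_congr' fun k => by simp [Measure.dirac_apply' _ hs]

lemma pointMeasureErase_eq_zero_iff (n : ℕ) (y : ℕ → E) {s : Set E} (hs : MeasurableSet s) :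
    pointMeasureErase n y s = 0 ↔ ∀ k, k ≠ n → y k ∉ s := by
  rw [pointMeasureErase, Measure.sum_apply _ hs, ENNReal.tsum_eq_zero]
  refine forall_congr' fun k => ?_
  by_cases hk : k = n
  · simp [hk]
  · simp [hk, Measure.dirac_apply' _ hs]

lemma measurable_pointMeasure : Measurable (pointMeasure : (ℕ → E) → Measure E) := by
  refine Measure.measurable_of_measurable_coe _ fun s hs => ?_
  simp_rw [pointMeasure, Measure.sum_apply _ hs, Measure.dirac_apply' _ hs]
  exact Measurable.tsum fun k => (measurable_one.indicator hs).comp (measurable_pi_apply k)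

lemma measurable_pointMeasureErase (n : ℕ) :
    Measurable (pointMeasureErase n : (ℕ → E) → Measure E) := by
  refine Measure.measurable_of_measurable_coe _ fun s hs => ?_
  simp_rw [pointMeasureErase, Measure.sum_apply _ hs]
  refine Measurable.tsum fun k => ?_
  split_ifs
  · simp
  · simp_rw [Measure.dirac_apply' _ hs]
    exact (measurable_one.indicator hs).comp (measurable_pi_apply k)

/-- Measures that give no mass to a measurably varying family of sets, tested on restrictions
to finite masses. -/
lemma measurableSet_forall_restrict_eq_zero {B : Set (E × E)} (hB : MeasurableSet B)
    {S : ℕ → Set E} (hS : ∀ j, MeasurableSet (S j)) :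
    MeasurableSet {q : E × Measure E |
      ∀ j, q.2 (S j) < ⊤ ∧ q.2 (Prod.mk q.1 ⁻¹' B ∩ S j) = 0} := by
  rw [ofPred_forall]
  refine MeasurableSet.iInter fun j => ?_
  -- Measurability of the mass of sections is used for finite kernels. Replacing measures whose mass
  -- on `S j` exceeds K by 0 makes a finite kernel, and when that mass is finite some K leaves the
  -- measure intact.
  have hκ : ∀ K : ℕ, ∃ κ : Kernel (E × Measure E) E, IsFiniteKernel κ ∧
      ∀ q : E × Measure E, κ q = if q.2 (S j) ≤ K then q.2.restrict (S j) else 0 := by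
    intro K
    have hm : Measurable fun q : E × Measure E =>
        if q.2 (S j) ≤ K then q.2.restrict (S j) else 0 :=
      Measurable.ite (((Measure.measurable_coe (hS j)).comp measurable_snd) measurableSet_Iic)
        ((Measure.measurable_of_measurable_coe _ fun s hs => by
          simp_rw [Measure.restrict_apply hs]
          exact (Measure.measurable_coe (hs.inter (hS j))).comp measurable_snd)) measurable_const
    refine ⟨⟨_, hm⟩, ⟨⟨K, by simp, fun q => ?_⟩⟩, fun q => rfl⟩
    change (if q.2 (S j) ≤ K then q.2.restrict (S j) else 0) univ ≤ K
    split_ifs with h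
    · simpa using h
    · simp
  choose κ hκf hκe using hκ
  have hB' : MeasurableSet {q : (E × Measure E) × E | (q.1.1, q.2) ∈ B} :=
    ((measurable_fst.comp measurable_fst).prodMk measurable_snd) hB
  have key : {q : E × Measure E | q.2 (S j) < ⊤ ∧ q.2 (Prod.mk q.1 ⁻¹' B ∩ S j) = 0} =
      {q : E × Measure E | q.2 (S j) < ⊤} ∩
        ⋂ K : ℕ, {q | κ K q (Prod.mk q ⁻¹' {q | (q.1.1, q.2) ∈ B}) = 0} := by
    ext q
    have hBq : MeasurableSet (Prod.mk q.1 ⁻¹' B) := measurable_prodMk_left hB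
    simp only [mem_ofPred_eq, mem_inter_iff, mem_iInter]
    refine and_congr_right fun hq => ?_
    have e : Prod.mk q ⁻¹' {q : (E × Measure E) × E | (q.1.1, q.2) ∈ B} = Prod.mk q.1 ⁻¹' B := rfl
    constructor
    · intro h K
      rw [e, hκe]
      split_ifs
      · rwa [Measure.restrict_apply hBq]
      · simp
    · intro h
      obtain ⟨K, hK⟩ := ENNReal.exists_nat_gt hq.ne
      have := h K
      rwa [e, hκe, if_pos hK.le, Measure.restrict_apply hBq] at this
  rw [key]
  refine MeasurableSet.inter
    (((Measure.measurable_coe (hS j)).comp measurable_snd) measurableSet_Iio)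
    (MeasurableSet.iInter fun K => ?_)
  have := hκf K
  exact (Kernel.measurable_kernel_prodMk_left hB') (measurableSet_singleton 0)

end PointMeasure

/-! ### Slivnyak–Mecke theorem -/

namespace HasPoissonLaplace

variable {Ω E : Type*} [MeasurableSpace Ω] [MeasurableSpace E] {P : Measure Ω}
  [IsProbabilityMeasure P] {μ : Measure E} [SigmaFinite μ] {Y : ℕ → Ω → E}

/-- Mecke's formula with g = 1_A e^{h}: the factor e^{h(Y_n)} cancels the term of the n-th point and
leaves the exponential of the other points. The cancellation needs h finite, which is why only
finite test functions are required in `ext_of_laplace`. -/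
lemma tsum_expNeg_erase (hY : HasPoissonLaplace P μ Y) {h : E → ℝ≥0∞} (hh : Measurable h)
    (hfin : ∀ y, h y ≠ ⊤) {A : Set E} (hA : MeasurableSet A) :
    ∑' n, ∫⁻ ω in {ω | Y n ω ∈ A},
      expNeg (∫⁻ x, h x ∂(pointMeasureErase n fun k => Y k ω)) ∂P =
      μ A * ∫⁻ ω, expNeg (∫⁻ x, h x ∂(pointMeasure fun k => Y k ω)) ∂P := by
  have hE : Measurable fun y => expNeg (h y) := measurable_expNeg.comp hh
  have hE0 : ∀ y, expNeg (h y) ≠ 0 := fun y => fun hy => hfin y (expNeg_eq_zero.1 hy)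
  have h1 := hY.lintegral_tsum_mul_expNeg hh (g := A.indicator fun y => (expNeg (h y))⁻¹)
    (hE.inv.indicator hA)
  have h2 : ∫⁻ y, A.indicator (fun y => (expNeg (h y))⁻¹) y * expNeg (h y) ∂μ = μ A := by
    rw [← lintegral_indicator_one hA]
    refine lintegral_congr fun y => ?_
    by_cases hy : y ∈ A
    · simp [hy, ENNReal.inv_mul_cancel (hE0 y) (expNeg_ne_top _)]
    · simp [hy]
  have h3 : ∫⁻ ω, expNeg (∫⁻ x, h x ∂(pointMeasure fun k => Y k ω)) ∂P =
      expNeg (∫⁻ y, (1 - expNeg (h y)) ∂μ) := by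
    simp_rw [lintegral_pointMeasure _ hh]
    exact hY.laplace h hh
  rw [h3, ← h2, ← h1, lintegral_tsum fun n => ?_]
  · refine tsum_congr fun n => ?_
    have hAn : MeasurableSet {ω | Y n ω ∈ A} := hY.measurable n hA
    rw [← lintegral_indicator hAn]
    refine lintegral_congr fun ω => ?_
    by_cases hω : Y n ω ∈ A
    · have hω' : ω ∈ {ω | Y n ω ∈ A} := hω
      rw [indicator_of_mem hω', indicator_of_mem hω, lintegral_pointMeasureErase n _ hh,
        ENNReal.tsum_eq_add_tsum_ite (f := fun k => h (Y k ω)) n, expNeg_add, ← mul_assoc,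
        ENNReal.inv_mul_cancel (hE0 _) (expNeg_ne_top _), one_mul]
      exact congrArg expNeg (tsum_congr fun k => by split_ifs <;> rfl)
    · have hω' : ω ∉ {ω | Y n ω ∈ A} := hω
      rw [indicator_of_notMem hω', indicator_of_notMem hω, zero_mul]
  · exact (((hE.inv.indicator hA).comp (hY.measurable n)).mul (measurable_expNeg.comp
      (Measurable.tsum fun k => hh.comp (hY.measurable k)))).aemeasurable

/-- The reduced Campbell measure of a Poisson process (Slivnyak–Mecke theorem). -/
theorem reduced_campbell (hY : HasPoissonLaplace P μ Y) :
    Measure.sum (fun n => P.map fun ω => (Y n ω, pointMeasureErase n fun k => Y k ω)) =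
      μ.prod (P.map fun ω => pointMeasure fun k => Y k ω) := by
  have hζ : Measurable fun ω => pointMeasure fun k => Y k ω :=
    measurable_pointMeasure.comp hY.measurable_pi
  have hη : ∀ n, Measurable fun ω => pointMeasureErase n fun k => Y k ω := fun n =>
    (measurable_pointMeasureErase n).comp hY.measurable_pi
  have := Measure.isProbabilityMeasure_map (μ := P) hζ.aemeasurable
  symm
  refine Measure.prod_eq fun A T hA hT => ?_
  have hfin : ∀ A, MeasurableSet A → μ A ≠ ⊤ →
      Measure.sum (fun n => (P.restrict {ω | Y n ω ∈ A}).map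
        fun ω => pointMeasureErase n fun k => Y k ω) =
      μ A • P.map fun ω => pointMeasure fun k => Y k ω := by
    intro A hA hA'
    have hf2 : IsFiniteMeasure (μ A • P.map fun ω => pointMeasure fun k => Y k ω) :=
      Measure.smul_finite _ hA'
    have hL : ∀ f : E → ℝ≥0∞, Measurable f → (∀ y, f y ≠ ⊤) →
        ∫⁻ ζ, expNeg (∫⁻ y, f y ∂ζ) ∂(Measure.sum (fun n => (P.restrict {ω | Y n ω ∈ A}).map
          fun ω => pointMeasureErase n fun k => Y k ω)) =
        ∫⁻ ζ, expNeg (∫⁻ y, f y ∂ζ) ∂(μ A • P.map fun ω => pointMeasure fun k => Y k ω) := by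
      intro f hf hff
      have hm : Measurable fun ζ : Measure E => expNeg (∫⁻ y, f y ∂ζ) :=
        measurable_expNeg.comp (Measure.measurable_lintegral hf)
      rw [lintegral_sum_measure, lintegral_smul_measure, lintegral_map hm hζ, smul_eq_mul,
        ← hY.tsum_expNeg_erase hf hff hA]
      exact tsum_congr fun n => lintegral_map hm (hη n)
    -- The zero test function in `hL` shows that the total mass is `μ A`.
    have hf1 : IsFiniteMeasure (Measure.sum (fun n => (P.restrict {ω | Y n ω ∈ A}).map
        fun ω => pointMeasureErase n fun k => Y k ω)) := by
      constructor
      have h0 := hL (fun _ => 0) measurable_const (by simp)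
      simp only [lintegral_zero, expNeg_zero, lintegral_one] at h0
      rw [h0]
      exact measure_lt_top _ _
    exact ext_of_laplace hL
  -- The roles are exchanged: with T fixed, both sides are measures in the first coordinate, so
  -- agreement on sets of finite intensity extends to every measurable set.
  have hsets : Measure.sum (fun n => (P.restrict {ω | pointMeasureErase n (fun k => Y k ω) ∈ T}).map
      (Y n)) = P.map (fun ω => pointMeasure fun k => Y k ω) T • μ := by
    refine Measure.ext_of_finite_sets μ fun B hB hB' => ?_
    have h0 := congrArg (fun m : Measure (Measure E) => m T) (hfin B hB hB')
    simp only [Measure.sum_apply _ hT, Measure.smul_apply, smul_eq_mul] at h0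
    rw [Measure.sum_apply _ hB, Measure.smul_apply, smul_eq_mul, mul_comm, ← h0]
    refine tsum_congr fun n => ?_
    rw [Measure.map_apply (hY.measurable n) hB, Measure.map_apply (hη n) hT,
      Measure.restrict_apply (hY.measurable n hB), Measure.restrict_apply (hη n hT), inter_comm]
    rfl
  have h0 := congrArg (fun m : Measure E => m A) hsets
  simp only [Measure.sum_apply _ hA, Measure.smul_apply, smul_eq_mul] at h0
  rw [mul_comm, ← h0, Measure.sum_apply _ (hA.prod hT)]
  refine tsum_congr fun n => ?_
  rw [Measure.map_apply (hY.measurable n) hA, Measure.restrict_apply (hY.measurable n hA),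
    Measure.map_apply ((hY.measurable n).prodMk (hη n)) (hA.prod hT)]
  rfl

/-- The points in a set of finite intensity are almost surely finitely many. -/
lemma ae_pointMeasure_lt_top (hY : HasPoissonLaplace P μ Y) {B : Set E} (hB : MeasurableSet B)
    (hB' : μ B ≠ ⊤) : ∀ᵐ ω ∂P, pointMeasure (fun k => Y k ω) B < ⊤ := by
  have h := hY.campbell (measurable_one.indicator hB)
  rw [lintegral_indicator_one hB] at h
  have h2 := ae_lt_top (Measurable.tsum fun n => (measurable_one.indicator hB).comp
    (hY.measurable n)) (h.trans_ne hB')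
  filter_upwards [h2] with ω hω
  rw [pointMeasure, Measure.sum_apply _ hB]
  simpa [Measure.dirac_apply' _ hB] using hω

/-- Mecke's formula for the event that no other point is in a set that depends on the point. -/
theorem tsum_setLIntegral_void (hY : HasPoissonLaplace P μ Y) {B : Set (E × E)}
    (hB : MeasurableSet B) {g : E → ℝ≥0∞} (hg : Measurable g) :
    ∑' n, ∫⁻ ω in {ω | ∀ k, k ≠ n → (Y n ω, Y k ω) ∉ B}, g (Y n ω) ∂P =
      ∫⁻ y, g y * expNeg (μ (Prod.mk y ⁻¹' B)) ∂μ := by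
  set S := spanningSets μ with hS
  have hSm : ∀ j, MeasurableSet (S j) := measurableSet_spanningSets μ
  have hBy : ∀ y, MeasurableSet (Prod.mk y ⁻¹' B) := fun y => measurable_prodMk_left hB
  have hζ : Measurable fun ω => pointMeasure fun k => Y k ω :=
    measurable_pointMeasure.comp hY.measurable_pi
  have hη : ∀ n, Measurable fun ω => pointMeasureErase n fun k => Y k ω := fun n =>
    (measurable_pointMeasureErase n).comp hY.measurable_pi
  have := Measure.isProbabilityMeasure_map (μ := P) hζ.aemeasurable
  -- `T` expresses the void event through the point and the measure of the other points, so that the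
  -- reduced Campbell formula applies. The finiteness on each spanning set makes `T` measurable and
  -- holds almost surely.
  set T : Set (E × Measure E) := {q : E × Measure E |
      ∀ j, q.2 (S j) < ⊤ ∧ q.2 (Prod.mk q.1 ⁻¹' B ∩ S j) = 0} with hT
  have hTm : MeasurableSet T := measurableSet_forall_restrict_eq_zero hB hSm
  have hfin : ∀ᵐ ω ∂P, ∀ j, pointMeasure (fun k => Y k ω) (S j) < ⊤ :=
    ae_all_iff.2 fun j => hY.ae_pointMeasure_lt_top (hSm j) (measure_spanningSets_lt_top μ j).ne
  have hcover : ∀ x, ∃ j, x ∈ S j := fun x => by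
    have : x ∈ ⋃ j, S j := by rw [hS, iUnion_spanningSets]; trivial
    simpa using this
  have hmT : ∀ n, ∀ᵐ ω ∂P, ((Y n ω, pointMeasureErase n fun k => Y k ω) ∈ T ↔
      ∀ k, k ≠ n → (Y n ω, Y k ω) ∉ B) := fun n => by
    filter_upwards [hfin] with ω hω
    simp only [hT, mem_ofPred_eq]
    constructor
    · intro h k hk hkB
      obtain ⟨j, hj⟩ := hcover (Y k ω)
      exact (pointMeasureErase_eq_zero_iff n _ ((hBy _).inter (hSm j))).1 (h j).2 k hk ⟨hkB, hj⟩
    · intro h j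
      refine ⟨(pointMeasureErase_le n _ _).trans_lt (hω j), ?_⟩
      exact (pointMeasureErase_eq_zero_iff n _ ((hBy _).inter (hSm j))).2
        fun k hk hkB => h k hk hkB.1
  have hmT' : ∀ y, P {ω | (y, pointMeasure fun k => Y k ω) ∈ T} = expNeg (μ (Prod.mk y ⁻¹' B)) := by
    intro y
    rw [← hY.measure_void (hBy y)]
    refine measure_congr ?_
    filter_upwards [hfin] with ω hω
    refine propext ⟨fun h k hkB => ?_, fun h j => ⟨hω j, ?_⟩⟩
    · obtain ⟨j, hj⟩ := hcover (Y k ω)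
      exact (pointMeasure_eq_zero_iff _ ((hBy _).inter (hSm j))).1 (h j).2 k ⟨hkB, hj⟩
    · exact (pointMeasure_eq_zero_iff _ ((hBy _).inter (hSm j))).2 fun k hkB => h k hkB.1
  have hG : Measurable fun q : E × Measure E => T.indicator (fun q => g q.1) q :=
    (hg.comp measurable_fst).indicator hTm
  have h1 := congrArg (fun m => ∫⁻ q, T.indicator (fun q => g q.1) q ∂m) hY.reduced_campbell
  rw [lintegral_sum_measure, lintegral_prod _ hG.aemeasurable] at h1
  have hset : ∀ n, MeasurableSet {ω | ∀ k, k ≠ n → (Y n ω, Y k ω) ∉ B} := fun n => by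
    simp_rw [ofPred_forall]
    exact MeasurableSet.iInter fun k => MeasurableSet.iInter fun _ =>
      (((hY.measurable n).prodMk (hY.measurable k)) hB).compl
  calc _ = ∑' n, ∫⁻ q, T.indicator (fun q => g q.1) q
        ∂(P.map fun ω => (Y n ω, pointMeasureErase n fun k => Y k ω)) := by
        refine tsum_congr fun n => ?_
        rw [lintegral_map hG ((hY.measurable n).prodMk (hη n)), ← lintegral_indicator (hset n)]
        refine lintegral_congr_ae ?_
        filter_upwards [hmT n] with ω hω
        by_cases h : ∀ k, k ≠ n → (Y n ω, Y k ω) ∉ B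
        · rw [indicator_of_mem (hω.2 h), indicator_of_mem (by exact h)]
        · rw [indicator_of_notMem fun h' => h (hω.1 h'), indicator_of_notMem (by exact h)]
    _ = _ := by
        rw [h1]
        refine lintegral_congr fun y => ?_
        have hTy : MeasurableSet (Prod.mk y ⁻¹' T) := measurable_prodMk_left hTm
        have hGy : Measurable fun ζ : Measure E => T.indicator (fun q => g q.1) (y, ζ) :=
          hG.comp measurable_prodMk_left
        rw [← hmT' y, lintegral_map hGy hζ]
        have : ∀ ω, T.indicator (fun q => g q.1) (y, pointMeasure fun k => Y k ω) =
            {ω | (y, pointMeasure fun k => Y k ω) ∈ T}.indicator (fun _ => g y) ω := fun ω => rfl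
        simp only [this]
        exact lintegral_indicator_const (hζ hTy) _

end HasPoissonLaplace
-- Polar coordinates, shadowing law and intensities of the links
-- Lebesgue measure off the origin is the product of the sphere measure and r dr; the circle has
-- mass 2π, the dimension times the area π of the unit disc.
lemma lintegral_fun_norm_plane {f : ℝ → ℝ≥0∞} (hf : Measurable f) :
    ∫⁻ z : Plane, f ‖z‖ =
      ENNReal.ofReal (2 * Real.pi) * ∫⁻ r in Ioi (0 : ℝ), f r * ENNReal.ofReal r := by
  have hdim : Module.finrank ℝ Plane = 2 := by simp
  have hball : (volume : Measure Plane) (Metric.ball 0 1) = ENNReal.ofReal Real.pi := by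
    rw [EuclideanSpace.volume_ball]
    simp [one_add_one_eq_two, Real.sq_sqrt Real.pi_pos.le]
  calc ∫⁻ z : Plane, f ‖z‖
      = ∫⁻ z : ({(0)}ᶜ : Set Plane), f ‖z.1‖ ∂((volume : Measure Plane).comap (↑)) := by
        rw [lintegral_subtype_comap (measurableSet_singleton _).compl fun x : Plane => f ‖x‖,
          restrict_compl_singleton]
    _ = ∫⁻ x, f x.2 ∂(volume : Measure Plane).toSphere.prod (.volumeIoiPow (2 - 1)) := by
        have h := (volume : Measure Plane).measurePreserving_homeomorphUnitSphereProd
        rw [hdim] at h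
        have h2 := h.lintegral_comp_emb (Homeomorph.measurableEmbedding _) (fun x => f x.2)
        simpa using h2
    _ = (volume : Measure Plane).toSphere univ *
          ∫⁻ x : Ioi (0 : ℝ), f x ∂.volumeIoiPow 1 := by
        have hm : Measurable fun x : Metric.sphere (0 : Plane) 1 × Ioi (0 : ℝ) => f x.2 :=
          hf.comp (measurable_subtype_coe.comp measurable_snd)
        rw [lintegral_prod _ hm.aemeasurable]
        simp only
        rw [lintegral_const, mul_comm]
    _ = ENNReal.ofReal (2 * Real.pi) * ∫⁻ r in Ioi (0 : ℝ), f r * ENNReal.ofReal r := by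
        rw [Measure.toSphere_apply_univ, hdim, hball, ENNReal.ofReal_mul (by norm_num)]
        congr 1
        · norm_num
        have hfs : Measurable fun x : Ioi (0 : ℝ) => f x := hf.comp measurable_subtype_coe
        rw [Measure.volumeIoiPow, lintegral_withDensity_eq_lintegral_mul _ (by fun_prop) hfs]
        rw [← lintegral_subtype_comap measurableSet_Ioi fun r => f r * ENNReal.ofReal r]
        refine lintegral_congr fun x => ?_
        simp [mul_comm]

namespace NetworkParams

variable {S : Type*} [Fintype S] (N : NetworkParams S)

@[fun_prop]
lemma measurable_p (s : S) : Measurable (N.p s) := by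
  unfold p
  refine Finset.measurable_sum _ fun b _ => Measurable.const_mul (measurable_const.indicator ?_) _
  exact (measurableSet_le measurable_const ENNReal.measurable_ofReal).inter
    (measurableSet_lt ENNReal.measurable_ofReal measurable_const)

lemma p_nonneg (s : S) (r : ℝ) : 0 ≤ N.p s r :=
  Finset.sum_nonneg fun b _ => mul_nonneg (N.q_nonneg b s)
    (indicator_nonneg (fun _ _ => zero_le_one) _)

lemma p_le (s : S) (r : ℝ) : N.p s r ≤ ∑ b, N.q b s := by
  refine Finset.sum_le_sum fun b _ => mul_le_of_le_one_right (N.q_nonneg b s) ?_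
  exact indicator_le_self' (fun _ _ => zero_le_one) _

lemma pathLoss_nonneg (s : S) {r : ℝ} (hr : 0 ≤ r) : 0 ≤ N.pathLoss s r :=
  mul_nonneg (N.kappa_pos s).le (Real.rpow_nonneg hr _)

lemma pathLoss_pos (s : S) {r : ℝ} (hr : 0 < r) : 0 < N.pathLoss s r :=
  mul_pos (N.kappa_pos s) (Real.rpow_pos_of_pos hr _)

@[fun_prop]
lemma measurable_pathLoss (s : S) : Measurable (N.pathLoss s) := by
  unfold pathLoss
  fun_prop

/-- In dB the shadowing is Gaussian: X = exp(Y ln 10 / 10), by change of variables. This yields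
total mass 1, positivity and, through Gaussian exponential moments, all power moments. -/
lemma shadowLaw_eq_map_gaussianReal (s : S) :
    N.shadowLaw s = (gaussianReal (N.mu s) (N.sigma s ^ 2).toNNReal).map
      (fun y => Real.exp (y * (Real.log 10 / 10))) := by
  have hσ := N.sigma_pos s
  have hl : 0 < Real.log 10 := Real.log_pos (by norm_num)
  set c := Real.log 10 / 10 with hc
  have hc0 : 0 < c := by positivity
  have hv : (N.sigma s ^ 2).toNNReal ≠ 0 := by
    simpa using pow_ne_zero 2 hσ.ne'
  have hm : Measurable fun y : ℝ => Real.exp (y * c) := by fun_prop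
  have himg : (fun y : ℝ => Real.exp (y * c)) '' univ = Ioi 0 := by
    ext x
    simp only [image_univ, mem_range, mem_Ioi]
    constructor
    · rintro ⟨y, rfl⟩
      exact Real.exp_pos _
    · intro hx
      exact ⟨Real.log x / c, by rw [div_mul_cancel₀ _ hc0.ne', Real.exp_log hx]⟩
  have hinj : InjOn (fun y : ℝ => Real.exp (y * c)) univ := fun y _ y' _ h =>
    mul_right_cancel₀ hc0.ne' (Real.exp_injective h)
  have hder : ∀ y ∈ (univ : Set ℝ), HasDerivWithinAt (fun y : ℝ => Real.exp (y * c))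
      (Real.exp (y * c) * c) univ y := fun y _ => by
    have := ((hasDerivAt_id y).mul_const c).exp
    simp only [id, one_mul] at this
    exact this.hasDerivWithinAt
  refine Measure.ext fun A hA => ?_
  rw [Measure.map_apply hm hA, gaussianReal_of_var_ne_zero _ hv, withDensity_apply _ (hm hA),
    shadowLaw, withDensity_apply _ hA, ← lintegral_indicator hA, ← lintegral_indicator (hm hA)]
  have h0 : ∀ x, A.indicator (fun x => ENNReal.ofReal (N.shadowPDF s x)) x =
      (Ioi (0 : ℝ)).indicator (A.indicator fun x => ENNReal.ofReal (N.shadowPDF s x)) x := by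
    intro x
    by_cases hx : 0 < x
    · simp [hx]
    · by_cases hxA : x ∈ A <;> simp [hx, hxA, shadowPDF]
  simp_rw [h0]
  rw [lintegral_indicator measurableSet_Ioi, ← himg,
    lintegral_image_eq_lintegral_abs_deriv_mul MeasurableSet.univ hder hinj,
    Measure.restrict_univ]
  refine lintegral_congr fun y => ?_
  by_cases hy : Real.exp (y * c) ∈ A
  · have hy' : y ∈ (fun y : ℝ => Real.exp (y * c)) ⁻¹' A := hy
    rw [indicator_of_mem hy, indicator_of_mem hy', ← ENNReal.ofReal_mul (abs_nonneg _),
      gaussianPDF, abs_of_pos (by positivity), shadowPDF, if_pos (Real.exp_pos _), gaussianPDFReal,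
      Real.coe_toNNReal _ (by positivity)]
    congr 1
    have h1 : 10 * Real.logb 10 (Real.exp (y * c)) = y := by
      rw [Real.logb, Real.log_exp, hc]
      field_simp
    have h2 : Real.sqrt (2 * Real.pi * N.sigma s ^ 2) = Real.sqrt (2 * Real.pi) * N.sigma s := by
      rw [Real.sqrt_mul (by positivity), Real.sqrt_sq hσ.le]
    rw [h1, h2, hc]
    have := (Real.exp_pos (y * (Real.log 10 / 10))).ne'
    field_simp
  · have hy' : y ∉ (fun y : ℝ => Real.exp (y * c)) ⁻¹' A := hy
    rw [indicator_of_notMem hy, indicator_of_notMem hy', mul_zero]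

instance (s : S) : IsProbabilityMeasure (N.shadowLaw s) := by
  rw [shadowLaw_eq_map_gaussianReal]
  exact Measure.isProbabilityMeasure_map (by fun_prop)

lemma shadowLaw_pos (s : S) : ∀ᵐ x ∂(N.shadowLaw s), 0 < x := by
  rw [shadowLaw_eq_map_gaussianReal, ae_map_iff (by fun_prop) measurableSet_Ioi]
  exact ae_of_all _ fun y => Real.exp_pos _

lemma shadowLaw_absolutelyContinuous (s : S) : N.shadowLaw s ≪ volume :=
  withDensity_absolutelyContinuous _ _

lemma lintegral_rpow_shadowLaw (s : S) (a : ℝ) :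
    ∫⁻ x, ENNReal.ofReal (x ^ a) ∂(N.shadowLaw s) < ⊤ := by
  rw [shadowLaw_eq_map_gaussianReal, lintegral_map (by fun_prop) (by fun_prop)]
  have h := (integrable_exp_mul_gaussianReal (μ := N.mu s) (v := (N.sigma s ^ 2).toNNReal)
    (Real.log 10 / 10 * a)).lintegral_lt_top
  refine lt_of_eq_of_lt (lintegral_congr fun y => ?_) h
  rw [← Real.exp_mul]
  congr 2
  ring

/-- The integral of `p s r * r` over `(0, R]`. -/
def radialMass (s : S) (R : ℝ) : ℝ≥0∞ := ∫⁻ r in Ioc (0 : ℝ) R, ENNReal.ofReal (N.p s r * r)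

lemma radialMass_le (s : S) {R : ℝ} (hR : 0 ≤ R) :
    N.radialMass s R ≤ ENNReal.ofReal ((∑ b, N.q b s) * R ^ 2) := by
  have hq : 0 ≤ ∑ b, N.q b s := Finset.sum_nonneg fun b _ => N.q_nonneg b s
  calc N.radialMass s R ≤ ∫⁻ r in Ioc (0 : ℝ) R, ENNReal.ofReal ((∑ b, N.q b s) * R) := by
        refine setLIntegral_mono measurable_const fun r hr => ENNReal.ofReal_le_ofReal ?_
        exact mul_le_mul (N.p_le s r) hr.2 hr.1.le hq
    _ = _ := by
        rw [setLIntegral_const, Real.volume_Ioc, sub_zero,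
          ← ENNReal.ofReal_mul (mul_nonneg hq hR)]
        congr 1
        ring

lemma intervalIntegral_p_mul (s : S) {R : ℝ} (hR : 0 ≤ R) :
    ∫ r in (0 : ℝ)..R, N.p s r * r = (N.radialMass s R).toReal := by
  rw [intervalIntegral.integral_of_le hR, integral_eq_lintegral_of_nonneg_ae, radialMass]
  · filter_upwards [ae_restrict_mem measurableSet_Ioc] with r hr
    exact mul_nonneg (N.p_nonneg s r) hr.1.le
  · exact ((N.measurable_p s).mul measurable_id).aestronglyMeasurable

lemma monotone_radialMass (s : S) : Monotone (N.radialMass s) := fun _ _ h =>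
  lintegral_mono_set (Ioc_subset_Ioc_right h)

/-- The radius at which a link in state `s` with shadowing `x` has inverse average received
power `ξ`. -/
def reach (s : S) (ξ x : ℝ) : ℝ := (x * ξ / N.kappa s) ^ (1 / N.alpha s)

@[fun_prop]
lemma measurable_reach (s : S) (ξ : ℝ) : Measurable (N.reach s ξ) := by
  unfold reach
  fun_prop

/-- The radial mass grows at most quadratically and the reach is a power of the shadowing, so a
log-normal moment bounds the integral. Finiteness ensures that the Bochner integral in `Lambda` has
its true value and not the default 0. -/
lemma lintegral_radialMass_lt_top (s : S) {ξ : ℝ} (hξ : 0 ≤ ξ) :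
    ∫⁻ x, N.radialMass s (N.reach s ξ x) ∂(N.shadowLaw s) < ⊤ := by
  have hκ := N.kappa_pos s
  set C := (∑ b, N.q b s) * ((ξ / N.kappa s) ^ (1 / N.alpha s)) ^ 2
  have hC : 0 ≤ C := mul_nonneg (Finset.sum_nonneg fun b _ => N.q_nonneg b s) (sq_nonneg _)
  calc _ ≤ ∫⁻ x, ENNReal.ofReal C * ENNReal.ofReal (x ^ (1 / N.alpha s * 2)) ∂(N.shadowLaw s) := by
        refine lintegral_mono_ae ?_
        filter_upwards [N.shadowLaw_pos s] with x hx
        refine (N.radialMass_le s (by unfold reach; positivity)).trans (le_of_eq ?_)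
        rw [← ENNReal.ofReal_mul hC, reach, mul_div_assoc, Real.mul_rpow hx.le (by positivity),
          Real.rpow_mul hx.le]
        congr 1
        norm_num [C]
        ring
    _ < ⊤ := by
        rw [lintegral_const_mul' _ _ ENNReal.ofReal_ne_top]
        exact ENNReal.mul_lt_top ENNReal.ofReal_lt_top (N.lintegral_rpow_shadowLaw s _)

lemma Lambda_eq_toReal (s : S) {ξ : ℝ} (hξ : 0 ≤ ξ) :
    N.Lambda s ξ = 2 * Real.pi * N.lam *
      (∫⁻ x, N.radialMass s (N.reach s ξ x) ∂(N.shadowLaw s)).toReal := by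
  have hκ := N.kappa_pos s
  rw [Lambda]
  congr 1
  have hm : Measurable fun x => N.radialMass s (N.reach s ξ x) :=
    (N.monotone_radialMass s).measurable.comp (N.measurable_reach s ξ)
  rw [← integral_toReal hm.aemeasurable (ae_lt_top hm (N.lintegral_radialMass_lt_top s hξ).ne)]
  refine integral_congr_ae ?_
  filter_upwards [N.shadowLaw_pos s] with x hx
  exact N.intervalIntegral_p_mul s (by positivity)

lemma Lambda_nonneg (s : S) {ξ : ℝ} (hξ : 0 ≤ ξ) : 0 ≤ N.Lambda s ξ := by
  have := N.lam_pos
  rw [N.Lambda_eq_toReal s hξ]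
  positivity

lemma ofReal_Lambda (s : S) {ξ : ℝ} (hξ : 0 ≤ ξ) :
    ENNReal.ofReal (N.Lambda s ξ) = ENNReal.ofReal (2 * Real.pi * N.lam) *
      ∫⁻ x, N.radialMass s (N.reach s ξ x) ∂(N.shadowLaw s) := by
  have := N.lam_pos
  rw [N.Lambda_eq_toReal s hξ, ENNReal.ofReal_mul (by positivity),
    ENNReal.ofReal_toReal (N.lintegral_radialMass_lt_top s hξ).ne]

/-- `cRadius` is the reach in state t at the level l_s(r)/x of the competing link. -/
lemma integral_cRadius_eq_Lambda (s t : S) (r x : ℝ) :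
    2 * Real.pi * N.lam * ∫ x', (∫ ρ in (0 : ℝ)..N.cRadius s t r x' x, N.p t ρ * ρ)
      ∂(N.shadowLaw t) = N.Lambda t (N.pathLoss s r / x) := by
  have h : ∀ x', N.cRadius s t r x' x =
      (x' * (N.pathLoss s r / x) / N.kappa t) ^ (1 / N.alpha t) := fun x' => by
    rw [cRadius, pathLoss]
    congr 1
    ring
  simp_rw [h, Lambda]

/-- Intensity of the inverse average received powers of the links in state `s`. -/
def linkIntensity (s : S) (U : Set ℝ) : ℝ≥0∞ :=
  ENNReal.ofReal (2 * Real.pi * N.lam) * ∫⁻ r in Ioi (0 : ℝ),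
    N.shadowLaw s {x | N.pathLoss s r / x ∈ U} * ENNReal.ofReal (N.p s r * r)

/-- For fixed r > 0, the map x ↦ l_s(r)/x is its own inverse and differentiable off 0, so it pulls
null sets back to null sets, and the shadowing has a density. This excludes ties between base
stations and makes the minima absolutely continuous. -/
lemma linkIntensity_eq_zero (s : S) {U : Set ℝ} (hU : volume U = 0) :
    N.linkIntensity s U = 0 := by
  have h : ∀ r ∈ Ioi (0 : ℝ), N.shadowLaw s {x | N.pathLoss s r / x ∈ U} *
      ENNReal.ofReal (N.p s r * r) = 0 := fun r hr => by
    have hl := N.pathLoss_pos s hr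
    have h0 : volume ((fun u : ℝ => N.pathLoss s r / u) '' (U \ {0})) = 0 := by
      refine addHaar_image_eq_zero_of_differentiableOn_of_addHaar_eq_zero volume ?_
        (measure_mono_null sdiff_subset hU)
      intro u hu
      have hu0 : u ≠ 0 := hu.2
      exact (by fun_prop (disch := assumption) :
        DifferentiableAt ℝ (fun u : ℝ => N.pathLoss s r / u) u).differentiableWithinAt
    have h1 : N.shadowLaw s {x | N.pathLoss s r / x ∈ U} = 0 := by
      have h2 := N.shadowLaw_absolutelyContinuous s h0
      refine measure_mono_null_ae ?_ h2
      filter_upwards [N.shadowLaw_pos s] with x hx hxU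
      refine ⟨N.pathLoss s r / x, ⟨hxU, (div_pos hl hx).ne'⟩, ?_⟩
      simp only
      field_simp
    rw [h1, zero_mul]
  rw [linkIntensity, setLIntegral_congr_fun measurableSet_Ioi h]
  simp

lemma linkIntensity_eq_lintegral (s : S) {U : Set ℝ} (hU : MeasurableSet U) :
    N.linkIntensity s U = ENNReal.ofReal (2 * Real.pi * N.lam) * ∫⁻ x,
      (∫⁻ r in Ioi (0 : ℝ) ∩ {r | N.pathLoss s r / x ∈ U}, ENNReal.ofReal (N.p s r * r))
      ∂(N.shadowLaw s) := by
  have hm : Measurable fun q : ℝ × ℝ => N.pathLoss s q.1 / q.2 :=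
    ((N.measurable_pathLoss s).comp measurable_fst).div measurable_snd
  have hset : MeasurableSet {q : ℝ × ℝ | N.pathLoss s q.1 / q.2 ∈ U} := hm hU
  have hpm : Measurable fun r => ENNReal.ofReal (N.p s r * r) :=
    ((N.measurable_p s).mul measurable_id).ennreal_ofReal
  set G : ℝ × ℝ → ℝ≥0∞ := {q : ℝ × ℝ | N.pathLoss s q.1 / q.2 ∈ U}.indicator
    fun q => ENNReal.ofReal (N.p s q.1 * q.1) with hG
  have hGm : Measurable G := (hpm.comp measurable_fst).indicator hset
  rw [linkIntensity]
  congr 1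
  calc _ = ∫⁻ r in Ioi (0 : ℝ), ∫⁻ x, G (r, x) ∂(N.shadowLaw s) := by
        refine lintegral_congr fun r => ?_
        have : ∀ x, G (r, x) = {x | N.pathLoss s r / x ∈ U}.indicator
          (fun _ => ENNReal.ofReal (N.p s r * r)) x := fun x => rfl
        simp_rw [this]
        rw [lintegral_indicator_const, mul_comm]
        exact (hm.comp measurable_prodMk_left) hU
    _ = ∫⁻ x, (∫⁻ r in Ioi (0 : ℝ), G (r, x)) ∂(N.shadowLaw s) :=
        lintegral_lintegral_swap (f := fun r x => G (r, x)) hGm.aemeasurable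
    _ = _ := by
        refine lintegral_congr fun x => ?_
        have hx : MeasurableSet {r | N.pathLoss s r / x ∈ U} :=
          (hm.comp measurable_prodMk_right) hU
        rw [inter_comm, ← Measure.restrict_restrict hx, ← lintegral_indicator hx]
        rfl

lemma pathLoss_div_le_iff (s : S) {r x ξ : ℝ} (hr : 0 ≤ r) (hx : 0 < x) (hξ : 0 ≤ ξ) :
    N.pathLoss s r / x ≤ ξ ↔ r ≤ N.reach s ξ x := by
  have hκ := N.kappa_pos s
  rw [pathLoss, reach, one_div, Real.le_rpow_inv_iff_of_pos hr (by positivity) (N.alpha_pos s),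
    le_div_iff₀ hκ, div_le_iff₀ hx, mul_comm ξ, mul_comm (N.kappa s)]

lemma pathLoss_div_lt_iff (s : S) {r x ξ : ℝ} (hr : 0 ≤ r) (hx : 0 < x) (hξ : 0 ≤ ξ) :
    N.pathLoss s r / x < ξ ↔ r < N.reach s ξ x := by
  have hκ := N.kappa_pos s
  rw [pathLoss, reach, one_div, Real.lt_rpow_inv_iff_of_pos hr (by positivity) (N.alpha_pos s),
    lt_div_iff₀ hκ, div_lt_iff₀ hx, mul_comm ξ, mul_comm (N.kappa s)]

lemma linkIntensity_Iic (s : S) {ξ : ℝ} (hξ : 0 ≤ ξ) :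
    N.linkIntensity s (Iic ξ) = ENNReal.ofReal (N.Lambda s ξ) := by
  rw [N.linkIntensity_eq_lintegral s measurableSet_Iic, N.ofReal_Lambda s hξ]
  congr 1
  refine lintegral_congr_ae ?_
  filter_upwards [N.shadowLaw_pos s] with x hx
  have : Ioi (0 : ℝ) ∩ {r | N.pathLoss s r / x ∈ Iic ξ} = Ioc 0 (N.reach s ξ x) := by
    ext r
    exact and_congr_right fun hr => N.pathLoss_div_le_iff s (le_of_lt hr) hx hξ
  rw [this, radialMass]

lemma linkIntensity_Iio (s : S) {ξ : ℝ} (hξ : 0 ≤ ξ) :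
    N.linkIntensity s (Iio ξ) = ENNReal.ofReal (N.Lambda s ξ) := by
  rw [N.linkIntensity_eq_lintegral s measurableSet_Iio, N.ofReal_Lambda s hξ]
  congr 1
  refine lintegral_congr_ae ?_
  filter_upwards [N.shadowLaw_pos s] with x hx
  have : Ioi (0 : ℝ) ∩ {r | N.pathLoss s r / x ∈ Iio ξ} = Ioo 0 (N.reach s ξ x) := by
    ext r
    exact and_congr_right fun hr => N.pathLoss_div_lt_iff s (le_of_lt hr) hx hξ
  rw [this, radialMass, restrict_Ioo_eq_restrict_Ioc]

end NetworkParams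

/-! ### The marked process and the links of a fixed location -/

/-- Intensity measure of the marked base stations. -/
def NetworkParams.bsIntensity {S : Type*} [Fintype S] (N : NetworkParams S) {M : Type*}
    [MeasurableSpace M] (ν : Measure M) : Measure (Plane × M) :=
  (ENNReal.ofReal N.lam • volume).prod ν

namespace NetworkParams

variable {S : Type*} [Fintype S] (N : NetworkParams S) {M : Type*} [MeasurableSpace M]
  (ν : Measure M)

instance [IsProbabilityMeasure ν] : SigmaFinite (N.bsIntensity ν) := by
  have : SigmaFinite (ENNReal.ofReal N.lam • (volume : Measure Plane)) :=
    inferInstanceAs (SigmaFinite (N.lam.toNNReal • (volume : Measure Plane)))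
  unfold bsIntensity
  infer_instance

lemma lintegral_bsIntensity [IsProbabilityMeasure ν] {f : Plane × M → ℝ≥0∞} (hf : Measurable f) :
    ∫⁻ b, f b ∂(N.bsIntensity ν) = ENNReal.ofReal N.lam * ∫⁻ x, ∫⁻ m, f (x, m) ∂ν := by
  rw [bsIntensity, lintegral_prod _ hf.aemeasurable, lintegral_smul_measure, smul_eq_mul]

lemma bsIntensity_translate [IsProbabilityMeasure ν] (x : Plane) {A : Set (Plane × M)}
    (hA : MeasurableSet A) :
    N.bsIntensity ν {b | (b.1 - x, b.2) ∈ A} = N.bsIntensity ν A := by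
  have hm : Measurable fun b : Plane × M => (b.1 - x, b.2) := by fun_prop
  have hA' : MeasurableSet {b : Plane × M | (b.1 - x, b.2) ∈ A} := hm hA
  rw [← lintegral_indicator_one hA, ← lintegral_indicator_one hA',
    N.lintegral_bsIntensity ν (measurable_one.indicator hA),
    N.lintegral_bsIntensity ν (measurable_one.indicator hA')]
  congr 1
  exact lintegral_sub_right_eq_self (fun y => ∫⁻ m, A.indicator 1 (y, m) ∂ν) x

end NetworkParams

namespace LinkField

variable {S : Type*} [Fintype S] [MeasurableSpace S] [MeasurableSingletonClass S]
  {N : NetworkParams S} {M : Type*} [MeasurableSpace M] {ν : Measure M} [IsProbabilityMeasure ν]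
  (F : LinkField N ν)

omit [MeasurableSingletonClass S] [IsProbabilityMeasure ν] in
lemma measurable_linkState :
    Measurable fun q : Plane × (Plane × M) => F.linkState q.1 q.2 :=
  F.measurable_state.comp ((measurable_fst.sub (measurable_fst.comp measurable_snd)).prodMk
    (measurable_snd.comp measurable_snd))

omit [MeasurableSingletonClass S] [IsProbabilityMeasure ν] in
lemma measurable_linkShadow :
    Measurable fun q : Plane × (Plane × M) => F.shadow (q.1 - q.2.1) q.2.2 :=
  F.measurable_shadow.comp ((measurable_fst.sub (measurable_fst.comp measurable_snd)).prodMk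
    (measurable_snd.comp measurable_snd))

omit [IsProbabilityMeasure ν] in
lemma measurable_invPower :
    Measurable fun q : Plane × (Plane × M) => F.invPower q.1 q.2 := by
  have hs := F.measurable_linkState
  have hk : Measurable N.kappa := Measurable.of_discrete
  have ha : Measurable N.alpha := Measurable.of_discrete
  have hn : Measurable fun q : Plane × (Plane × M) => ‖q.1 - q.2.1‖ := by fun_prop
  exact ((hk.comp hs).mul (hn.pow (ha.comp hs))).div F.measurable_linkShadow

omit [IsProbabilityMeasure ν] in
lemma lintegral_state_shadow (y : Plane) {φ : S → ℝ → ℝ≥0∞} (hφ : ∀ s, Measurable (φ s)) :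
    ∫⁻ m, φ (F.state y m) (F.shadow y m) ∂ν =
      ∑ s, ENNReal.ofReal (N.p s ‖y‖) * ∫⁻ x, φ s x ∂(N.shadowLaw s) := by
  classical
  have hst : Measurable (F.state y) := F.measurable_state.comp measurable_prodMk_left
  have hsh : Measurable (F.shadow y) := F.measurable_shadow.comp measurable_prodMk_left
  have hset : ∀ s, MeasurableSet {m | F.state y m = s} := fun s => hst (measurableSet_singleton s)
  have h1 : ∀ m, φ (F.state y m) (F.shadow y m) =
      ∑ s, {m | F.state y m = s}.indicator (fun m => φ s (F.shadow y m)) m := fun m => by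
    rw [Finset.sum_eq_single (F.state y m)]
    · simp
    · intro s _ hs
      simp [hs.symm]
    · simp
  simp_rw [h1]
  rw [lintegral_finsetSum (f := fun s m => {m | F.state y m = s}.indicator
    (fun m => φ s (F.shadow y m)) m) _ fun s _ => ((hφ s).comp hsh).indicator (hset s)]
  refine Finset.sum_congr rfl fun s _ => ?_
  have hmap : (ν.restrict {m | F.state y m = s}).map (F.shadow y) =
      ENNReal.ofReal (N.p s ‖y‖) • N.shadowLaw s := by
    refine Measure.ext fun A hA => ?_
    rw [Measure.map_apply hsh hA, Measure.restrict_apply (hsh hA), Measure.smul_apply, smul_eq_mul,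
      ← F.law y s A hA, inter_comm]
    rfl
  rw [lintegral_indicator (hset s), ← lintegral_map (hφ s) hsh, hmap, lintegral_smul_measure,
    smul_eq_mul]

/-- The mark integral depends on the displacement through its length only. Invariance of Lebesgue
measure under x ↦ z - x removes z, and polar coordinates leave a radial integral; every location
thus sees the same link intensities. -/
lemma lintegral_link (z : Plane) {φ : S → ℝ × ℝ → ℝ≥0∞} (hφ : ∀ s, Measurable (φ s)) :
    ∫⁻ b, φ (F.linkState z b) (‖z - b.1‖, F.shadow (z - b.1) b.2) ∂(N.bsIntensity ν) =
      ENNReal.ofReal (2 * Real.pi * N.lam) * ∑ s, ∫⁻ r in Ioi (0 : ℝ),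
        (∫⁻ x, φ s (r, x) ∂(N.shadowLaw s)) * ENNReal.ofReal (N.p s r * r) := by
  have hφ' : Measurable fun q : S × (ℝ × ℝ) => φ q.1 q.2 :=
    measurable_from_prod_countable_right hφ
  have hm : Measurable fun b : Plane × M =>
      φ (F.linkState z b) (‖z - b.1‖, F.shadow (z - b.1) b.2) := by
    have h1 : Measurable fun b : Plane × M => F.linkState z b :=
      F.measurable_linkState.comp measurable_prodMk_left
    have h2 : Measurable fun b : Plane × M => F.shadow (z - b.1) b.2 :=
      F.measurable_linkShadow.comp measurable_prodMk_left
    have h3 : Measurable fun b : Plane × M => ‖z - b.1‖ := by fun_prop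
    exact hφ'.comp (h1.prodMk (h3.prodMk h2))
  have hI : ∀ s, Measurable fun r => ∫⁻ x, φ s (r, x) ∂(N.shadowLaw s) := fun s =>
    (hφ s).lintegral_prod_right'
  have hpI : ∀ s, Measurable fun r =>
      ENNReal.ofReal (N.p s r) * ∫⁻ x, φ s (r, x) ∂(N.shadowLaw s) := fun s =>
    (N.measurable_p s).ennreal_ofReal.mul (hI s)
  have hlam := N.lam_pos
  rw [N.lintegral_bsIntensity ν hm]
  have h1 : ∀ x : Plane, ∫⁻ m, φ (F.linkState z (x, m)) (‖z - x‖, F.shadow (z - x) m) ∂ν =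
      ∑ s, ENNReal.ofReal (N.p s ‖z - x‖) * ∫⁻ x', φ s (‖z - x‖, x') ∂(N.shadowLaw s) := fun x =>
    F.lintegral_state_shadow (z - x) fun s => (hφ s).comp measurable_prodMk_left
  simp_rw [h1]
  rw [lintegral_sub_left_eq_self (fun y : Plane => ∑ s, ENNReal.ofReal (N.p s ‖y‖) *
    ∫⁻ x', φ s (‖y‖, x') ∂(N.shadowLaw s)) z,
    lintegral_finsetSum (f := fun s (y : Plane) => ENNReal.ofReal (N.p s ‖y‖) *
      ∫⁻ x', φ s (‖y‖, x') ∂(N.shadowLaw s)) _ fun s _ => (hpI s).comp measurable_norm,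
    Finset.mul_sum, Finset.mul_sum]
  refine Finset.sum_congr rfl fun s _ => ?_
  rw [lintegral_fun_norm_plane (hpI s), ← mul_assoc, ← ENNReal.ofReal_mul hlam.le,
    mul_comm N.lam]
  congr 1
  refine setLIntegral_congr_fun measurableSet_Ioi fun r _ => ?_
  rw [ENNReal.ofReal_mul (N.p_nonneg s r)]
  ring

/-- Letting the target set depend on the state allows different thresholds for different states,
which yields the joint void probabilities. -/
lemma bsIntensity_invPower_mem (z : Plane) {U : S → Set ℝ} (hU : ∀ s, MeasurableSet (U s)) :
    N.bsIntensity ν {b | F.invPower z b ∈ U (F.linkState z b)} =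
      ∑ s, N.linkIntensity s (U s) := by
  have hm : ∀ s, MeasurableSet {q : ℝ × ℝ | N.pathLoss s q.1 / q.2 ∈ U s} := fun s =>
    (((N.measurable_pathLoss s).comp measurable_fst).div measurable_snd) (hU s)
  have h := F.lintegral_link z
    (φ := fun s => {q : ℝ × ℝ | N.pathLoss s q.1 / q.2 ∈ U s}.indicator 1)
    fun s => measurable_one.indicator (hm s)
  have hset : MeasurableSet {b | F.invPower z b ∈ U (F.linkState z b)} := by
    have : {b | F.invPower z b ∈ U (F.linkState z b)} =
        ⋃ s, {b | F.linkState z b = s} ∩ {b | F.invPower z b ∈ U s} := by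
      ext b
      simp
    rw [this]
    exact MeasurableSet.iUnion fun s =>
      ((F.measurable_linkState.comp measurable_prodMk_left) (measurableSet_singleton s)).inter
        ((F.measurable_invPower.comp measurable_prodMk_left) (hU s))
  rw [← lintegral_indicator_one hset]
  refine Eq.trans ?_ (h.trans ?_)
  · exact lintegral_congr fun b => rfl
  · rw [Finset.mul_sum]
    refine Finset.sum_congr rfl fun s _ => ?_
    rw [NetworkParams.linkIntensity]
    congr 1
    refine lintegral_congr fun r => ?_
    congr 1
    exact lintegral_indicator_one ((measurable_prodMk_left (x := r)) (hm s))

lemma bsIntensity_linkState_invPower (z : Plane) (s : S) {U : Set ℝ} (hU : MeasurableSet U) :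
    N.bsIntensity ν {b | F.linkState z b = s ∧ F.invPower z b ∈ U} = N.linkIntensity s U := by
  classical
  have h := F.bsIntensity_invPower_mem z (U := fun t => if t = s then U else ∅) fun t => by
    split_ifs
    · exact hU
    · exact MeasurableSet.empty
  have hset : {b | F.linkState z b = s ∧ F.invPower z b ∈ U} =
      {b | F.invPower z b ∈ (if F.linkState z b = s then U else ∅)} := by
    ext b
    by_cases hb : F.linkState z b = s <;> simp [hb]
  rw [hset, h, Finset.sum_eq_single s]
  · simp
  · intro t _ ht
    simpa [ht] using N.linkIntensity_eq_zero t measure_empty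
  · simp

end LinkField

/-! ### Palm distribution of the marked process -/

section Palm

variable {Ω : Type*} [MeasurableSpace Ω] {M : Type*} [MeasurableSpace M] {P : Measure Ω}
  {X : ℕ → Ω → Plane} {K : ℕ → Ω → M} {W : Set Plane}

lemma measurable_typicalPoint : Measurable fun a : ℕ × Config M => a.2 a.1 :=
  measurable_from_prod_countable_right fun n => measurable_pi_apply n

lemma measurable_viewedFrom (hX : ∀ n, Measurable (X n)) (hK : ∀ n, Measurable (K n)) (n : ℕ) :
    Measurable fun ω => ((n, fun k => (X k ω - X n ω, K k ω)) : ℕ × Config M) :=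
  measurable_const.prodMk
    (measurable_pi_lambda _ fun k => ((hX k).sub (hX n)).prodMk (hK k))

lemma palm_apply (hX : ∀ n, Measurable (X n)) (hK : ∀ n, Measurable (K n)) (lam : ℝ)
    {A : Set (ℕ × Config M)} (hA : MeasurableSet A) :
    palm P lam X K W A = (ENNReal.ofReal lam * volume W)⁻¹ *
      ∑' n, P ({ω | (n, fun k => (X k ω - X n ω, K k ω)) ∈ A} ∩ {ω | X n ω ∈ W}) := by
  rw [palm, Measure.smul_apply, Measure.sum_apply _ hA, smul_eq_mul]
  congr 1
  refine tsum_congr fun n => ?_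
  have hn := measurable_viewedFrom hX hK n
  rw [Measure.map_apply hn hA, Measure.restrict_apply (hn hA)]
  rfl

/-- The typical base station is at the origin. -/
lemma palm_ae_typicalPoint (hX : ∀ n, Measurable (X n)) (hK : ∀ n, Measurable (K n)) (lam : ℝ) :
    ∀ᵐ a ∂(palm P lam X K W), (a.2 a.1).1 = 0 := by
  have hm : MeasurableSet {a : ℕ × Config M | (a.2 a.1).1 = 0} :=
    (measurable_fst.comp measurable_typicalPoint) (measurableSet_singleton 0)
  rw [ae_iff]
  change palm P lam X K W {a : ℕ × Config M | (a.2 a.1).1 = 0}ᶜ = 0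
  rw [palm_apply hX hK lam hm.compl]
  simp

/-- Palm probabilities of void events. -/
lemma palm_void {S : Type*} [Fintype S] {N : NetworkParams S} {ν : Measure M}
    [IsProbabilityMeasure ν] [IsProbabilityMeasure P]
    (hY : HasPoissonLaplace P (N.bsIntensity ν) fun n ω => (X n ω, K n ω))
    (hW : MeasurableSet W) (hW0 : volume W ≠ 0) (hW1 : volume W ≠ ⊤)
    {C : Set M} (hC : MeasurableSet C) {D : Set (M × (Plane × M))} (hD : MeasurableSet D) :
    palm P N.lam X K W {a | (a.2 a.1).2 ∈ C ∧ ∀ k, k ≠ a.1 → ((a.2 a.1).2, a.2 k) ∉ D} =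
      ∫⁻ m in C, expNeg (N.bsIntensity ν {b | (m, b) ∈ D}) ∂ν := by
  have hX : ∀ n, Measurable (X n) := fun n => (hY.measurable n).fst
  have hK : ∀ n, Measurable (K n) := fun n => (hY.measurable n).snd
  have hset : MeasurableSet
      {a : ℕ × Config M | (a.2 a.1).2 ∈ C ∧ ∀ k, k ≠ a.1 → ((a.2 a.1).2, a.2 k) ∉ D} := by
    refine ((measurable_snd.comp measurable_typicalPoint) hC).inter ?_
    change MeasurableSet {a : ℕ × Config M | ∀ k, k ≠ a.1 → ((a.2 a.1).2, a.2 k) ∉ D}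
    simp_rw [ofPred_forall]
    refine MeasurableSet.iInter fun k => ?_
    have h1 : MeasurableSet {a : ℕ × Config M | k = a.1} :=
      (measurable_fst (measurableSet_singleton k)).congr (by ext; simp [eq_comm])
    have h2 : MeasurableSet {a : ℕ × Config M | ((a.2 a.1).2, a.2 k) ∉ D} :=
      (((measurable_snd.comp measurable_typicalPoint).prodMk
        ((measurable_pi_apply k).comp measurable_snd)) hD).compl
    convert h1.union h2 using 1
    ext a
    simp only [mem_ofPred_eq, mem_union]
    tauto
  -- `D` concerns the configuration seen from the typical point; `B` is the same condition in the
  -- original coordinates, where Mecke's formula applies.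
  set B : Set ((Plane × M) × (Plane × M)) := {q | (q.1.2, (q.2.1 - q.1.1, q.2.2)) ∈ D} with hB
  have hBm : MeasurableSet B := by
    have : Measurable fun q : (Plane × M) × (Plane × M) => (q.1.2, (q.2.1 - q.1.1, q.2.2)) := by
      fun_prop
    exact this hD
  have hg : Measurable ((W ×ˢ C).indicator (1 : Plane × M → ℝ≥0∞)) :=
    measurable_one.indicator (hW.prod hC)
  have hmecke := hY.tsum_setLIntegral_void hBm hg
  have hlam : ENNReal.ofReal N.lam ≠ 0 := by simpa using N.lam_pos
  rw [palm_apply hX hK _ hset]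
  have h1 : ∑' n, P ({ω | (n, fun k => (X k ω - X n ω, K k ω)) ∈
      {a : ℕ × Config M | (a.2 a.1).2 ∈ C ∧ ∀ k, k ≠ a.1 → ((a.2 a.1).2, a.2 k) ∉ D}} ∩
        {ω | X n ω ∈ W}) =
      ∑' n, ∫⁻ ω in {ω | ∀ k, k ≠ n → ((X n ω, K n ω), (X k ω, K k ω)) ∉ B},
        (W ×ˢ C).indicator (1 : Plane × M → ℝ≥0∞) (X n ω, K n ω) ∂P := by
    refine tsum_congr fun n => ?_
    have hWC : MeasurableSet {ω | (X n ω, K n ω) ∈ W ×ˢ C} := hY.measurable n (hW.prod hC)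
    have e1 : ∀ ω, (W ×ˢ C).indicator (1 : Plane × M → ℝ≥0∞) (X n ω, K n ω) =
        {ω | (X n ω, K n ω) ∈ W ×ˢ C}.indicator 1 ω := fun ω => rfl
    simp_rw [e1]
    rw [lintegral_indicator_one hWC, Measure.restrict_apply hWC]
    congr 1
    ext ω
    simp only [mem_inter_iff, mem_ofPred_eq, mem_prod, hB]
    tauto
  rw [h1, hmecke]
  -- By translation invariance the void probability depends on the mark alone. The integral over
  -- positions then contributes λ|W|, which the normalization cancels, so the window plays no role.
  have hB' : ∀ y : Plane × M, N.bsIntensity ν (Prod.mk y ⁻¹' B) =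
      N.bsIntensity ν {b | (y.2, b) ∈ D} := fun y =>
    N.bsIntensity_translate ν y.1 (A := {b | (y.2, b) ∈ D}) (measurable_prodMk_left hD)
  simp_rw [hB']
  have hv : Measurable fun m : M => expNeg (N.bsIntensity ν {b | (m, b) ∈ D}) :=
    measurable_expNeg.comp (measurable_measure_prodMk_left hD)
  have hgv : Measurable fun y : Plane × M => (W ×ˢ C).indicator (1 : Plane × M → ℝ≥0∞) y *
      expNeg (N.bsIntensity ν {b | (y.2, b) ∈ D}) := hg.mul (hv.comp measurable_snd)
  rw [N.lintegral_bsIntensity ν hgv]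
  have h2 : ∀ x : Plane, ∫⁻ m, (W ×ˢ C).indicator (1 : Plane × M → ℝ≥0∞) (x, m) *
      expNeg (N.bsIntensity ν {b | (m, b) ∈ D}) ∂ν =
      W.indicator (fun _ => ∫⁻ m in C, expNeg (N.bsIntensity ν {b | (m, b) ∈ D}) ∂ν) x := by
    intro x
    by_cases hx : x ∈ W
    · rw [indicator_of_mem hx, ← lintegral_indicator hC]
      refine lintegral_congr fun m => ?_
      by_cases hm : m ∈ C <;> simp [hx, hm]
    · simp [hx]
  simp_rw [h2]
  rw [lintegral_indicator_const hW, mul_comm (lintegral _ _) (volume W),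
    ← mul_assoc (ENNReal.ofReal N.lam) (volume W), ← mul_assoc _ (_ * volume W), ENNReal.inv_mul_cancel (mul_ne_zero hlam hW0)
      (ENNReal.mul_ne_top ENNReal.ofReal_ne_top hW1), one_mul]

end Palm

/-! ### Coverage probabilities and the mean cell area -/

namespace NetworkParams

variable {S : Type*} [Fintype S] (N : NetworkParams S)

lemma monotone_linkIntensity_Iio (s : S) : Monotone fun ξ => N.linkIntensity s (Iio ξ) := by
  intro ξ ξ' h
  unfold linkIntensity
  refine mul_le_mul_right (lintegral_mono fun r => mul_le_mul_left (measure_mono fun x hx => ?_) _) _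
  exact lt_of_lt_of_le (mem_Iio.1 hx) h

/-- Probability that a link of length `r` in state `s` is the best one. -/
def coverage (s : S) (r : ℝ) : ℝ≥0∞ :=
  ∫⁻ x, expNeg (∑ t, N.linkIntensity t (Iio (N.pathLoss s r / x))) ∂(N.shadowLaw s)

lemma measurable_expNeg_linkIntensity :
    Measurable fun ξ => expNeg (∑ t, N.linkIntensity t (Iio ξ)) :=
  measurable_expNeg.comp (Finset.measurable_sum _ fun t _ =>
    (N.monotone_linkIntensity_Iio t).measurable)

lemma measurable_expNeg_linkIntensity_pathLoss (s : S) : Measurable fun q : ℝ × ℝ =>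
    expNeg (∑ t, N.linkIntensity t (Iio (N.pathLoss s q.1 / q.2))) :=
  N.measurable_expNeg_linkIntensity.comp
    (((N.measurable_pathLoss s).comp measurable_fst).div measurable_snd)

lemma measurable_expNeg_linkIntensity_pathLoss' (s : S) (r : ℝ) : Measurable fun x : ℝ =>
    expNeg (∑ t, N.linkIntensity t (Iio (N.pathLoss s r / x))) :=
  N.measurable_expNeg_linkIntensity.comp (measurable_const.div measurable_id)

lemma measurable_coverage (s : S) : Measurable (N.coverage s) :=
  (N.measurable_expNeg_linkIntensity_pathLoss s).lintegral_prod_right'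

lemma prod_exp_neg_Lambda {ξ : ℝ} (hξ : 0 ≤ ξ) :
    expNeg (∑ t, ENNReal.ofReal (N.Lambda t ξ)) =
      ENNReal.ofReal (Real.exp (-∑ t, N.Lambda t ξ)) := by
  rw [← ENNReal.ofReal_sum_of_nonneg fun t _ => N.Lambda_nonneg t hξ,
    expNeg_ofReal (Finset.sum_nonneg fun t _ => N.Lambda_nonneg t hξ)]

lemma coverage_eq (s : S) {r : ℝ} (hr : 0 ≤ r) :
    N.coverage s r = ∫⁻ x, ENNReal.ofReal (Real.exp (-∑ t, N.Lambda t (N.pathLoss s r / x)))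
      ∂(N.shadowLaw s) := by
  refine lintegral_congr_ae ?_
  filter_upwards [N.shadowLaw_pos s] with x hx
  have hξ : 0 ≤ N.pathLoss s r / x := div_nonneg (N.pathLoss_nonneg s hr) hx.le
  simp_rw [N.linkIntensity_Iio _ hξ]
  exact N.prod_exp_neg_Lambda hξ

end NetworkParams

namespace LinkField

variable {S : Type*} [Fintype S] [MeasurableSpace S] [MeasurableSingletonClass S]
  {N : NetworkParams S} {M : Type*} [MeasurableSpace M] {ν : Measure M}
  (F : LinkField N ν)

lemma measurableSet_cell :
    MeasurableSet {q : (ℕ × Config M) × Plane | q.2 ∈ F.cell q.1.2 q.1.1} := by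
  have : {q : (ℕ × Config M) × Plane | q.2 ∈ F.cell q.1.2 q.1.1} =
      ⋂ k, {q | F.invPower q.2 (q.1.2 q.1.1) ≤ F.invPower q.2 (q.1.2 k)} := by
    ext q
    simp [cell, Serves]
  rw [this]
  refine MeasurableSet.iInter fun k => measurableSet_le ?_ ?_
  · exact F.measurable_invPower.comp
      (measurable_snd.prodMk (measurable_typicalPoint.comp measurable_fst))
  · exact F.measurable_invPower.comp (measurable_snd.prodMk
      ((measurable_pi_apply k).comp (measurable_snd.comp measurable_fst)))

lemma measurable_cellArea :
    Measurable fun a : ℕ × Config M => volume (F.cell a.2 a.1) :=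
  measurable_measure_prodMk_left F.measurableSet_cell

lemma meanCellArea_eq (Q : Measure (ℕ × Config M)) [SFinite Q] :
    meanCellArea F Q = ∫⁻ z, Q {a | z ∈ F.cell a.2 a.1} := by
  rw [meanCellArea]
  exact (Measure.prod_apply F.measurableSet_cell).symm.trans
    (Measure.prod_apply_symm F.measurableSet_cell)

lemma cell_measurableSet_right (z : Plane) :
    MeasurableSet {a : ℕ × Config M | z ∈ F.cell a.2 a.1} :=
  measurable_prodMk_right F.measurableSet_cell

lemma measurableSet_linkState_typical (z : Plane) (s : S) :
    MeasurableSet {a : ℕ × Config M | F.linkState z (a.2 a.1) = s} :=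
  (F.measurable_linkState.comp (measurable_const.prodMk measurable_typicalPoint))
    (measurableSet_singleton s)

variable [IsProbabilityMeasure ν] {Ω : Type*} [MeasurableSpace Ω] {P : Measure Ω}
  [IsProbabilityMeasure P] {X : ℕ → Ω → Plane} {K : ℕ → Ω → M} {W : Set Plane}

omit [Fintype S] [MeasurableSpace S] [MeasurableSingletonClass S] in
lemma _root_.isProbabilityMeasure_palm [Fintype S] {N : NetworkParams S}
    (hY : HasPoissonLaplace P (N.bsIntensity ν) fun n ω => (X n ω, K n ω))
    (hW : MeasurableSet W) (hW0 : volume W ≠ 0) (hW1 : volume W ≠ ⊤) :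
    IsProbabilityMeasure (palm P N.lam X K W) := by
  constructor
  have h := palm_void hY hW hW0 hW1 MeasurableSet.univ MeasurableSet.empty
  simpa using h

lemma palm_linkState (hY : HasPoissonLaplace P (N.bsIntensity ν) fun n ω => (X n ω, K n ω))
    (hW : MeasurableSet W) (hW0 : volume W ≠ 0) (hW1 : volume W ≠ ⊤) (z : Plane) (s : S) :
    palm P N.lam X K W {a | F.linkState z (a.2 a.1) = s} = ENNReal.ofReal (N.p s ‖z‖) := by
  have hst : Measurable (F.state z) := F.measurable_state.comp measurable_prodMk_left
  have hC : MeasurableSet {m | F.state z m = s} := hst (measurableSet_singleton s)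
  have h := palm_void hY hW hW0 hW1 hC MeasurableSet.empty
  have hlaw := F.law z s univ MeasurableSet.univ
  simp only [mem_univ, and_true, measure_univ, mul_one] at hlaw
  simp only [mem_empty_iff_false, not_false_eq_true, implies_true, and_true,
    ofPred_false, measure_empty, expNeg_zero, lintegral_one, Measure.restrict_apply_univ,
    hlaw] at h
  rw [← h]
  refine measure_congr ?_
  filter_upwards [palm_ae_typicalPoint (W := W) (P := P) (fun n => (hY.measurable n).fst)
    (fun n => (hY.measurable n).snd) N.lam] with a ha
  change (F.linkState z (a.2 a.1) = s) = (F.state z (a.2 a.1).2 = s)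
  rw [linkState, ha, sub_zero]

omit [IsProbabilityMeasure ν] in
lemma lintegral_state_eq (z : Plane) (s : S) {G : ℝ → ℝ≥0∞} (hG : Measurable G) :
    ∫⁻ m in {m | F.state z m = s}, G (F.shadow z m) ∂ν =
      ENNReal.ofReal (N.p s ‖z‖) * ∫⁻ x, G x ∂(N.shadowLaw s) := by
  classical
  have hst : Measurable (F.state z) := F.measurable_state.comp measurable_prodMk_left
  have hC : MeasurableSet {m | F.state z m = s} := hst (measurableSet_singleton s)
  have hφ := F.lintegral_state_shadow z (φ := fun t => if t = s then G else 0) fun t => by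
    split_ifs
    · exact hG
    · exact measurable_zero
  rw [Finset.sum_eq_single s (fun t _ ht => by simp [ht]) (by simp)] at hφ
  simp only [if_true] at hφ
  rw [← hφ, ← lintegral_indicator hC]
  refine lintegral_congr fun m => ?_
  by_cases hm : F.state z m = s
  · rw [indicator_of_mem (by exact hm), if_pos hm]
  · rw [indicator_of_notMem (by exact hm), if_neg hm]
    rfl

/-- The location is in the cell iff no other base station is strictly better there. With mark m this
is a void event of `palm_void` at level `invPower z (0, m)`, and in state s this level is l_s(‖z‖)
divided by the shadowing, so averaging over the mark gives the coverage. -/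
lemma palm_linkState_cell
    (hY : HasPoissonLaplace P (N.bsIntensity ν) fun n ω => (X n ω, K n ω))
    (hW : MeasurableSet W) (hW0 : volume W ≠ 0) (hW1 : volume W ≠ ⊤) (z : Plane) (s : S) :
    palm P N.lam X K W {a | F.linkState z (a.2 a.1) = s ∧ z ∈ F.cell a.2 a.1} =
      ENNReal.ofReal (N.p s ‖z‖) * N.coverage s ‖z‖ := by
  have hst : Measurable (F.state z) := F.measurable_state.comp measurable_prodMk_left
  have hC : MeasurableSet {m | F.state z m = s} := hst (measurableSet_singleton s)
  have hinv0 : Measurable fun m : M => F.invPower z (0, m) :=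
    F.measurable_invPower.comp (measurable_const.prodMk (measurable_const.prodMk measurable_id))
  have hinv : Measurable fun b : Plane × M => F.invPower z b :=
    F.measurable_invPower.comp measurable_prodMk_left
  have hD : MeasurableSet {q : M × (Plane × M) | F.invPower z q.2 < F.invPower z (0, q.1)} :=
    measurableSet_lt (hinv.comp measurable_snd) (hinv0.comp measurable_fst)
  have h := palm_void hY hW hW0 hW1 hC hD
  have h1 : ∀ m, N.bsIntensity ν
      {b | (m, b) ∈ {q : M × (Plane × M) | F.invPower z q.2 < F.invPower z (0, q.1)}} =
      ∑ t, N.linkIntensity t (Iio (F.invPower z (0, m))) := fun m =>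
    F.bsIntensity_invPower_mem z (U := fun _ => Iio (F.invPower z (0, m)))
      fun _ => measurableSet_Iio
  simp_rw [h1] at h
  refine Eq.trans ?_ (h.trans (Eq.trans ?_
    (F.lintegral_state_eq z s (N.measurable_expNeg_linkIntensity_pathLoss' s ‖z‖))))
  · refine measure_congr ?_
    filter_upwards [palm_ae_typicalPoint (W := W) (P := P) (fun n => (hY.measurable n).fst)
      (fun n => (hY.measurable n).snd) N.lam] with a ha
    have ha' : a.2 a.1 = (0, (a.2 a.1).2) := Prod.ext ha rfl
    change (F.linkState z (a.2 a.1) = s ∧ ∀ k, F.invPower z (a.2 a.1) ≤ F.invPower z (a.2 k)) =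
      (F.state z (a.2 a.1).2 = s ∧ ∀ k, k ≠ a.1 →
        ¬ F.invPower z (a.2 k) < F.invPower z (0, (a.2 a.1).2))
    rw [← ha', linkState, ha, sub_zero]
    simp only [not_lt, eq_iff_iff]
    refine and_congr_right fun _ => ⟨fun h k _ => h k, fun h k => ?_⟩
    by_cases hk : k = a.1
    · rw [hk]
    · exact h k hk
  · refine setLIntegral_congr_fun hC fun m hm => ?_
    have hm' : F.state (z - 0) m = s := by rw [sub_zero]; exact hm
    have he : F.invPower z (0, m) = N.pathLoss s ‖z‖ / F.shadow z m := by
      rw [invPower, linkState, hm', sub_zero]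
    rw [he]

lemma palm_others (hY : HasPoissonLaplace P (N.bsIntensity ν) fun n ω => (X n ω, K n ω))
    (hW : MeasurableSet W) (hW0 : volume W ≠ 0) (hW1 : volume W ≠ ⊤) (z : Plane) (t : S)
    {ξ : ℝ} (hξ : 0 ≤ ξ) :
    palm P N.lam X K W {a | ∀ k, k ≠ a.1 → F.linkState z (a.2 k) = t → ξ < F.invPower z (a.2 k)} =
      expNeg (ENNReal.ofReal (N.Lambda t ξ)) := by
  have hD : MeasurableSet
      {q : M × (Plane × M) | F.linkState z q.2 = t ∧ F.invPower z q.2 ∈ Iic ξ} :=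
    ((F.measurable_linkState.comp (measurable_const.prodMk measurable_snd))
      (measurableSet_singleton t)).inter
      ((F.measurable_invPower.comp (measurable_const.prodMk measurable_snd)) measurableSet_Iic)
  have h := palm_void hY hW hW0 hW1 MeasurableSet.univ hD
  have h1 := F.bsIntensity_linkState_invPower z t (measurableSet_Iic (a := ξ))
  rw [N.linkIntensity_Iic t hξ] at h1
  simp only [mem_ofPred_eq, h1, mem_univ, true_and, lintegral_const, measure_univ, mul_one,
    Measure.restrict_univ] at h
  rw [← h]
  congr 1
  ext a
  simp

lemma palm_cell (hY : HasPoissonLaplace P (N.bsIntensity ν) fun n ω => (X n ω, K n ω))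
    (hW : MeasurableSet W) (hW0 : volume W ≠ 0) (hW1 : volume W ≠ ⊤) (z : Plane) :
    palm P N.lam X K W {a | z ∈ F.cell a.2 a.1} =
      ∑ s, ENNReal.ofReal (N.p s ‖z‖) * N.coverage s ‖z‖ := by
  simp_rw [← F.palm_linkState_cell hY hW hW0 hW1 z]
  rw [← measure_biUnion_finset]
  · congr 1
    ext a
    simp
  · intro s _ t _ hst
    refine Set.disjoint_left.2 fun a ha ha' => hst (ha.1.symm.trans ha'.1)
  · exact fun s _ => (F.measurableSet_linkState_typical z s).inter (F.cell_measurableSet_right z)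

/-- The mean area of the typical cell as an integral of the coverage probabilities. -/
theorem meanCellArea_palm (hY : HasPoissonLaplace P (N.bsIntensity ν) fun n ω => (X n ω, K n ω))
    (hW : MeasurableSet W) (hW0 : volume W ≠ 0) (hW1 : volume W ≠ ⊤) :
    meanCellArea F (palm P N.lam X K W) = ENNReal.ofReal (2 * Real.pi) *
      ∑ s, ∫⁻ r in Ioi (0 : ℝ), N.coverage s r * ENNReal.ofReal (N.p s r * r) := by
  have := isProbabilityMeasure_palm hY hW hW0 hW1
  have hm : ∀ s, Measurable fun r => ENNReal.ofReal (N.p s r) * N.coverage s r := fun s =>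
    (N.measurable_p s).ennreal_ofReal.mul (N.measurable_coverage s)
  rw [F.meanCellArea_eq]
  simp_rw [F.palm_cell hY hW hW0 hW1]
  rw [lintegral_finsetSum (f := fun s (z : Plane) => ENNReal.ofReal (N.p s ‖z‖) *
    N.coverage s ‖z‖) _ fun s _ => (hm s).comp measurable_norm, Finset.mul_sum]
  refine Finset.sum_congr rfl fun s _ => ?_
  rw [lintegral_fun_norm_plane (hm s)]
  congr 1
  refine lintegral_congr fun r => ?_
  rw [ENNReal.ofReal_mul (N.p_nonneg s r)]
  ring

/-- The weight p_s cancels the normalization of the conditional probability. When p_s = 0 both sides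
vanish, in agreement with reading that term as 0. -/
lemma cond_palm_cell_mul (hY : HasPoissonLaplace P (N.bsIntensity ν) fun n ω => (X n ω, K n ω))
    (hW : MeasurableSet W) (hW0 : volume W ≠ 0) (hW1 : volume W ≠ ⊤) (z : Plane) (s : S) :
    (ProbabilityTheory.cond (palm P N.lam X K W) {a | F.linkState z (a.2 a.1) = s})
      {a | z ∈ F.cell a.2 a.1} * ENNReal.ofReal (N.p s ‖z‖ * ‖z‖) =
      N.coverage s ‖z‖ * ENNReal.ofReal (N.p s ‖z‖ * ‖z‖) := by
  rw [cond_apply (F.measurableSet_linkState_typical z s), F.palm_linkState hY hW hW0 hW1,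
    ENNReal.ofReal_mul (N.p_nonneg s _)]
  have h := F.palm_linkState_cell hY hW hW0 hW1 z s
  rw [ofPred_and] at h
  rw [h]
  by_cases hp : ENNReal.ofReal (N.p s ‖z‖) = 0
  · simp [hp]
  · rw [← mul_assoc (ENNReal.ofReal (N.p s ‖z‖))⁻¹, ENNReal.inv_mul_cancel hp ENNReal.ofReal_ne_top,
      one_mul]

/-- The exponential of the sum over the states is the product of the void probabilities. The factors
involve L ≤ ξ and the coverage L < ξ; both have intensity `Lambda`, since a single level carries no
mass. -/
lemma lintegral_prod_palm_others
    (hY : HasPoissonLaplace P (N.bsIntensity ν) fun n ω => (X n ω, K n ω))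
    (hW : MeasurableSet W) (hW0 : volume W ≠ 0) (hW1 : volume W ≠ ⊤) (z : Plane) (s : S)
    {r : ℝ} (hr : 0 ≤ r) :
    ∫⁻ x, ∏ t, (palm P N.lam X K W) {a | ∀ k, k ≠ a.1 → F.linkState z (a.2 k) = t →
      N.pathLoss s r / x < F.invPower z (a.2 k)} ∂(N.shadowLaw s) = N.coverage s r := by
  refine lintegral_congr_ae ?_
  filter_upwards [N.shadowLaw_pos s] with x hx
  have hξ : 0 ≤ N.pathLoss s r / x := div_nonneg (N.pathLoss_nonneg s hr) hx.le
  simp_rw [F.palm_others hY hW hW0 hW1 z _ hξ, N.linkIntensity_Iio _ hξ]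
  exact (expNeg_sum _ _).symm

end LinkField

/-! ### Almost sure properties of Poisson points -/

namespace HasPoissonLaplace

variable {Ω : Type*} [MeasurableSpace Ω] {P : Measure Ω} [IsProbabilityMeasure P]
  {E : Type*} [MeasurableSpace E] {μ : Measure E} [SigmaFinite μ] {Y : ℕ → Ω → E}

omit [SigmaFinite μ] in
lemma ae_notMem (hY : HasPoissonLaplace P μ Y) {A : Set E} (hA : MeasurableSet A)
    (h0 : μ A = 0) : ∀ᵐ ω ∂P, ∀ k, Y k ω ∉ A := by
  have hset : MeasurableSet {ω | ∀ k, Y k ω ∉ A} := by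
    rw [ofPred_forall]
    exact MeasurableSet.iInter fun k => (hY.measurable k hA).compl
  have h := hY.measure_void hA
  rw [h0, expNeg_zero] at h
  exact (prob_compl_eq_zero_iff hset).2 h

/-- All the void probabilities in Mecke's formula are 1. Hence the mean number of points of a
spanning set without partners in B equals the mean number of all its points; as this is finite,
points with partners have mean number 0. -/
lemma ae_pairwise_notMem (hY : HasPoissonLaplace P μ Y) {B : Set (E × E)}
    (hB : MeasurableSet B) (h0 : ∀ y, μ (Prod.mk y ⁻¹' B) = 0) :
    ∀ᵐ ω ∂P, ∀ n k, k ≠ n → (Y n ω, Y k ω) ∉ B := by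
  set V : ℕ → Set Ω := fun n => {ω | ∀ k, k ≠ n → (Y n ω, Y k ω) ∉ B} with hV
  have hVm : ∀ n, MeasurableSet (V n) := fun n => by
    simp_rw [hV, ofPred_forall]
    exact MeasurableSet.iInter fun k => MeasurableSet.iInter fun _ =>
      (((hY.measurable n).prodMk (hY.measurable k)) hB).compl
  have key : ∀ j n, P ({ω | Y n ω ∈ spanningSets μ j} \ V n) = 0 := by
    intro j
    have hA := measurableSet_spanningSets μ j
    have hAn : ∀ n, MeasurableSet {ω | Y n ω ∈ spanningSets μ j} := fun n => hY.measurable n hA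
    have hg : Measurable ((spanningSets μ j).indicator (1 : E → ℝ≥0∞)) :=
      measurable_one.indicator hA
    have h1 := hY.tsum_setLIntegral_void hB hg
    have h2 := hY.campbell hg
    simp_rw [h0, expNeg_zero, mul_one] at h1
    rw [lintegral_indicator_one hA] at h1 h2
    have e : ∀ n ω, (spanningSets μ j).indicator (1 : E → ℝ≥0∞) (Y n ω) =
        {ω | Y n ω ∈ spanningSets μ j}.indicator 1 ω := fun n ω => rfl
    rw [lintegral_tsum (f := fun n ω => (spanningSets μ j).indicator (1 : E → ℝ≥0∞) (Y n ω))
      fun n => (hg.comp (hY.measurable n)).aemeasurable] at h2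
    simp_rw [e] at h1 h2
    simp_rw [lintegral_indicator_one (hAn _)] at h1 h2
    simp_rw [Measure.restrict_apply (hAn _)] at h1
    have hfin := measure_spanningSets_lt_top μ j
    have h3 : ∀ n, P {ω | Y n ω ∈ spanningSets μ j} =
        P ({ω | Y n ω ∈ spanningSets μ j} ∩ V n) + P ({ω | Y n ω ∈ spanningSets μ j} \ V n) :=
      fun n => (measure_inter_add_sdiff _ (hVm n)).symm
    have h4 : ∑' n, P ({ω | Y n ω ∈ spanningSets μ j} \ V n) = 0 := by
      have h5 := h2
      simp_rw [h3] at h5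
      rw [ENNReal.tsum_add, h1] at h5
      exact (ENNReal.add_right_inj hfin.ne).1 (h5.trans (add_zero _).symm)
    exact ENNReal.tsum_eq_zero.1 h4
  have h : ∀ᵐ ω ∂P, ∀ n j, ω ∉ {ω | Y n ω ∈ spanningSets μ j} \ V n :=
    ae_all_iff.2 fun n => ae_all_iff.2 fun j => measure_eq_zero_iff_ae_notMem.1 (key j n)
  filter_upwards [h] with ω hω n
  by_contra hn
  obtain ⟨j, hj⟩ := mem_iUnion.1 ((iUnion_spanningSets μ).symm ▸ mem_univ (Y n ω))
  exact hω n j ⟨hj, hn⟩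

lemma ae_finite (hY : HasPoissonLaplace P μ Y) {B : Set E} (hB : MeasurableSet B)
    (hB' : μ B ≠ ⊤) : ∀ᵐ ω ∂P, {n | Y n ω ∈ B}.Finite := by
  filter_upwards [hY.ae_pointMeasure_lt_top hB hB'] with ω hω
  rw [pointMeasure, Measure.sum_apply _ hB] at hω
  simp_rw [Measure.dirac_apply' _ hB] at hω
  have h := ENNReal.finite_const_le_of_tsum_ne_top hω.ne one_ne_zero
  refine h.subset fun n hn => ?_
  simp [indicator_of_mem (show Y n ω ∈ B from hn)]

end HasPoissonLaplace

/-! ### Serving base station of the origin -/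

namespace LinkField

variable {S : Type*} [Fintype S] [MeasurableSpace S]
  {N : NetworkParams S} {M : Type*} [MeasurableSpace M] {ν : Measure M}
  (F : LinkField N ν)

/-- The inverse powers received at the origin are positive, distinct and locally finite. -/
structure Regular (c : Config M) : Prop where
  pos : ∀ n, 0 < F.invPower 0 (c n)
  ne : ∀ n k, k ≠ n → F.invPower 0 (c k) ≠ F.invPower 0 (c n)
  finite : ∀ j : ℕ, {n | F.invPower 0 (c n) ≤ j}.Finite

variable {F} {c : Config M}

/-- Only finitely many base stations lie below the level of a given member of `T`, so the minimum is
attained among those. -/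
lemma Regular.exists_min (h : F.Regular c) (T : Set ℕ) (hT : T.Nonempty) :
    ∃ n ∈ T, ∀ k ∈ T, F.invPower 0 (c n) ≤ F.invPower 0 (c k) := by
  obtain ⟨m, hm⟩ := hT
  obtain ⟨j, hj⟩ := exists_nat_ge (F.invPower 0 (c m))
  obtain ⟨n, hn, hmin⟩ := Set.exists_min_image ({n | F.invPower 0 (c n) ≤ j} ∩ T)
    (fun n => F.invPower 0 (c n)) ((h.finite j).inter_of_left T) ⟨m, hj, hm⟩
  refine ⟨n, hn.2, fun k hk => ?_⟩
  rcases le_total (F.invPower 0 (c k)) j with hkj | hkj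
  · exact hmin k ⟨hkj, hk⟩
  · exact le_trans hn.1 hkj

lemma Regular.exists_serves (h : F.Regular c) : ∃ n, F.Serves c n 0 := by
  obtain ⟨n, -, hn⟩ := h.exists_min univ univ_nonempty
  exact ⟨n, fun k => hn k (mem_univ k)⟩

lemma Regular.serves_unique (h : F.Regular c) {n k : ℕ} (hn : F.Serves c n 0)
    (hk : F.Serves c k 0) : n = k := by
  by_contra hne
  exact h.ne k n hne (le_antisymm (hn k) (hk n))

lemma minInvPower_le {s : S} {n : ℕ} (hn : F.linkState 0 (c n) = s) :
    F.minInvPower s c ≤ ENNReal.ofReal (F.invPower 0 (c n)) := by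
  unfold minInvPower
  refine (iInf_le _ n).trans ?_
  rw [if_pos hn]

lemma Regular.minInvPower_eq (h : F.Regular c) (s : S) (hs : F.minInvPower s c ≠ ⊤) :
    ∃ n, F.linkState 0 (c n) = s ∧ F.minInvPower s c = ENNReal.ofReal (F.invPower 0 (c n)) := by
  have hne : {n | F.linkState 0 (c n) = s}.Nonempty := by
    by_contra hemp
    refine hs ?_
    unfold minInvPower
    refine iInf_eq_top.2 fun n => ?_
    rw [if_neg]
    exact fun hn => hemp ⟨n, hn⟩
  obtain ⟨n, hn, hmin⟩ := h.exists_min _ hne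
  refine ⟨n, hn, le_antisymm (minInvPower_le hn) ?_⟩
  unfold minInvPower
  refine le_iInf fun k => ?_
  split_ifs with hk
  · exact ENNReal.ofReal_le_ofReal (hmin k hk)
  · exact le_top

lemma Regular.lt_minInvPower_iff (h : F.Regular c) (s : S) {x : ℝ} :
    ENNReal.ofReal x < F.minInvPower s c ↔
      ∀ k, F.linkState 0 (c k) = s → x < F.invPower 0 (c k) := by
  constructor
  · exact fun hlt k hk => (ENNReal.ofReal_lt_ofReal_iff (h.pos k)).1
      (hlt.trans_le (minInvPower_le hk))
  · intro hall
    by_cases hs : F.minInvPower s c = ⊤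
    · rw [hs]
      exact ENNReal.ofReal_lt_top
    · obtain ⟨n, hn, he⟩ := h.minInvPower_eq s hs
      rw [he]
      exact (ENNReal.ofReal_lt_ofReal_iff (h.pos n)).2 (hall n hn)

/-- The absence of ties makes the comparisons strict. The finiteness of the minimum follows from the
comparison if there is another state; it is stated separately because the comparison is vacuous when
s is the only state. -/
lemma Regular.exists_serves_iff (h : F.Regular c) (s : S) :
    (∃ n, F.Serves c n 0 ∧ F.linkState 0 (c n) = s) ↔
      F.minInvPower s c ≠ ⊤ ∧ ∀ t, t ≠ s → F.minInvPower s c < F.minInvPower t c := by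
  constructor
  · rintro ⟨n, hn, hs⟩
    have hle := minInvPower_le hs
    refine ⟨(hle.trans_lt ENNReal.ofReal_lt_top).ne, fun t ht => ?_⟩
    refine lt_of_le_of_lt hle ?_
    rw [h.lt_minInvPower_iff t]
    intro k hk
    refine lt_of_le_of_ne (hn k) (h.ne k n ?_)
    rintro rfl
    exact ht (hk.symm.trans hs)
  · rintro ⟨-, hall⟩
    obtain ⟨n, hn⟩ := h.exists_serves
    refine ⟨n, hn, ?_⟩
    by_contra hns
    have hlt := (hall _ hns).trans_le (minInvPower_le rfl)
    obtain ⟨k, -, he⟩ := h.minInvPower_eq s (hlt.trans ENNReal.ofReal_lt_top).ne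
    rw [he, ENNReal.ofReal_lt_ofReal_iff (h.pos n)] at hlt
    exact (hn k).not_gt hlt

variable (F) [MeasurableSingletonClass S] [IsProbabilityMeasure ν] {Ω : Type*} [MeasurableSpace Ω]
  {P : Measure Ω} [IsProbabilityMeasure P] {X : ℕ → Ω → Plane} {K : ℕ → Ω → M}

omit [IsProbabilityMeasure ν] in
lemma measurable_invPower_right (z : Plane) : Measurable fun b : Plane × M => F.invPower z b :=
  F.measurable_invPower.comp measurable_prodMk_left

omit [MeasurableSingletonClass S] [IsProbabilityMeasure ν] in
lemma measurable_linkState_right (z : Plane) : Measurable fun b : Plane × M => F.linkState z b :=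
  F.measurable_linkState.comp measurable_prodMk_left

/-- Positivity holds because Λ vanishes at level 0, distinctness because a single level has
intensity zero, and local finiteness because Λ is finite at every level. -/
lemma ae_regular (hY : HasPoissonLaplace P (N.bsIntensity ν) fun n ω => (X n ω, K n ω)) :
    ∀ᵐ ω ∂P, F.Regular (config X K ω) := by
  have hinv := F.measurable_invPower_right 0
  have hpos : ∀ᵐ ω ∂P, ∀ k, (X k ω, K k ω) ∉ {b | F.invPower 0 b ∈ Iic (0 : ℝ)} := by
    refine hY.ae_notMem (hinv measurableSet_Iic) ?_
    rw [F.bsIntensity_invPower_mem 0 (U := fun _ => Iic 0) fun _ => measurableSet_Iic]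
    refine Finset.sum_eq_zero fun t _ => ?_
    rw [N.linkIntensity_Iic t le_rfl]
    have : ∀ x : ℝ, (x * 0 / N.kappa t) ^ (1 / N.alpha t) = 0 := fun x => by
      rw [mul_zero, zero_div, Real.zero_rpow (one_div_pos.2 (N.alpha_pos t)).ne']
    simp_rw [NetworkParams.Lambda, this]
    simp
  have hne : ∀ᵐ ω ∂P, ∀ n k, k ≠ n → ((X n ω, K n ω), (X k ω, K k ω)) ∉
      {q : (Plane × M) × (Plane × M) | F.invPower 0 q.2 = F.invPower 0 q.1} := by
    have hB : MeasurableSet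
        {q : (Plane × M) × (Plane × M) | F.invPower 0 q.2 = F.invPower 0 q.1} :=
      measurableSet_eq_fun (hinv.comp measurable_snd) (hinv.comp measurable_fst)
    refine hY.ae_pairwise_notMem hB fun y => ?_
    have hy := F.bsIntensity_invPower_mem 0 (U := fun _ => {F.invPower 0 y})
      fun _ => measurableSet_singleton _
    refine Eq.trans (congrArg _ ?_) (hy.trans ?_)
    · ext b
      rfl
    · exact Finset.sum_eq_zero fun t _ => N.linkIntensity_eq_zero t Real.volume_singleton
  have hfin : ∀ᵐ ω ∂P, ∀ j : ℕ, {n | (X n ω, K n ω) ∈ {b | F.invPower 0 b ∈ Iic (j : ℝ)}}.Finite := by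
    refine ae_all_iff.2 fun j => hY.ae_finite (hinv measurableSet_Iic) ?_
    rw [F.bsIntensity_invPower_mem 0 (U := fun _ => Iic (j : ℝ)) fun _ => measurableSet_Iic]
    simp_rw [N.linkIntensity_Iic _ (Nat.cast_nonneg j)]
    exact ENNReal.sum_ne_top.2 fun t _ => ENNReal.ofReal_ne_top
  filter_upwards [hpos, hne, hfin] with ω h1 h2 h3
  exact ⟨fun n => not_le.1 (h1 n), fun n k hk => h2 n k hk, h3⟩

end LinkField

/-! ### Association probabilities and independence of the minima -/

namespace LinkField

variable {S : Type*} [Fintype S] [MeasurableSpace S] [MeasurableSingletonClass S]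
  {N : NetworkParams S} {M : Type*} [MeasurableSpace M] {ν : Measure M} (F : LinkField N ν)
  {Ω : Type*} [MeasurableSpace Ω] {X : ℕ → Ω → Plane} {K : ℕ → Ω → M}

lemma measurable_minInvPower (s : S) : Measurable (F.minInvPower s : Config M → ℝ≥0∞) := by
  unfold minInvPower
  refine Measurable.iInf fun n => Measurable.ite ?_ ?_ measurable_const
  · exact ((F.measurable_linkState_right 0).comp (measurable_pi_apply n))
      (measurableSet_singleton s)
  · exact ((F.measurable_invPower_right 0).comp (measurable_pi_apply n)).ennreal_ofReal

lemma measurableSet_serves (n : ℕ) : MeasurableSet {c : Config M | F.Serves c n 0} := by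
  simp_rw [Serves, ofPred_forall]
  exact MeasurableSet.iInter fun k => measurableSet_le
    ((F.measurable_invPower_right 0).comp (measurable_pi_apply n))
    ((F.measurable_invPower_right 0).comp (measurable_pi_apply k))

lemma measurableSet_linkState (n : ℕ) (s : S) :
    MeasurableSet {c : Config M | F.linkState 0 (c n) = s} :=
  ((F.measurable_linkState_right 0).comp (measurable_pi_apply n)) (measurableSet_singleton s)

variable [IsProbabilityMeasure ν] {P : Measure Ω} [IsProbabilityMeasure P]

omit [MeasurableSpace S] [MeasurableSingletonClass S] [IsProbabilityMeasure ν]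
  [IsProbabilityMeasure P] in
lemma measurable_config (hY : HasPoissonLaplace P (N.bsIntensity ν) fun n ω => (X n ω, K n ω)) :
    Measurable (config X K) :=
  measurable_pi_lambda _ hY.measurable

omit [IsProbabilityMeasure ν] [IsProbabilityMeasure P] in
lemma measurable_minLink
    (hY : HasPoissonLaplace P (N.bsIntensity ν) fun n ω => (X n ω, K n ω)) (s : S) :
    Measurable (minLink F X K s) :=
  (F.measurable_minInvPower s).comp (measurable_config hY)

/-- Mecke's formula at the origin, with the same event “no other base station is strictly better” as
for the typical cell. This produces λ times the integral in the mean cell area and so exchanges the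
roles of location and base station. -/
lemma tsum_measure_serves
    (hY : HasPoissonLaplace P (N.bsIntensity ν) fun n ω => (X n ω, K n ω)) (s : S) :
    ∑' n, P {ω | F.Serves (config X K ω) n 0 ∧ F.linkState 0 (config X K ω n) = s} =
      ENNReal.ofReal (2 * Real.pi * N.lam) *
        ∫⁻ r in Ioi (0 : ℝ), N.coverage s r * ENNReal.ofReal (N.p s r * r) := by
  classical
  have hinv := F.measurable_invPower_right 0
  have hst : MeasurableSet {b : Plane × M | F.linkState 0 b = s} :=
    F.measurable_linkState_right 0 (measurableSet_singleton s)
  have hB : MeasurableSet {q : (Plane × M) × (Plane × M) | F.invPower 0 q.2 < F.invPower 0 q.1} :=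
    measurableSet_lt (hinv.comp measurable_snd) (hinv.comp measurable_fst)
  have h := hY.tsum_setLIntegral_void hB (measurable_one.indicator hst)
  have hl : ∀ n, ∫⁻ ω in {ω | ∀ k, k ≠ n → ((X n ω, K n ω), (X k ω, K k ω)) ∉
      {q : (Plane × M) × (Plane × M) | F.invPower 0 q.2 < F.invPower 0 q.1}},
        {b : Plane × M | F.linkState 0 b = s}.indicator 1 (X n ω, K n ω) ∂P =
      P {ω | F.Serves (config X K ω) n 0 ∧ F.linkState 0 (config X K ω n) = s} := fun n => by
    have hn : MeasurableSet {ω | F.linkState 0 (X n ω, K n ω) = s} := hY.measurable n hst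
    have e : ∀ ω, {b : Plane × M | F.linkState 0 b = s}.indicator (1 : Plane × M → ℝ≥0∞)
        (X n ω, K n ω) = {ω | F.linkState 0 (X n ω, K n ω) = s}.indicator 1 ω := fun ω => rfl
    simp_rw [e]
    rw [lintegral_indicator_one hn, Measure.restrict_apply hn, inter_comm]
    congr 1
    ext ω
    refine and_congr_left fun _ => ⟨fun hk k => ?_, fun hk k _ => not_lt.2 (hk k)⟩
    by_cases hkn : k = n
    · rw [hkn]
    · exact not_lt.1 (hk k hkn)
  simp_rw [hl] at h
  rw [h]
  have h1 : ∀ y : Plane × M, N.bsIntensity ν (Prod.mk y ⁻¹'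
      {q : (Plane × M) × (Plane × M) | F.invPower 0 q.2 < F.invPower 0 q.1}) =
      ∑ t, N.linkIntensity t (Iio (F.invPower 0 y)) := fun y =>
    F.bsIntensity_invPower_mem 0 (U := fun _ => Iio (F.invPower 0 y)) fun _ => measurableSet_Iio
  simp_rw [h1]
  have hlink := F.lintegral_link 0 (φ := fun t => if t = s then fun q : ℝ × ℝ =>
    expNeg (∑ t, N.linkIntensity t (Iio (N.pathLoss s q.1 / q.2))) else 0) fun t => by
      split_ifs
      · exact N.measurable_expNeg_linkIntensity_pathLoss s
      · exact measurable_zero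
  rw [Finset.sum_eq_single s (fun t _ ht => by simp [ht]) (by simp)] at hlink
  simp only [if_true] at hlink
  refine Eq.trans (lintegral_congr fun b => ?_) hlink
  by_cases hb : F.linkState 0 b = s
  · rw [indicator_of_mem (by exact hb), if_pos hb, Pi.one_apply, one_mul, invPower, hb]
  · rw [indicator_of_notMem (by exact hb), if_neg hb, zero_mul]
    rfl

/-- Uniqueness of the server makes the events over n almost surely disjoint, so the mean number of
servers in state s is the probability that there is one. -/
lemma assocProb_eq
    (hY : HasPoissonLaplace P (N.bsIntensity ν) fun n ω => (X n ω, K n ω)) (s : S) :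
    assocProb P F X K s = ENNReal.ofReal (2 * Real.pi * N.lam) *
        ∫⁻ r in Ioi (0 : ℝ), N.coverage s r * ENNReal.ofReal (N.p s r * r) := by
  rw [← F.tsum_measure_serves hY, assocProb, ofPred_exists, measure_iUnion₀]
  · intro n k hnk
    refine measure_mono_null ?_ (ae_iff.1 (F.ae_regular hY))
    exact fun ω hω hreg => hnk (hreg.serves_unique hω.1.1 hω.2.1)
  · exact fun n => ((measurable_config hY) ((F.measurableSet_serves n).inter
      (F.measurableSet_linkState n s))).nullMeasurableSet

omit [IsProbabilityMeasure ν] [IsProbabilityMeasure P] in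
lemma measurableSet_assoc
    (hY : HasPoissonLaplace P (N.bsIntensity ν) fun n ω => (X n ω, K n ω)) (s : S) :
    MeasurableSet
      {ω | ∃ n, F.Serves (config X K ω) n 0 ∧ F.linkState 0 (config X K ω n) = s} := by
  rw [ofPred_exists]
  exact MeasurableSet.iUnion fun n => (measurable_config hY) ((F.measurableSet_serves n).inter
      (F.measurableSet_linkState n s))

lemma sum_assocProb
    (hY : HasPoissonLaplace P (N.bsIntensity ν) fun n ω => (X n ω, K n ω)) :
    ∑ s, assocProb P F X K s = 1 := by
  unfold assocProb
  rw [← tsum_fintype (L := .unconditional _), ← measure_iUnion₀]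
  · rw [← prob_compl_eq_zero_iff₀]
    · refine measure_mono_null ?_ (ae_iff.1 (F.ae_regular hY))
      intro ω hω hreg
      obtain ⟨n, hn⟩ := hreg.exists_serves
      exact hω (mem_iUnion.2 ⟨_, n, hn, rfl⟩)
    · exact (MeasurableSet.iUnion fun s => F.measurableSet_assoc hY s).nullMeasurableSet
  · intro s t hst
    refine measure_mono_null ?_ (ae_iff.1 (F.ae_regular hY))
    rintro ω ⟨⟨n, hn, hs⟩, k, hk, ht⟩ hreg
    rw [hreg.serves_unique hn hk] at hs
    exact hst (hs.symm.trans ht)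
  · exact fun s => (F.measurableSet_assoc hY s).nullMeasurableSet

lemma assocProb_eq_measure
    (hY : HasPoissonLaplace P (N.bsIntensity ν) fun n ω => (X n ω, K n ω)) (s : S) :
    assocProb P F X K s = P {ω | minLink F X K s ω ≠ ⊤ ∧
      ∀ t, t ≠ s → minLink F X K s ω < minLink F X K t ω} := by
  refine measure_congr ?_
  filter_upwards [F.ae_regular hY] with ω hω
  exact propext (hω.exists_serves_iff s)

/-- Joint void probabilities at the origin. -/
lemma measure_lt_minLink_finset
    (hY : HasPoissonLaplace P (N.bsIntensity ν) fun n ω => (X n ω, K n ω)) (T : Finset S)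
    {x : S → ℝ} (hx : ∀ s, 0 ≤ x s) :
    P {ω | ∀ s ∈ T, ENNReal.ofReal (x s) < minLink F X K s ω} =
      ∏ s ∈ T, ENNReal.ofReal (Real.exp (-N.Lambda s (x s))) := by
  classical
  -- States outside `T` are unconstrained, so their forbidden set is empty.
  have hU : ∀ s, MeasurableSet (if s ∈ T then Iic (x s) else ∅) := fun s => by
    split_ifs
    · exact measurableSet_Iic
    · exact MeasurableSet.empty
  have hUm : MeasurableSet
      {b : Plane × M | F.invPower 0 b ∈ (if F.linkState 0 b ∈ T then Iic (x (F.linkState 0 b))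
        else ∅)} := by
    have : {b : Plane × M | F.invPower 0 b ∈ (if F.linkState 0 b ∈ T then
        Iic (x (F.linkState 0 b)) else ∅)} =
        ⋃ s ∈ T, {b | F.linkState 0 b = s} ∩ {b | F.invPower 0 b ∈ Iic (x s)} := by
      ext b
      by_cases hb : F.linkState 0 b ∈ T <;> simp [hb]
    rw [this]
    exact T.measurableSet_biUnion fun s _ =>
      (F.measurable_linkState_right 0 (measurableSet_singleton s)).inter
        (F.measurable_invPower_right 0 measurableSet_Iic)
  have h := hY.measure_void hUm
  rw [F.bsIntensity_invPower_mem 0 (U := fun s => if s ∈ T then Iic (x s) else ∅) hU] at h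
  have hsum : ∑ s, N.linkIntensity s (if s ∈ T then Iic (x s) else ∅) =
      ∑ s ∈ T, ENNReal.ofReal (N.Lambda s (x s)) := by
    rw [← Finset.sum_subset T.subset_univ]
    · refine Finset.sum_congr rfl fun s hs => ?_
      rw [if_pos hs, N.linkIntensity_Iic s (hx s)]
    · intro s _ hs
      rw [if_neg hs]
      exact N.linkIntensity_eq_zero s measure_empty
  rw [hsum, expNeg_sum] at h
  simp_rw [expNeg_ofReal (N.Lambda_nonneg _ (hx _))] at h
  rw [← h]
  refine measure_congr ?_
  filter_upwards [F.ae_regular hY] with ω hω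
  refine propext ⟨fun hT k hk => ?_, fun hk s hs => ?_⟩
  · by_cases hkT : F.linkState 0 (X k ω, K k ω) ∈ T
    · rw [if_pos hkT] at hk
      exact (mem_Iic.1 hk).not_gt ((hω.lt_minInvPower_iff _).1 (hT _ hkT) k rfl)
    · rw [if_neg hkT] at hk
      exact hk
  · refine (hω.lt_minInvPower_iff s).2 fun k hks => ?_
    have hks' : F.linkState 0 (X k ω, K k ω) = s := hks
    have := hk k
    rw [hks', if_pos hs] at this
    exact not_le.1 this

lemma measure_lt_minLink
    (hY : HasPoissonLaplace P (N.bsIntensity ν) fun n ω => (X n ω, K n ω)) (s : S)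
    {x : ℝ} (hx : 0 ≤ x) :
    P {ω | ENNReal.ofReal x < minLink F X K s ω} =
      ENNReal.ofReal (Real.exp (-N.Lambda s x)) := by
  simpa using F.measure_lt_minLink_finset hY {s} (x := fun _ => x) fun _ => hx

/-- The minima over the different link states are independent. -/
lemma iIndepFun_minLink
    (hY : HasPoissonLaplace P (N.bsIntensity ν) fun n ω => (X n ω, K n ω)) :
    iIndepFun (fun s => minLink F X K s) P := by
  -- The half-lines (a, ∞] form a generating π-system, and on them independence is the factorization
  -- of the joint void probabilities.
  have hpi : IsPiSystem (range (Ioi : ℝ≥0∞ → Set ℝ≥0∞)) := isPiSystem_Ioi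
  refine (iIndepFun_iff_iIndep _ _ _).2 ?_
  refine iIndepSets.iIndep (fun s => (F.measurable_minLink hY s).comap_le)
    (fun s => {A | ∃ C ∈ range (Ioi : ℝ≥0∞ → Set ℝ≥0∞), minLink F X K s ⁻¹' C = A})
    (fun s => hpi.comap _) (fun s => ?_) ?_
  · rw [BorelSpace.measurable_eq (α := ℝ≥0∞), borel_eq_generateFrom_Ioi,
      MeasurableSpace.comap_generateFrom]
    rfl
  · refine (iIndepSets_iff _ _).2 fun T f hf => ?_
    choose! C hC hCf using hf
    choose! x hx using hC
    have hf' : ∀ s ∈ T, f s = {ω | x s < minLink F X K s ω} := fun s hs => by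
      rw [← hCf s hs, ← hx s hs]
      rfl
    -- The void formula takes real thresholds only. For an infinite threshold the event is empty and
    -- both sides are 0.
    by_cases htop : ∃ s ∈ T, x s = ⊤
    · obtain ⟨s, hs, hxs⟩ := htop
      have h0 : f s = ∅ := by
        rw [hf' s hs, hxs]
        simp
      rw [Finset.prod_eq_zero hs (by rw [h0, measure_empty])]
      exact measure_mono_null (biInter_subset_of_mem hs) (by rw [h0, measure_empty])
    · push Not at htop
      have hr : ∀ s ∈ T, ENNReal.ofReal (x s).toReal = x s := fun s hs =>
        ENNReal.ofReal_toReal (htop s hs)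
      have h1 := F.measure_lt_minLink_finset hY T (x := fun s => (x s).toReal)
        fun s => ENNReal.toReal_nonneg
      have h2 : ⋂ s ∈ T, f s =
          {ω | ∀ s ∈ T, ENNReal.ofReal (x s).toReal < minLink F X K s ω} := by
        ext ω
        simp only [mem_iInter, mem_ofPred_eq]
        refine forall₂_congr fun s hs => ?_
        rw [hf' s hs, hr s hs]
        rfl
      rw [h2, h1]
      refine Finset.prod_congr rfl fun s hs => ?_
      rw [hf' s hs, ← F.measure_lt_minLink hY s ENNReal.toReal_nonneg, hr s hs]

end LinkField

/-! ### Comparison of independent variables -/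

section Comparison

variable {Ω : Type*} [MeasurableSpace Ω] {P : Measure Ω} [IsProbabilityMeasure P]
  {L L' : Ω → ℝ≥0∞}

lemma measurable_measure_lt (L : Ω → ℝ≥0∞) (P : Measure Ω) :
    Measurable fun a => P {ω | a < L ω} :=
  Antitone.measurable fun _ _ hab => measure_mono fun _ h => lt_of_le_of_lt hab h

lemma ProbabilityTheory.IndepFun.measure_inter_lt (h : IndepFun L L' P) (hL : Measurable L)
    (hL' : Measurable L') {D : Set ℝ≥0∞} (hD : MeasurableSet D) :
    P (L ⁻¹' D ∩ {ω | L ω < L' ω}) = ∫⁻ ω in L ⁻¹' D, P {ω' | L ω < L' ω'} ∂P := by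
  have hA : MeasurableSet {q : ℝ≥0∞ × ℝ≥0∞ | q.1 ∈ D ∧ q.1 < q.2} :=
    (measurable_fst hD).inter (measurableSet_lt measurable_fst measurable_snd)
  have hprod := (indepFun_iff_map_prod_eq_prod_map_map hL.aemeasurable hL'.aemeasurable).1 h
  have := Measure.isProbabilityMeasure_map (μ := P) hL'.aemeasurable
  have h1 : P (L ⁻¹' D ∩ {ω | L ω < L' ω}) =
      P.map (fun ω => (L ω, L' ω)) {q : ℝ≥0∞ × ℝ≥0∞ | q.1 ∈ D ∧ q.1 < q.2} := by
    rw [Measure.map_apply (hL.prodMk hL') hA]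
    rfl
  rw [h1, hprod, Measure.prod_apply hA, lintegral_map (measurable_measure_prodMk_left hA) hL,
    ← lintegral_indicator (hL hD)]
  refine lintegral_congr fun ω => ?_
  rw [Measure.map_apply hL' (measurable_prodMk_left hA)]
  by_cases hω : L ω ∈ D
  · rw [indicator_of_mem (by exact hω)]
    congr 1
    ext ω'
    simp [hω]
  · rw [indicator_of_notMem (by exact hω)]
    simp [hω]

/-- Conditional probability, given `L`, that an independent variable exceeds `L`. -/
lemma ProbabilityTheory.IndepFun.condProb_lt (h : IndepFun L L' P) (hL : Measurable L)
    (hL' : Measurable L') :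
    P⟦{ω | L ω < L' ω} | MeasurableSpace.comap L inferInstance⟧ =ᵐ[P]
      fun ω => (P {ω' | L ω < L' ω'}).toReal := by
  have hA : MeasurableSet {ω | L ω < L' ω} := measurableSet_lt hL hL'
  have hG := measurable_measure_lt L' P
  have hGL : Measurable fun ω => (P {ω' | L ω < L' ω'}).toReal :=
    hG.ennreal_toReal.comp hL
  have hle : ∀ ω, ‖(P {ω' | L ω < L' ω'}).toReal‖ ≤ 1 := fun ω => by
    rw [Real.norm_of_nonneg ENNReal.toReal_nonneg]
    exact measureReal_le_one
  have hint : Integrable (fun ω => (P {ω' | L ω < L' ω'}).toReal) P :=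
    Integrable.of_bound hGL.aestronglyMeasurable 1 (Filter.Eventually.of_forall hle)
  refine (ae_eq_condExp_of_forall_setIntegral_eq hL.comap_le ?_ (fun s _ _ => hint.integrableOn)
    ?_ ?_).symm
  · exact (integrable_const _).indicator hA
  · rintro _ ⟨D, hD, rfl⟩ -
    have hm : Measurable fun ω => P {ω' | L ω < L' ω'} := hG.comp hL
    rw [integral_toReal hm.aemeasurable (Filter.Eventually.of_forall fun ω => measure_lt_top P _),
      ← h.measure_inter_lt hL hL' hD, setIntegral_indicator hA, setIntegral_const]
    simp [Measure.real]
  · exact (hG.ennreal_toReal.comp (comap_measurable L)).aestronglyMeasurable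

/-- Probability that one of finitely many independent variables is the strict minimum. -/
lemma ProbabilityTheory.iIndepFun.measure_ne_top_forall_lt {S : Type*} [DecidableEq S] [Fintype S]
    {L : S → Ω → ℝ≥0∞} (h : iIndepFun L P) (hL : ∀ s, Measurable (L s)) (s : S)
    {D : Set ℝ≥0∞} (hD : MeasurableSet D) :
    P {ω | L s ω ∈ D ∧ ∀ t, t ≠ s → L s ω < L t ω} =
      ∫⁻ ω in L s ⁻¹' D, ∏ t ∈ Finset.univ.erase s, P {ω' | L s ω < L t ω'} ∂P := by
  set T := Finset.univ.erase s with hT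
  have hm : Measurable fun ω (t : T) => L t ω := measurable_pi_lambda _ fun t => hL t
  have hind : IndepFun (L s) (fun ω (t : T) => L t ω) P := by
    have h1 := h.indepFun_finset {s} T (by simp [hT]) hL
    exact h1.comp (φ := fun g : ({s} : Finset S) → ℝ≥0∞ => g ⟨s, Finset.mem_singleton_self s⟩)
      (ψ := id) (measurable_pi_apply _) measurable_id
  have hprod := (indepFun_iff_map_prod_eq_prod_map_map (hL s).aemeasurable hm.aemeasurable).1 hind
  have hA : MeasurableSet {q : ℝ≥0∞ × (T → ℝ≥0∞) | q.1 ∈ D ∧ ∀ t, q.1 < q.2 t} := by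
    have hlt : MeasurableSet {q : ℝ≥0∞ × (T → ℝ≥0∞) | ∀ t, q.1 < q.2 t} := by
      rw [ofPred_forall]
      exact MeasurableSet.iInter fun t => measurableSet_lt measurable_fst
        ((measurable_pi_apply t).comp measurable_snd)
    exact (measurable_fst hD).inter hlt
  have := Measure.isProbabilityMeasure_map (μ := P) hm.aemeasurable
  have h1 : P {ω | L s ω ∈ D ∧ ∀ t, t ≠ s → L s ω < L t ω} =
      P.map (fun ω => (L s ω, fun t : T => L t ω))
        {q : ℝ≥0∞ × (T → ℝ≥0∞) | q.1 ∈ D ∧ ∀ t, q.1 < q.2 t} := by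
    rw [Measure.map_apply ((hL s).prodMk hm) hA]
    congr 1
    ext ω
    simp [hT]
  rw [h1, hprod, Measure.prod_apply hA, lintegral_map (measurable_measure_prodMk_left hA) (hL s),
    ← lintegral_indicator (hL s hD)]
  refine lintegral_congr fun ω => ?_
  rw [Measure.map_apply hm (measurable_prodMk_left hA)]
  by_cases hω : L s ω ∈ D
  · rw [indicator_of_mem (by exact hω)]
    have h2 := iIndepFun_iff_measure_inter_preimage_eq_mul.1 h T
      (sets := fun _ => Ioi (L s ω)) fun _ _ => measurableSet_Ioi
    refine Eq.trans ?_ h2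
    congr 1
    ext ω'
    simp [hω, hT]
  · rw [indicator_of_notMem (by exact hω)]
    simp [hω]

end Comparison

/-! ### Conditional and density forms of the association probabilities -/

namespace LinkField

variable {S : Type*} [Fintype S] [MeasurableSpace S] [MeasurableSingletonClass S]
  {N : NetworkParams S} {M : Type*} [MeasurableSpace M] {ν : Measure M} (F : LinkField N ν)
  {Ω : Type*} [MeasurableSpace Ω] {X : ℕ → Ω → Plane} {K : ℕ → Ω → M}
  [IsProbabilityMeasure ν] {P : Measure Ω} [IsProbabilityMeasure P]

/-- A finite minimum is attained by a link in state s, and almost surely no such link has its value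
in a given Lebesgue-null set, since that set has intensity zero. -/
lemma minLinkLaw_absolutelyContinuous
    (hY : HasPoissonLaplace P (N.bsIntensity ν) fun n ω => (X n ω, K n ω)) (s : S) :
    minLinkLaw P F X K s ≪ volume := by
  have hL := F.measurable_minLink hY s
  refine Measure.AbsolutelyContinuous.mk fun U hU hU0 => ?_
  have hset : MeasurableSet {b : Plane × M | F.linkState 0 b = s ∧ F.invPower 0 b ∈ U} :=
    (F.measurable_linkState_right 0 (measurableSet_singleton s)).inter
      (F.measurable_invPower_right 0 hU)
  have hnot := hY.ae_notMem hset
    ((F.bsIntensity_linkState_invPower 0 s hU).trans (N.linkIntensity_eq_zero s hU0))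
  rw [minLinkLaw, Measure.map_apply hL.ennreal_toReal hU,
    Measure.restrict_apply (hL.ennreal_toReal hU)]
  have hbad : ∀ᵐ ω ∂P, ω ∉ (fun ω => (minLink F X K s ω).toReal) ⁻¹' U ∩
      {ω | minLink F X K s ω ≠ ⊤} := by
    filter_upwards [hnot, F.ae_regular hY] with ω hω hreg hmem
    obtain ⟨n, hn, he⟩ := hreg.minInvPower_eq s hmem.2
    refine hω n ⟨hn, ?_⟩
    have h1 : (F.minInvPower s (config X K ω)).toReal ∈ U := hmem.1
    rw [he, ENNReal.toReal_ofReal (hreg.pos n).le] at h1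
    exact h1
  exact measure_eq_zero_iff_ae_notMem.2 hbad

lemma minLinkLaw_Iic_zero
    (hY : HasPoissonLaplace P (N.bsIntensity ν) fun n ω => (X n ω, K n ω)) (s : S) :
    minLinkLaw P F X K s (Iic 0) = 0 := by
  have hL := F.measurable_minLink hY s
  rw [minLinkLaw, Measure.map_apply hL.ennreal_toReal measurableSet_Iic,
    Measure.restrict_apply (hL.ennreal_toReal measurableSet_Iic)]
  have hbad : ∀ᵐ ω ∂P, ω ∉ (fun ω => (minLink F X K s ω).toReal) ⁻¹' Iic 0 ∩
      {ω | minLink F X K s ω ≠ ⊤} := by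
    filter_upwards [F.ae_regular hY] with ω hreg hmem
    obtain ⟨n, hn, he⟩ := hreg.minInvPower_eq s hmem.2
    have h1 : (F.minInvPower s (config X K ω)).toReal ≤ 0 := hmem.1
    rw [he, ENNReal.toReal_ofReal (hreg.pos n).le] at h1
    exact h1.not_gt (hreg.pos n)
  exact measure_eq_zero_iff_ae_notMem.2 hbad

variable [DecidableEq S]

lemma assocProb_eq_lintegral
    (hY : HasPoissonLaplace P (N.bsIntensity ν) fun n ω => (X n ω, K n ω)) (s : S) :
    assocProb P F X K s = ∫⁻ ω in {ω | minLink F X K s ω ≠ ⊤},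
      ∏ t ∈ Finset.univ.erase s, P {ω' | minLink F X K s ω < minLink F X K t ω'} ∂P := by
  rw [F.assocProb_eq_measure hY]
  exact (F.iIndepFun_minLink hY).measure_ne_top_forall_lt (F.measurable_minLink hY) s
    (D := {⊤}ᶜ) (measurableSet_singleton ⊤).compl

/-- The event L_s = ∞ adds nothing: any other state would have to exceed ∞ strictly, and if there is
no other state then every link is in state s and L_s is finite. -/
lemma assocProb_eq_lintegral_univ
    (hY : HasPoissonLaplace P (N.bsIntensity ν) fun n ω => (X n ω, K n ω)) (s : S) :
    assocProb P F X K s =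
      ∫⁻ ω, ∏ t ∈ Finset.univ.erase s, P {ω' | minLink F X K s ω < minLink F X K t ω'} ∂P := by
  have h1 := (F.iIndepFun_minLink hY).measure_ne_top_forall_lt (F.measurable_minLink hY) s
    MeasurableSet.univ
  rw [preimage_univ, Measure.restrict_univ] at h1
  rw [← h1]
  refine measure_congr ?_
  filter_upwards [F.ae_regular hY] with ω hω
  refine propext ⟨fun h => ⟨mem_univ _, ((hω.exists_serves_iff s).1 h).2⟩, fun h => ?_⟩
  refine (hω.exists_serves_iff s).2 ⟨?_, h.2⟩
  by_cases hs : ∃ t, t ≠ s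
  · obtain ⟨t, ht⟩ := hs
    exact (h.2 t ht).ne_top
  · push Not at hs
    exact ((minInvPower_le (hs (F.linkState 0 (config X K ω 0)))).trans_lt
      ENNReal.ofReal_lt_top).ne

lemma toReal_assocProb
    (hY : HasPoissonLaplace P (N.bsIntensity ν) fun n ω => (X n ω, K n ω)) (s : S) :
    (assocProb P F X K s).toReal = ∫ ω, ∏ t ∈ Finset.univ.erase s,
      (P⟦{ω' | minLink F X K s ω' < minLink F X K t ω'} |
        MeasurableSpace.comap (minLink F X K s) inferInstance⟧) ω ∂P := by
  have hL := F.measurable_minLink hY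
  have hc : ∀ᵐ ω ∂P, ∀ t ∈ Finset.univ.erase s,
      (P⟦{ω' | minLink F X K s ω' < minLink F X K t ω'} |
        MeasurableSpace.comap (minLink F X K s) inferInstance⟧) ω =
        (P {ω' | minLink F X K s ω < minLink F X K t ω'}).toReal := by
    refine (Filter.eventually_all_finset _).2 fun t ht => ?_
    exact ((F.iIndepFun_minLink hY).indepFun (Finset.ne_of_mem_erase ht).symm).condProb_lt
      (hL s) (hL t)
  have hm : Measurable fun ω => ∏ t ∈ Finset.univ.erase s,
      P {ω' | minLink F X K s ω < minLink F X K t ω'} :=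
    Finset.measurable_prod _ fun t _ => (measurable_measure_lt (minLink F X K t) P).comp (hL s)
  rw [F.assocProb_eq_lintegral_univ hY, ← integral_toReal hm.aemeasurable]
  · refine integral_congr_ae ?_
    filter_upwards [hc] with ω hω
    rw [ENNReal.toReal_prod]
    exact Finset.prod_congr rfl fun t ht => (hω t ht).symm
  · exact Filter.Eventually.of_forall fun ω =>
      ENNReal.prod_lt_top fun t _ => measure_lt_top P _

lemma assocProb_eq_lintegral_pdf
    (hY : HasPoissonLaplace P (N.bsIntensity ν) fun n ω => (X n ω, K n ω)) (s : S) :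
    assocProb P F X K s = ∫⁻ x in Ioi (0 : ℝ),
      (∏ t ∈ Finset.univ.erase s, P {ω | ENNReal.ofReal x < minLink F X K t ω}) *
        minLinkPDF P F X K s x := by
  have hL := F.measurable_minLink hY s
  have hset : MeasurableSet {ω | minLink F X K s ω ≠ ⊤} := hL (measurableSet_singleton ⊤).compl
  have hG : Measurable fun x : ℝ => ∏ t ∈ Finset.univ.erase s,
      P {ω | ENNReal.ofReal x < minLink F X K t ω} :=
    Finset.measurable_prod _ fun t _ =>
      (measurable_measure_lt (minLink F X K t) P).comp ENNReal.measurable_ofReal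
  have : IsFiniteMeasure (minLinkLaw P F X K s) := by
    unfold minLinkLaw
    infer_instance
  have h1 : assocProb P F X K s = ∫⁻ x, ∏ t ∈ Finset.univ.erase s,
      P {ω | ENNReal.ofReal x < minLink F X K t ω} ∂(minLinkLaw P F X K s) := by
    rw [F.assocProb_eq_lintegral hY, minLinkLaw, lintegral_map hG hL.ennreal_toReal]
    refine setLIntegral_congr_fun hset fun ω hω => ?_
    simp only [ENNReal.ofReal_toReal hω]
  have h2 : (minLinkLaw P F X K s).restrict (Ioi 0) = minLinkLaw P F X K s := by
    refine Measure.restrict_eq_self_of_ae_mem ?_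
    filter_upwards [measure_eq_zero_iff_ae_notMem.1 (F.minLinkLaw_Iic_zero hY s)] with x hx
    exact not_le.1 (notMem_Iic.1 hx).not_ge
  rw [h1]
  -- Absolute continuity makes the Radon–Nikodym derivative a true density, and the law charges only
  -- the positive half-line.
  conv_lhs => rw [← h2, ← Measure.withDensity_rnDeriv_eq _ _
    (F.minLinkLaw_absolutelyContinuous hY s), restrict_withDensity measurableSet_Ioi]
  rw [lintegral_withDensity_eq_lintegral_mul _ (Measure.measurable_rnDeriv _ _) hG]
  refine lintegral_congr fun x => ?_
  rw [Pi.mul_apply, mul_comm]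
  rfl

end LinkField

end

/-! ### Assembly -/

theorem lemma1
    {S : Type*} [Fintype S] [DecidableEq S] [MeasurableSpace S] [MeasurableSingletonClass S]
    (N : NetworkParams S)
    {M : Type*} [MeasurableSpace M] (ν : Measure M) [IsProbabilityMeasure ν]
    (F : LinkField N ν)
    {Ω : Type*} [MeasurableSpace Ω] (P : Measure Ω) [IsProbabilityMeasure P]
    (X : ℕ → Ω → Plane) (K : ℕ → Ω → M)
    (hX : IsHomogeneousPPP P N.lam X) (hK : IsIndependentMarking P X ν K) :
    -- the Palm mean area of the cells, for any choice of the window in the Palm distribution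
    (∀ W : Set Plane, MeasurableSet W → volume W ≠ 0 → volume W ≠ ⊤ →
      IsProbabilityMeasure (palm P N.lam X K W) ∧
      -- the area of the cell of the typical base station is a random variable
      Measurable (fun a : ℕ × Config M => volume (F.cell a.2 a.1)) ∧
      -- the integral of the coverage probabilities, then the form with independent states;
      -- `r • u` is any location at distance `r` from the typical base station
      (∀ u : Plane, ‖u‖ = 1 →
        meanCellArea F (palm P N.lam X K W) =
          ENNReal.ofReal (2 * Real.pi) * ∑ s, ∫⁻ r in Ioi (0 : ℝ),
            (ProbabilityTheory.cond (palm P N.lam X K W)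
                {a | F.linkState (r • u) (a.2 a.1) = s})
              {a | r • u ∈ F.cell a.2 a.1} * ENNReal.ofReal (N.p s r * r) ∧
        meanCellArea F (palm P N.lam X K W) =
          ENNReal.ofReal (2 * Real.pi) * ∑ s, ∫⁻ r in Ioi (0 : ℝ),
            (∫⁻ x, ∏ t, (palm P N.lam X K W)
                {a | ∀ k, k ≠ a.1 → F.linkState (r • u) (a.2 k) = t →
                  N.pathLoss s r / x < F.invPower (r • u) (a.2 k)} ∂(N.shadowLaw s)) *
              ENNReal.ofReal (N.p s r * r)) ∧
      -- explicit form, by the void probabilities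
      meanCellArea F (palm P N.lam X K W) =
        ENNReal.ofReal (2 * Real.pi) * ∑ s, ∫⁻ r in Ioi (0 : ℝ),
          (∫⁻ x, ENNReal.ofReal (Real.exp (-∑ t, 2 * Real.pi * N.lam *
              ∫ x', (∫ ρ in (0 : ℝ)..N.cRadius s t r x' x, N.p t ρ * ρ) ∂(N.shadowLaw t)))
            ∂(N.shadowLaw s)) * ENNReal.ofReal (N.p s r * r) ∧
      -- form with the association probabilities, and the value
      meanCellArea F (palm P N.lam X K W) =
        ∑ s, assocProb P F X K s / ENNReal.ofReal N.lam ∧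
      meanCellArea F (palm P N.lam X K W) = 1 / ENNReal.ofReal N.lam) ∧
    -- the association probabilities
    (∀ s : S,
      (assocProb P F X K s).toReal =
        ∫ ω, ∏ t ∈ Finset.univ.erase s,
          (P⟦{ω' | minLink F X K s ω' < minLink F X K t ω'} |
            MeasurableSpace.comap (minLink F X K s) inferInstance⟧) ω ∂P ∧
      minLinkLaw P F X K s ≪ volume ∧
      assocProb P F X K s =
        ∫⁻ x in Ioi (0 : ℝ),
          (∏ t ∈ Finset.univ.erase s, P {ω | ENNReal.ofReal x < minLink F X K t ω}) *
            minLinkPDF P F X K s x ∧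
      ∀ x : ℝ, 0 ≤ x →
        P {ω | ENNReal.ofReal x < minLink F X K s ω} =
          ENNReal.ofReal (Real.exp (-N.Lambda s x))) := by
  have hlam := N.lam_pos
  have hY : HasPoissonLaplace P (N.bsIntensity ν) fun n ω => (X n ω, K n ω) := by
    have : SigmaFinite (ENNReal.ofReal N.lam • (volume : Measure Plane)) :=
      inferInstanceAs (SigmaFinite (N.lam.toNNReal • (volume : Measure Plane)))
    exact hK.hasPoissonLaplace (hX.hasPoissonLaplace hlam.le)
  refine ⟨fun W hW hW0 hW1 => ⟨isProbabilityMeasure_palm hY hW hW0 hW1, F.measurable_cellArea,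
    fun u hu => ⟨?_, ?_⟩, ?_, ?_⟩, fun s => ⟨F.toReal_assocProb hY s,
    F.minLinkLaw_absolutelyContinuous hY s, F.assocProb_eq_lintegral_pdf hY s,
    fun x hx => F.measure_lt_minLink hY s hx⟩⟩
  · rw [F.meanCellArea_palm hY hW hW0 hW1]
    congr 1
    refine Finset.sum_congr rfl fun s _ => setLIntegral_congr_fun measurableSet_Ioi fun r hr => ?_
    have hr' : ‖r • u‖ = r := by
      rw [norm_smul, hu, mul_one, Real.norm_of_nonneg (mem_Ioi.1 hr).le]
    have h := F.cond_palm_cell_mul hY hW hW0 hW1 (r • u) s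
    rw [hr'] at h
    exact h.symm
  · rw [F.meanCellArea_palm hY hW hW0 hW1]
    congr 1
    refine Finset.sum_congr rfl fun s _ => setLIntegral_congr_fun measurableSet_Ioi fun r hr => ?_
    simp only [F.lintegral_prod_palm_others hY hW hW0 hW1 (r • u) s (mem_Ioi.1 hr).le]
  · rw [F.meanCellArea_palm hY hW hW0 hW1]
    congr 1
    refine Finset.sum_congr rfl fun s _ => setLIntegral_congr_fun measurableSet_Ioi fun r hr => ?_
    simp only [N.integral_cRadius_eq_Lambda, N.coverage_eq s (mem_Ioi.1 hr).le]
  · have hassoc : meanCellArea F (palm P N.lam X K W) =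
        ∑ s, assocProb P F X K s / ENNReal.ofReal N.lam := by
      rw [F.meanCellArea_palm hY hW hW0 hW1, Finset.mul_sum]
      refine Finset.sum_congr rfl fun s _ => ?_
      have h0 : ENNReal.ofReal N.lam ≠ 0 := by simpa using hlam
      rw [F.assocProb_eq hY, ENNReal.ofReal_mul (p := 2 * Real.pi) (by positivity), mul_right_comm,
        div_eq_mul_inv,
        mul_assoc (_ * _), ENNReal.mul_inv_cancel h0 ENNReal.ofReal_ne_top, mul_one]
    refine ⟨hassoc, ?_⟩
    -- The numerator 1 is replaced by the sum of the association probabilities.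
    rw [hassoc, ← F.sum_assocProb hY, div_eq_mul_inv, Finset.sum_mul]
    rfl
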